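/- **Setting.** Let $p_1,p_2,\dots\in\mathbb C$ with $p_1\ne 0$. Write $x=x_1\in\mathbb R$, $N=n_1\in\mathbb Z$, $n\in\mathbb Z$, and keep the other variables $x_3,x_5,\dots\in\mathbb R$ and $n_2,n_3,\dots\in\mathbb Z$ fixed, all but finitely many of them zero. Put $$\rho_n(k)=e^{\sum_{j\ge0}k^{2j+1}x_{2j+1}}\prod_{i\ge1}\Big(\frac{p_i+k}{p_i-k}\Big)^{n_i}k^n,\qquad \sigma_n(k')=e^{\sum_{j\ge0}k'^{2j+1}x_{2j+1}}\prod_{i\ge1}\Big(\frac{p_i+k'}{p_i-k'}\Big)^{n_i}(-k')^{-n},\qquad \Omega(k,k')=\frac1{k+k'} .$$ Let $d\zeta=w\,d\mu$, with $\mu$ a $\sigma$-finite measure on $\mathbb C\times\mathbb C$ and $w$ a complex density, let $D\subseteq\mathbb C\times\mathbb C$ be measurable, let $J\subseteq\mathbb R$ be open, and let $K\subseteq\mathbb C$ contain the first projection of $D$. Assume: no $k\in K$ and no $k'$ with $(k,k')\in D$ for some $k$ equals $0$, $\pm p_1$, or $\pm p_i$ for an $i\geq 2$ with $n_i\neq0$;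 $k+l'\ne0$ and $|\Omega(k,l')|\le c\,(|k|+|k|^{-1})^m(|l'|+|l'|^{-1})^m$ for all $k\in K$, $(l,l')\in D$, with some constants $c,m$; and all the integrals $\iint_D d\zeta(k,k')\,\rho_n(k)k^ik'^j\sigma_n(k')$ ($i,j,n,N\in\mathbb Z$, $x\in J$) converge absolutely. Let $$\tau_n=\sum_{m\ge0}\frac1{m!}\int_{D^m}\det\big(\Omega(k_a,k_b')\big)_{a,b=1}^m\prod_{a=1}^m\rho_n(k_a)\sigma_n(k_a')\,d\zeta(k_a,k_a')$$ (the expansion of $\det(1+\mathbf\Omega\mathbf C_n)$, where $\mathbf C_n$ is the infinite matrix of the integrals above and $\mathbf\Omega$ represents the kernel). Call $(N,n,x)$ *regular* if $x\in J$ and $\tau_n\ne0$ there. Suppose that at every regular point the vector $\mathbf u_n(k)=(u_n^{(i)}(k))_{i\in\mathbb Z}$ solves $$u^{(i)}_n(k)+\iint_D d\zeta(l,l')\,\rho_n(k)\,\Omega(k,l')\,\sigma_n(l')\,u_n^{(i)}(l)=\rho_n(k)k^i\qquad(k\in K,\ i\in\mathbb Z),$$ and that all entries $U_n^{(i,j)}=\iint_D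 d\zeta(k,k')\,u_n^{(i)}(k)k'^j\sigma_n(k')$ converge absolutely. Set $\phi_n=u_n^{(0)}(k)$, $u_n=U_n^{(0,0)}$; a tilde denotes $N\mapsto N+1$. **Theorem.** 1. The series for $\tau_n$ converges absolutely for all $N,n\in\mathbb Z$, $x\in J$, and there is a choice of $\partial_1^{-1}u_n$ with $\partial_1(\partial_1^{-1}u_n)=u_n$ and $\exp(\partial_1^{-1}u_n)=\tau_n$ at every regular point. In the following $\partial_1^{-1}$ is any such choice, extended linearly. 2. (Lax pair) For all $k\in K$, $$\partial_1\phi_n=\phi_{n+1}+(u_{n+1}-u_n)\phi_n$$ wherever $(N,n,x)$ and $(N,n+1,x)$ are regular, and $$\widetilde\phi_{n+1}=\frac{2p_1+u_{n+1}-\widetilde u_{n+1}}{1+\exp[\partial_1^{-1}(\widetilde u_{n+1}-u_{n+1})-\partial_1^{-1}(\widetilde u_n-u_n)]}\widetilde\phi_n-\phi_{n+1}-\frac{2p_1+u_{n+1}-\widetilde u_{n+1}}{1+\exp[\partial_1^{-1}(u_{n+1}-\widetilde u_{n+1})-\partial_1^{-1}(u_n-\widetilde u_n)]}\phi_n$$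 wherever $(N,n,x),(N,n+1,x),(N+1,n,x),(N+1,n+1,x)$ are regular and the denominators do not vanish. 3. (Compatibility) For arbitrary functions $u_n$ (depending on $N,n,x$, differentiable in $x$ at the point considered) with antiderivatives $\partial_1^{-1}u_n$, and any $p_1\in\mathbb C$, the compatibility condition $\partial_1(\widetilde\phi_{n+1})=(\partial_1\phi)^{\sim}_{n+1}$ of the two equations in 2, required identically in $\phi$ modulo these equations, holds at $(N,n,x)$ if and only if the equation $$\partial_1\ln(2p_1+u_n-\widetilde u_n)=u_{n+1}-2u_n+u_{n-1}+(2p_1+u_n-\widetilde u_n)-\frac{2p_1+u_{n+1}-\widetilde u_{n+1}}{1+\exp[\partial_1^{-1}(u_{n+1}-\widetilde u_{n+1})-\partial_1^{-1}(u_n-\widetilde u_n)]}-\frac{2p_1+u_{n-1}-\widetilde u_{n-1}}{1+\exp[\partial_1^{-1}(u_{n-1}-\widetilde u_{n-1})-\partial_1^{-1}(u_n-\widetilde u_n)]}$$ holds at $(N,n+1,x)$, provided that $2p_1+u_{n+1}-\widetilde u_{n+1}$ and the denominators that occur do not vanish. (Here $\partial_1\ln f=\partial_1f/f$.) 4. In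 particular, the potential $u_n$ of the integral equation satisfies the equation in 3 at $(N,n,x)$ whenever $(M,m,x)$ is regular for $M\in\{N,N+1\}$, $m\in\{n-1,n,n+1\}$, and $2p_1+u_n-\widetilde u_n$ and the denominators do not vanish. -/

import Mathlib

open MeasureTheory

noncomputable section

namespace DirectLin

/-- The free data of the direct linearisation scheme. The complex measure `dζ(l,l')` on `ℂ × ℂ` is
`w · μ`, integrated over the domain `D`. The lattice parameters `p₁, p₂, …` are `p 0, p 1, …`.
The flow variables other than `x₁`, `n₁` and `n` are frozen at finitely supported values:
`xs j` is `x_{2j+3}` and `ns i` is `n_{i+2}`. -/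
structure Data where
  μ : Measure (ℂ × ℂ)
  w : ℂ × ℂ → ℂ
  D : Set (ℂ × ℂ)
  p : ℕ → ℂ
  xs : ℕ →₀ ℝ
  ns : ℕ →₀ ℤ

variable (S : Data)

/-- The part common to `ρ_n(k)` and `σ_n(k)`:
`exp(∑_j k^(2j+1) x_{2j+1}) ∏_i ((p_i + k)/(p_i - k))^{n_i}`, at `n₁ = N`, `x₁ = x`. -/
def flow (N : ℤ) (x : ℝ) (k : ℂ) : ℂ :=
  Complex.exp (k * x + ∑ j ∈ S.xs.support, k ^ (2 * j + 3) * (S.xs j : ℂ)) *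
    (((S.p 0 + k) / (S.p 0 - k)) ^ N *
      ∏ i ∈ S.ns.support, ((S.p (i + 1) + k) / (S.p (i + 1) - k)) ^ (S.ns i))

/-- The plane wave factor `ρ_n(k)` at `n₁ = N`, `x₁ = x`. -/
def rho (N n : ℤ) (x : ℝ) (k : ℂ) : ℂ := flow S N x k * k ^ n

/-- The plane wave factor `σ_n(k')` at `n₁ = N`, `x₁ = x`. -/
def sigma (N n : ℤ) (x : ℝ) (k' : ℂ) : ℂ := flow S N x k' * (-k') ^ (-n)

/-- The Cauchy kernel `Ω(k,k') = 1/(k+k')`. -/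
def Om (k k' : ℂ) : ℂ := 1 / (k + k')

/-- `k` is neither `0` nor a pole or a zero of the plane wave factors. -/
def NonSing (k : ℂ) : Prop :=
  k ≠ 0 ∧ (k ≠ S.p 0 ∧ k ≠ -S.p 0) ∧
    ∀ i ∈ S.ns.support, k ≠ S.p (i + 1) ∧ k ≠ -S.p (i + 1)

/-- The conditions under which the integrals of the scheme make sense, for spectral parameters
`k ∈ K` and for `x₁ ∈ J`: the plane wave factors are regular, the kernel has no pole and grows at
most polynomially in `|k|, 1/|k|, |k'|, 1/|k'|`, and every entry `∬ dζ ρ_n(k) k^i k'^j σ_n(k')`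
of the infinite matrix `C_n` converges absolutely. -/
structure Admissible (K : Set ℂ) (J : Set ℝ) : Prop where
  sigmaFinite : SigmaFinite S.μ
  measurableSet : MeasurableSet S.D
  p_ne_zero : S.p 0 ≠ 0
  fst_mem : ∀ z ∈ S.D, z.1 ∈ K
  nonSing_left : ∀ k ∈ K, NonSing S k
  nonSing_right : ∀ z ∈ S.D, NonSing S z.2
  kernel : ∃ (c : ℝ) (m : ℕ), ∀ k ∈ K, ∀ z ∈ S.D, k + z.2 ≠ 0 ∧
    ‖Om k z.2‖ ≤ c * (‖k‖ + ‖k‖⁻¹) ^ m * (‖z.2‖ + ‖z.2‖⁻¹) ^ m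
  moments : ∀ (N n i j : ℤ), ∀ x ∈ J,
    IntegrableOn (fun z => S.w z * (rho S N n x z.1 * z.1 ^ i * z.2 ^ j * sigma S N n x z.2))
      S.D S.μ

/-- `u : ℂ → ℤ → ℂ`, with `u k i` the `i`-th component of the infinite column vector `𝐮_n(k)`,
solves the linear integral equation
`𝐮_n(k) + ∬_D dζ(l,l') ρ_n(k) Ω(k,l') σ_n(l') 𝐮_n(l) = ρ_n(k) 𝐜(k)`, `𝐜(k)^{(i)} = k^i`,
for all `k ∈ K`, and its potential matrix is defined (all entries converge absolutely). -/
structure IsSolution (K : Set ℂ) (N n : ℤ) (x : ℝ) (u : ℂ → ℤ → ℂ) : Prop where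
  integrable : ∀ i j : ℤ,
    IntegrableOn (fun z => S.w z * (u z.1 i * z.2 ^ j * sigma S N n x z.2)) S.D S.μ
  eqn : ∀ k ∈ K, ∀ i : ℤ,
    u k i + ∫ z in S.D, S.w z * (rho S N n x k * Om k z.2 * sigma S N n x z.2 * u z.1 i) ∂S.μ
      = rho S N n x k * k ^ i

/-- The `(i,j)` entry of the potential matrix `𝐔_n = ∬_D dζ(k,k') 𝐮_n(k) ᵗ𝐜(k') σ_n(k')`. -/
def potential (u : ℤ → ℤ → ℝ → ℂ → ℤ → ℂ) (i j N n : ℤ) (x : ℝ) : ℂ :=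
  ∫ z in S.D, S.w z * (u N n x z.1 i * z.2 ^ j * sigma S N n x z.2) ∂S.μ

/-- The `m`-th term of the expansion of `det(1 + Ω C_n)`, i.e. the sum of the principal
`m × m` minors of `Ω C_n`:
`(1/m!) ∬_D ⋯ ∬_D det(Ω(k_a, k'_b))_{a,b} ∏_a ρ_n(k_a) σ_n(k'_a) dζ(k_a,k'_a)`. -/
def tauTerm (N n : ℤ) (x : ℝ) (m : ℕ) : ℂ :=
  ((m.factorial : ℂ))⁻¹ *
    ∫ z : Fin m → ℂ × ℂ,
      (Matrix.of fun a b : Fin m => Om (z a).1 (z b).2).det *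
        ∏ a, (S.w (z a) * (rho S N n x (z a).1 * sigma S N n x (z a).2))
      ∂(Measure.pi fun _ : Fin m => S.μ.restrict S.D)

/-- The tau function `τ_n = det(1 + Ω C_n)` at `n₁ = N`, `x₁ = x`. -/
def tau (N n : ℤ) (x : ℝ) : ℂ := ∑' m : ℕ, tauTerm S N n x m

/-- `(n₁, n, x₁) = (N, n, x)` is a point with `x₁ ∈ J` at which `1 + Ω C_n` is invertible. -/
def Regular (J : Set ℝ) (N n : ℤ) (x : ℝ) : Prop := x ∈ J ∧ tau S N n x ≠ 0

/-- `θ N n` is the antiderivative `∂₁⁻¹ u_n` in `x₁`, its integration constants being those of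
`∂₁⁻¹ u_n = ln τ_n` (any branch of the logarithm). -/
def IsInvDeriv (J : Set ℝ) (v θ : ℤ → ℤ → ℝ → ℂ) : Prop :=
  ∀ N n x, Regular S J N n x →
    HasDerivAt (θ N n) (v N n x) x ∧ Complex.exp (θ N n x) = tau S N n x

end DirectLin

/-! The differential-difference equations. A field `v` is written `v N n x` with `N = n₁`, so that
the tilde is `N ↦ N + 1`; `θ N n` stands for `∂₁⁻¹ v_n`. -/
namespace SemiDiscreteKP

/-- `2 p₁ + v_n - ṽ_n`. -/
def amp (p : ℂ) (v : ℤ → ℤ → ℝ → ℂ) (N n : ℤ) (x : ℝ) : ℂ :=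
  2 * p + v N n x - v (N + 1) n x

/-- `1 + exp[∂₁⁻¹(v_m - ṽ_m) - ∂₁⁻¹(v_n - ṽ_n)]`. -/
def den (θ : ℤ → ℤ → ℝ → ℂ) (N m n : ℤ) (x : ℝ) : ℂ :=
  1 + Complex.exp ((θ N m x - θ (N + 1) m x) - (θ N n x - θ (N + 1) n x))

/-- `φ_{n+1} + (v_{n+1} - v_n) φ_n`, the right-hand side of the continuous Lax equation. -/
def laxA (v φ : ℤ → ℤ → ℝ → ℂ) (N n : ℤ) (x : ℝ) : ℂ :=
  φ N (n + 1) x + (v N (n + 1) x - v N n x) * φ N n x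

/-- The right-hand side of the discrete Lax equation (the equation for `φ̃_{n+1}`). -/
def laxB (p : ℂ) (v θ φ : ℤ → ℤ → ℝ → ℂ) (N n : ℤ) (x : ℝ) : ℂ :=
  (2 * p + v N (n + 1) x - v (N + 1) (n + 1) x) /
      (1 + Complex.exp ((θ (N + 1) (n + 1) x - θ N (n + 1) x) - (θ (N + 1) n x - θ N n x)))
      * φ (N + 1) n x
    - φ N (n + 1) x
    - (2 * p + v N (n + 1) x - v (N + 1) (n + 1) x) /
      (1 + Complex.exp ((θ N (n + 1) x - θ (N + 1) (n + 1) x) - (θ N n x - θ (N + 1) n x)))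
      * φ N n x

/-- The semi-discrete equation
`∂₁ ln(2p₁ + v_n - ṽ_n) = v_{n+1} - 2v_n + v_{n-1} + (2p₁ + v_n - ṽ_n)
  - (2p₁ + v_{n+1} - ṽ_{n+1}) / (1 + exp[∂₁⁻¹(v_{n+1} - ṽ_{n+1}) - ∂₁⁻¹(v_n - ṽ_n)])
  - (2p₁ + v_{n-1} - ṽ_{n-1}) / (1 + exp[∂₁⁻¹(v_{n-1} - ṽ_{n-1}) - ∂₁⁻¹(v_n - ṽ_n)])`
at `(N, n, x)`. -/
def Holds (p : ℂ) (v θ : ℤ → ℤ → ℝ → ℂ) (N n : ℤ) (x : ℝ) : Prop :=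
  DifferentiableAt ℝ (amp p v N n) x ∧
    logDeriv (amp p v N n) x =
      v N (n + 1) x - 2 * v N n x + v N (n - 1) x + amp p v N n x
        - amp p v N (n + 1) x / den θ N (n + 1) n x
        - amp p v N (n - 1) x / den θ N (n - 1) n x

/-- The compatibility condition `∂₁(φ̃_{n+1}) = (∂₁φ)~_{n+1}` of the Lax pair at `(N, n, x)`,
identically in the wave function: the right-hand side of the discrete Lax equation,
differentiated by means of the continuous one, agrees with the shift of the continuous one, in
which `φ̃_{n+1}` and `φ̃_{n+2}` are expressed by means of the discrete one. -/
def Compatible (p : ℂ) (v θ : ℤ → ℤ → ℝ → ℂ) (N n : ℤ) (x : ℝ) : Prop :=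
  ∀ φ : ℤ → ℤ → ℝ → ℂ,
    HasDerivAt (φ N n) (laxA v φ N n x) x →
    HasDerivAt (φ N (n + 1)) (laxA v φ N (n + 1) x) x →
    HasDerivAt (φ (N + 1) n) (laxA v φ (N + 1) n x) x →
    φ (N + 1) (n + 1) x = laxB p v θ φ N n x →
    φ (N + 1) (n + 2) x = laxB p v θ φ N (n + 1) x →
    HasDerivAt (laxB p v θ φ N n) (laxA v φ (N + 1) (n + 1) x) x

end SemiDiscreteKP

end

noncomputable section

namespace Fredholm

/-! ### Hadamard's inequality -/

/-! The linear integral equation is a Fredholm equation of the second kind on `D`, and `τ_n` is its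
Fredholm determinant. The kernel is bounded by a product `g(k) g'(k')` that is integrable against
the density on the diagonal, so Hadamard's inequality makes the determinant and all its bordered
variants converge absolutely (`summable_hadamard`). Cramer's rule (`fredholmDet_mul_sub_integral`)
turns `τ (γ - ∫ α h f)`, for a solution `f`, into a bordered determinant. Hence solutions are unique
where `τ ≠ 0`, and linear functionals of them are quotients of series that can be differentiated
termwise.

In `x₁` the density has exponential rate `k + k'`, the reciprocal of the Cauchy kernel.
Differentiation therefore multiplies a Cauchy determinant by `∑ (k_a + k'_a)`, which again gives a
bordered determinant. This yields `∂₁ τ = τ u` and the evolution of the amplitude `u/ρ`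
(`hasDerivAt_amplitude`). A step in `n` multiplies the density by `-k/k'`, and `-(k/k') Ω = Ω -
1/k'` is a rank-one change of the kernel, so `τ_{n+1}/τ_n` is a functional of the solution
(`tau_add_one`).

Multiplication by `k`, respectively by `(p₁+k)/(p₁-k)`, carries a solution at `n+1`, respectively at
`N+1`, to one at `n`, respectively at `N`. The new right-hand sides lie in the span of `1`, `k`,
`1/(p₁-k)`, so uniqueness gives a linear relation between four neighbouring amplitudes
(`four_term`). Its coefficients involve `B_n`, the amplitude at `k = p₁` one step ahead in `n₁`.
Integrating the relation against `1/k'` expresses the ratio of consecutive `B` through tau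
functions: `B_n V_{n+1} = p₁ B_{n+1} d`, with `V = 2p₁ + u - ũ` and `d` one of the exponential
denominators. This gives the discrete Lax equation. Solving it for `V_n` and taking the logarithmic
derivative gives the semi-discrete equation.

The compatibility statement is pure algebra. The two sides of the condition differ by the defect of
the equation times a combination of wave functions (`hasDerivAt_laxB`), and a suitable test wave
function makes that combination nonzero. -/

open scoped ComplexOrder in
-- AM-GM on the eigenvalues of `A* A`: their product is `|det A|²`, and their sum is the sum of all
-- `|A j i|²`, at most `n²`.
theorem sq_norm_det_le {n : ℕ} (A : Matrix (Fin n) (Fin n) ℂ) (hA : ∀ a b, ‖A a b‖ ≤ 1) :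
    ‖A.det‖ ^ 2 ≤ (n : ℝ) ^ n := by
  rcases Nat.eq_zero_or_pos n with rfl | hn
  · simp
  have hpos : (0 : ℝ) < n := by exact_mod_cast hn
  have hB := Matrix.posSemidef_conjTranspose_mul_self A
  set B := A.conjTranspose * A with hBdef
  set ev := hB.isHermitian.eigenvalues with hev
  have hev0 : ∀ i, 0 ≤ ev i := hB.eigenvalues_nonneg
  have hdet : ‖A.det‖ ^ 2 = ∏ i, ev i := by
    have h1 : B.det = ((∏ i, ev i : ℝ) : ℂ) := by
      rw [hB.isHermitian.det_eq_prod_eigenvalues]; push_cast; rfl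
    have h2 : B.det = ((‖A.det‖ ^ 2 : ℝ) : ℂ) := by
      rw [hBdef, Matrix.det_mul, Matrix.det_conjTranspose]
      push_cast
      exact Complex.conj_mul' _
    exact_mod_cast h2.symm.trans h1
  have htr : ∑ i, ev i ≤ (n : ℝ) * n := by
    have h1 : B.trace = ((∑ i, ev i : ℝ) : ℂ) := by
      rw [hB.isHermitian.trace_eq_sum_eigenvalues]; push_cast; rfl
    have h2 : B.trace = ((∑ i, ∑ j, ‖A j i‖ ^ 2 : ℝ) : ℂ) := by
      simp only [hBdef, Matrix.trace, Matrix.diag, Matrix.mul_apply, Matrix.conjTranspose_apply]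
      push_cast
      exact Finset.sum_congr rfl fun i _ => Finset.sum_congr rfl fun j _ => Complex.conj_mul' _
    have h3 : (∑ i, ev i) = ∑ i, ∑ j, ‖A j i‖ ^ 2 := by exact_mod_cast h1.symm.trans h2
    rw [h3]
    calc ∑ i, ∑ j, ‖A j i‖ ^ 2 ≤ ∑ _i : Fin n, ∑ _j : Fin n, (1 : ℝ) :=
          Finset.sum_le_sum fun i _ => Finset.sum_le_sum fun j _ =>
            pow_le_one₀ (norm_nonneg _) (hA j i)
      _ = n * n := by simp
  have hamgm := Real.geom_mean_le_arith_mean_weighted Finset.univ (fun _ : Fin n => (1 / n : ℝ)) ev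
    (fun _ _ => by positivity) (by simp [hpos.ne']) (fun i _ => hev0 i)
  have hle : ∏ i, ev i ^ (1 / n : ℝ) ≤ n := by
    refine hamgm.trans ?_
    rw [← Finset.mul_sum]
    calc (1 / n : ℝ) * ∑ i, ev i ≤ 1 / n * (n * n) := by gcongr
      _ = n := by field_simp
  rw [hdet]
  calc ∏ i, ev i = (∏ i, ev i ^ (1 / n : ℝ)) ^ n := by
        rw [← Finset.prod_pow]
        refine Finset.prod_congr rfl fun i _ => ?_
        rw [← Real.rpow_natCast, ← Real.rpow_mul (hev0 i)]
        simp [hpos.ne']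
    _ ≤ (n : ℝ) ^ n := pow_le_pow_left₀
        (Finset.prod_nonneg fun i _ => Real.rpow_nonneg (hev0 i) _) hle n

theorem norm_det_le {n : ℕ} (A : Matrix (Fin n) (Fin n) ℂ) (r t : Fin n → ℝ)
    (hr : ∀ a, 0 < r a) (ht : ∀ b, 0 < t b) (hA : ∀ a b, ‖A a b‖ ≤ r a * t b) :
    ‖A.det‖ ≤ √((n : ℝ) ^ n) * ((∏ a, r a) * ∏ b, t b) := by
  set B : Matrix (Fin n) (Fin n) ℂ := Matrix.of fun a b => A a b / (r a * t b) with hB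
  have hAB : A = Matrix.of fun a b => (r a : ℂ) * (t b * B a b) := by
    ext a b
    have h1 : (r a : ℂ) ≠ 0 := by exact_mod_cast (hr a).ne'
    have h2 : (t b : ℂ) ≠ 0 := by exact_mod_cast (ht b).ne'
    simp [hB]; field_simp
  have hdet : A.det = (∏ a, (r a : ℂ)) * ((∏ b, (t b : ℂ)) * B.det) := by
    conv_lhs => rw [hAB]
    have := Matrix.det_mul_column (fun a => (r a : ℂ)) (Matrix.of fun a b => (t b : ℂ) * B a b)
    rw [Matrix.det_mul_row] at this
    exact this
  have hBle : ‖B.det‖ ≤ √((n : ℝ) ^ n) := by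
    apply Real.le_sqrt_of_sq_le
    refine sq_norm_det_le B fun a b => ?_
    have h1 := mul_pos (hr a) (ht b)
    simp only [hB, Matrix.of_apply, norm_div, norm_mul, Complex.norm_real, Real.norm_eq_abs,
      abs_of_pos (hr a), abs_of_pos (ht b)]
    exact (div_le_one h1).2 (hA a b)
  rw [hdet, norm_mul, norm_mul, norm_prod, norm_prod]
  simp only [Complex.norm_real, Real.norm_eq_abs, abs_of_pos (hr _), abs_of_pos (ht _)]
  have h1 : 0 ≤ ∏ a, r a := Finset.prod_nonneg fun a _ => (hr a).le
  have h2 : 0 ≤ ∏ a, t a := Finset.prod_nonneg fun a _ => (ht a).le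
  calc _ = ‖B.det‖ * ((∏ a, r a) * ∏ b, t b) := by ring
    _ ≤ _ := by gcongr

/-- Hadamard's bound for a determinant of size `m + 1` with entries in the unit disc. -/
def hadamard (m : ℕ) : ℝ := √(((m + 1 : ℕ) : ℝ) ^ (m + 1))

theorem hadamard_nonneg (m : ℕ) : 0 ≤ hadamard m := Real.sqrt_nonneg _

/-- One majorant thus serves both the plain minors of size `m` and the bordered ones of size `m +
1`. -/
theorem sqrt_pow_self_le_hadamard (m : ℕ) : √((m : ℝ) ^ m) ≤ hadamard m := by
  apply Real.sqrt_le_sqrt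
  calc (m : ℝ) ^ m ≤ ((m + 1 : ℕ) : ℝ) ^ m := by gcongr; simp
    _ ≤ ((m + 1 : ℕ) : ℝ) ^ (m + 1) := by
      apply pow_le_pow_right₀ _ (Nat.le_succ m)
      simp

/-- The bound grows like `m^(m/2)`, up to exponential and polynomial factors, and loses to `m!`.
With `a` the term times `2^m`, the inequality `y^j / j! ≤ e^y` at `y = j = m + 1` gives `a² ≤ e
(8eA²)^m / m!`. The term `a 2^(-m)` is then at most half of `a² + 4^(-m)`. -/
theorem summable_hadamard (A : ℝ) :
    Summable fun m : ℕ => ((m.factorial : ℝ))⁻¹ * (hadamard m * A ^ m) := by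
  have hs : Summable fun m : ℕ => (1 / 2 : ℝ) *
      (Real.exp 1 * ((8 * Real.exp 1 * A ^ 2) ^ m / m.factorial) + (1 / 4) ^ m) := by
    refine Summable.mul_left _ (Summable.add (Summable.mul_left _ ?_) ?_)
    · exact Real.summable_pow_div_factorial _
    · exact summable_geometric_of_lt_one (by norm_num) (by norm_num)
  refine Summable.of_norm_bounded hs fun m => ?_
  have hf : (0 : ℝ) < m.factorial := by exact_mod_cast m.factorial_pos
  set a := (2 : ℝ) ^ m * (hadamard m * |A| ^ m / m.factorial) with ha
  have ha2 : a ^ 2 ≤ Real.exp 1 * ((8 * Real.exp 1 * A ^ 2) ^ m / m.factorial) := by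
    have h1 : hadamard m ^ 2 = ((m + 1 : ℕ) : ℝ) ^ (m + 1) := Real.sq_sqrt (by positivity)
    have h2 : ((m + 1 : ℕ) : ℝ) ^ (m + 1) ≤ Real.exp 1 ^ (m + 1) * ((m + 1) * m.factorial) := by
      have := Real.pow_div_factorial_le_exp ((m + 1 : ℕ) : ℝ) (by positivity) (m + 1)
      rw [div_le_iff₀ (by positivity)] at this
      rw [← Real.exp_nat_mul, mul_one]
      refine this.trans_eq ?_
      rw [Nat.factorial_succ]; push_cast; ring
    have h3 : ((m : ℝ) + 1) ≤ 2 ^ m := by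
      exact_mod_cast (Nat.lt_two_pow_self (n := m))
    have h4 : a ^ 2 = 4 ^ m * hadamard m ^ 2 * (A ^ 2) ^ m / (m.factorial : ℝ) ^ 2 := by
      have : ((2 : ℝ) ^ m) ^ 2 = 4 ^ m := by rw [← pow_mul, mul_comm, pow_mul]; norm_num
      have h5 : (|A| ^ m) ^ 2 = (A ^ 2) ^ m := by
        rw [← pow_mul, mul_comm, pow_mul, sq_abs]
      rw [ha, mul_pow, div_pow, mul_pow, this, h5]; ring
    rw [h4, h1]
    calc 4 ^ m * ((m + 1 : ℕ) : ℝ) ^ (m + 1) * (A ^ 2) ^ m / (m.factorial : ℝ) ^ 2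
        ≤ 4 ^ m * (Real.exp 1 ^ (m + 1) * (2 ^ m * m.factorial)) * (A ^ 2) ^ m
            / (m.factorial : ℝ) ^ 2 := by
          gcongr
          exact h2.trans (by gcongr)
      _ = _ := by
          have : (8 : ℝ) ^ m = 4 ^ m * 2 ^ m := by rw [← mul_pow]; norm_num
          rw [mul_pow, mul_pow, this, pow_succ]
          field_simp
  rw [Real.norm_eq_abs, abs_mul, abs_mul, abs_pow, abs_of_nonneg (hadamard_nonneg m),
    abs_of_pos (inv_pos.2 hf)]
  have hb : (m.factorial : ℝ)⁻¹ * (hadamard m * |A| ^ m) = a * (1 / 2) ^ m := by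
    have : (1 / 2 : ℝ) ^ m * 2 ^ m = 1 := by rw [← mul_pow]; norm_num
    rw [ha]
    calc _ = (hadamard m * |A| ^ m / m.factorial) * ((1 / 2 : ℝ) ^ m * 2 ^ m) := by
          rw [this]; ring
      _ = _ := by ring
  rw [hb]
  have h6 : ((1 / 2 : ℝ) ^ m) ^ 2 = (1 / 4) ^ m := by
    rw [← pow_mul, mul_comm, pow_mul]; norm_num
  nlinarith [sq_nonneg (a - (1 / 2) ^ m)]

end Fredholm

namespace Fredholm

/-! ### Kernel matrices and bordered kernel matrices -/

variable {Z : Type*}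

/-- The matrix `κ(z_a, z_b)`. -/
def kernelMatrix (κ : Z → Z → ℂ) {m : ℕ} (z : Fin m → Z) : Matrix (Fin m) (Fin m) ℂ :=
  Matrix.of fun a b => κ (z a) (z b)

/-- The matrix `κ(z_a, z_b)`, bordered by the row `(γ, α(z_b))` and the column `(γ, β(z_a))`. -/
def bordered (κ : Z → Z → ℂ) (γ : ℂ) (α β : Z → ℂ) {m : ℕ} (z : Fin m → Z) :
    Matrix (Fin (m + 1)) (Fin (m + 1)) ℂ :=
  Matrix.of fun i j => Fin.cases (motive := fun _ => ℂ)
    (Fin.cases (motive := fun _ => ℂ) γ (fun b => α (z b)) j)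
    (fun a => Fin.cases (motive := fun _ => ℂ) (β (z a)) (fun b => κ (z a) (z b)) j) i

section bordered

variable (κ : Z → Z → ℂ) (γ : ℂ) (α β : Z → ℂ) {m : ℕ} (z : Fin m → Z)

@[simp] theorem bordered_zero_zero : bordered κ γ α β z 0 0 = γ := rfl

@[simp] theorem bordered_zero_succ (b : Fin m) : bordered κ γ α β z 0 b.succ = α (z b) := rfl

@[simp] theorem bordered_succ_zero (a : Fin m) : bordered κ γ α β z a.succ 0 = β (z a) := rfl

@[simp] theorem bordered_succ_succ (a b : Fin m) :
    bordered κ γ α β z a.succ b.succ = κ (z a) (z b) := rfl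

end bordered

/-- Expansion of a bordered determinant along its first column. -/
theorem det_bordered (κ : Z → Z → ℂ) (γ : ℂ) (α β : Z → ℂ) {m : ℕ} (z : Fin (m + 1) → Z) :
    (bordered κ γ α β z).det = γ * (kernelMatrix κ z).det -
      ∑ a, β (z a) * (bordered κ (α (z a)) α (fun s => κ s (z a)) (a.removeNth z)).det := by
  rw [Matrix.det_succ_column_zero, Fin.sum_univ_succ, sub_eq_add_neg, ← Finset.sum_neg_distrib]
  congr 1
  · have : (bordered κ γ α β z).submatrix Fin.succ Fin.succ = kernelMatrix κ z := by
      ext a b; simp [kernelMatrix]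
    simp [this, Fin.succAbove_zero]
  · refine Finset.sum_congr rfl fun a _ => ?_
    -- Deleting the row of `z_a` leaves its column among the others. Moving that column to the front
    -- makes it the new border, at the cost of a sign `(-1)^a`; against the Laplace sign
    -- `(-1)^(a+1)` a single minus remains.
    have h1 := Matrix.det_permute' a.cycleRange.symm
      ((bordered κ γ α β z).submatrix a.succ.succAbove Fin.succ)
    have h2 : ((bordered κ γ α β z).submatrix a.succ.succAbove Fin.succ).submatrix id
        a.cycleRange.symm = bordered κ (α (z a)) α (fun s => κ s (z a)) (a.removeNth z) := by
      ext i j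
      refine Fin.cases ?_ (fun i => ?_) i <;> refine Fin.cases ?_ (fun j => ?_) j <;>
        simp [Fin.removeNth, Fin.cycleRange_symm_zero, Fin.cycleRange_symm_succ]
    rw [h2, Equiv.Perm.sign_symm, Fin.sign_cycleRange] at h1
    rw [h1]
    simp only [bordered_succ_zero, Fin.val_succ, pow_succ]
    push_cast
    ring

/-- Subtracting the border row from all the others clears the border column below its corner. A
rank-one change of the kernel is thus the same as bordering. -/
theorem det_kernelMatrix_sub_one_mul (κ : Z → Z → ℂ) (α : Z → ℂ) {m : ℕ} (z : Fin m → Z) :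
    (bordered κ 1 α (fun _ => 1) z).det = (kernelMatrix (fun s t => κ s t - α t) z).det := by
  set B := Matrix.of fun i j => Fin.cases (motive := fun _ => ℂ)
    (bordered κ 1 α (fun _ => 1) z 0 j)
    (fun a => bordered κ 1 α (fun _ => 1) z a.succ j - bordered κ 1 α (fun _ => 1) z 0 j) i
    with hB
  have h1 : (bordered κ 1 α (fun _ => 1) z).det = B.det := by
    refine Matrix.det_eq_of_forall_row_eq_smul_add_const
      (Fin.cases (motive := fun _ => ℂ) 0 fun _ => 1) 0 rfl fun i j => ?_
    refine Fin.cases ?_ (fun i => ?_) i <;> simp [hB]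
  rw [h1, Matrix.det_succ_column_zero, Fin.sum_univ_succ]
  have h2 : B.submatrix (Fin.succAbove 0) Fin.succ = kernelMatrix (fun s t => κ s t - α t) z := by
    ext a b; simp [hB, kernelMatrix]
  rw [h2]
  simp [hB]

/-- A matrix whose entries are multiplied by `x_a + y_b`: the sum of all parameters times the
determinant. -/
theorem sum_add_mul_det {n : ℕ} (M N : Matrix (Fin n) (Fin n) ℂ) (x y : Fin n → ℂ)
    (h : ∀ a b, (x a + y b) * M a b = N a b) :
    (∑ a, (x a + y a)) * M.det = ∑ b, (M.updateCol b fun a => N a b).det := by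
  -- The trace of `adj(M) N` is computed twice: by cyclicity from `N = X M + M Y`, and column by
  -- column from Cramer's rule.
  have h1 : N = Matrix.diagonal x * M + M * Matrix.diagonal y := by
    ext a b
    simp [← h a b, Matrix.diagonal_mul, Matrix.mul_diagonal]; ring
  have h2 : (M.adjugate * N).trace = (∑ a, (x a + y a)) * M.det := by
    rw [h1, mul_add, Matrix.trace_add, ← Matrix.mul_assoc, ← Matrix.mul_assoc,
      Matrix.adjugate_mul, Matrix.trace_mul_comm, ← Matrix.mul_assoc, Matrix.mul_adjugate]
    simp [Matrix.trace, Finset.sum_add_distrib, ← Finset.mul_sum]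
    ring
  rw [← h2, Matrix.trace]
  refine Finset.sum_congr rfl fun b _ => ?_
  rw [← Matrix.cramer_apply, Matrix.cramer_eq_adjugate_mulVec]
  rfl

/-- Expansion of a bordered determinant along its first row. -/
theorem det_bordered_eq_sub_sum_updateCol (κ : Z → Z → ℂ) (γ : ℂ) (α β : Z → ℂ) {m : ℕ}
    (z : Fin m → Z) :
    (bordered κ γ α β z).det = γ * (kernelMatrix κ z).det -
      ∑ b, α (z b) * ((kernelMatrix κ z).updateCol b fun a => β (z a)).det := by
  rw [Matrix.det_succ_row_zero, Fin.sum_univ_succ, sub_eq_add_neg, ← Finset.sum_neg_distrib]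
  congr 1
  · have : (bordered κ γ α β z).submatrix Fin.succ Fin.succ = kernelMatrix κ z := by
      ext a b; simp [kernelMatrix]
    simp [this, Fin.succAbove_zero]
  · refine Finset.sum_congr rfl fun b _ => ?_
    rcases m with _ | m
    · exact b.elim0
    have h1 := Matrix.det_permute' b.cycleRange.symm
      ((kernelMatrix κ z).updateCol b fun a => β (z a))
    have h2 : (bordered κ γ α β z).submatrix Fin.succ b.succ.succAbove =
        ((kernelMatrix κ z).updateCol b fun a => β (z a)).submatrix id b.cycleRange.symm := by
      ext i j
      refine Fin.cases ?_ (fun j => ?_) j <;>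
        simp [kernelMatrix, Fin.cycleRange_symm_zero, Fin.cycleRange_symm_succ]
    rw [h2, h1, Equiv.Perm.sign_symm, Fin.sign_cycleRange]
    simp only [bordered_zero_succ, Fin.val_succ, pow_succ]
    push_cast
    have : ((-1 : ℂ) ^ (b : ℕ)) * (-1) ^ (b : ℕ) = 1 := by rw [← mul_pow]; norm_num
    linear_combination (-α (z b) * ((kernelMatrix κ z).updateCol b fun a => β (z a)).det) * this

/-- For a Cauchy kernel `κ(s,t) = 1 / (x(s) + y(t))`. -/
theorem sum_add_mul_det_kernelMatrix (κ : Z → Z → ℂ) (x y : Z → ℂ)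
    (h : ∀ s t, (x s + y t) * κ s t = 1) {m : ℕ} (z : Fin m → Z) :
    (∑ a, (x (z a) + y (z a))) * (kernelMatrix κ z).det =
      -(bordered κ 0 (fun _ => 1) (fun _ => 1) z).det := by
  rw [det_bordered_eq_sub_sum_updateCol, sum_add_mul_det (kernelMatrix κ z) (fun _ _ => 1)
    (fun a => x (z a)) (fun b => y (z b)) fun a b => h _ _]
  simp

/-- For a Cauchy kernel `κ(s,t) = 1 / (x(s) + y(t))`, bordered by the row of the point `k`. -/
theorem sum_add_mul_det_bordered (κ : Z → Z → ℂ) (x y : Z → ℂ)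
    (h : ∀ s t, (x s + y t) * κ s t = 1) (k : ℂ) (α : Z → ℂ) (hα : ∀ t, (k + y t) * α t = 1)
    {m : ℕ} (z : Fin m → Z) :
    (∑ a, (x (z a) + y (z a))) * (bordered κ 1 α (fun _ => 1) z).det =
      (bordered κ k α x z).det - k * (bordered κ 1 α (fun _ => 1) z).det := by
  set M := bordered κ 1 α (fun _ => 1) z with hM
  set N : Matrix (Fin (m + 1)) (Fin (m + 1)) ℂ := Matrix.of fun i j =>
    Fin.cases (motive := fun _ => ℂ) (Fin.cases (motive := fun _ => ℂ) k (fun a => x (z a)) i)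
      (fun _ => 1) j with hN
  -- The border row gets the node `k`, the border column the node `0`. Every column of `N` but the
  -- first then consists of ones, like the first column of `M`, so only the replacement of the first
  -- column survives.
  have key := sum_add_mul_det M N (Fin.cases k fun a => x (z a)) (Fin.cases 0 fun b => y (z b)) ?_
  · rw [Fin.sum_univ_succ, Fin.sum_univ_succ] at key
    have h0 : (M.updateCol 0 fun a => N a 0) = bordered κ k α x z := by
      ext i j
      refine Fin.cases ?_ (fun i => ?_) i <;> refine Fin.cases ?_ (fun j => ?_) j <;>
        simp [hM, hN]
    have h1 : ∀ b : Fin m, (M.updateCol b.succ fun a => N a b.succ).det = 0 := fun b => by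
      refine Matrix.det_zero_of_column_eq (i := 0) (j := b.succ) (Fin.succ_ne_zero b).symm
        fun i => ?_
      rw [Matrix.updateCol_self, Matrix.updateCol_ne (Fin.succ_ne_zero b).symm]
      refine Fin.cases ?_ (fun i => ?_) i <;> simp [hM, hN]
    rw [h0] at key
    simp only [h1, Finset.sum_const_zero, add_zero, Fin.cases_zero, Fin.cases_succ] at key
    linear_combination key
  · intro i j
    refine Fin.cases ?_ (fun i => ?_) i <;> refine Fin.cases ?_ (fun j => ?_) j <;>
      simp [hM, hN, h, hα]

end Fredholm

namespace Fredholm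

/-! ### Fredholm series -/

section bounds

variable {Z : Type*} {κ : Z → Z → ℂ} {g g' : Z → ℝ}

theorem norm_det_kernelMatrix_le (hg : ∀ s, 0 < g s) (hg' : ∀ s, 0 < g' s)
    (hκ : ∀ s t, ‖κ s t‖ ≤ g s * g' t) {m : ℕ} (z : Fin m → Z) :
    ‖(kernelMatrix κ z).det‖ ≤ hadamard m * ∏ a, (g (z a) * g' (z a)) := by
  refine (norm_det_le _ (fun a => g (z a)) (fun b => g' (z b)) (fun _ => hg _) (fun _ => hg' _)
    fun a b => hκ _ _).trans ?_
  rw [Finset.prod_mul_distrib]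
  have h1 : 0 ≤ ∏ a, g (z a) := Finset.prod_nonneg fun a _ => (hg _).le
  have h2 : 0 ≤ ∏ a, g' (z a) := Finset.prod_nonneg fun a _ => (hg' _).le
  gcongr
  exact sqrt_pow_self_le_hadamard m

theorem norm_det_bordered_le (hg : ∀ s, 0 < g s) (hg' : ∀ s, 0 < g' s)
    (hκ : ∀ s t, ‖κ s t‖ ≤ g s * g' t) {γ : ℂ} {α β : Z → ℂ} {A B : ℝ} (hA : 0 < A) (hB : 0 < B)
    (hγ : ‖γ‖ ≤ A * B) (hα : ∀ t, ‖α t‖ ≤ A * g' t) (hβ : ∀ s, ‖β s‖ ≤ B * g s)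
    {m : ℕ} (z : Fin m → Z) :
    ‖(bordered κ γ α β z).det‖ ≤ (A * B * hadamard m) * ∏ a, (g (z a) * g' (z a)) := by
  refine (norm_det_le _ (Fin.cases A fun a => g (z a)) (Fin.cases B fun b => g' (z b))
    (fun a => Fin.cases hA (fun _ => hg _) a) (fun a => Fin.cases hB (fun _ => hg' _) a)
    fun a b => ?_).trans ?_
  · refine Fin.cases ?_ (fun a => ?_) a <;> refine Fin.cases ?_ (fun b => ?_) b
    · simpa using hγ
    · simpa using hα _
    · simpa [mul_comm] using hβ _
    · simpa using hκ _ _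
  · rw [Fin.prod_univ_succ, Fin.prod_univ_succ, Finset.prod_mul_distrib]
    simp only [Fin.cases_zero, Fin.cases_succ, hadamard]
    apply le_of_eq
    ring

end bounds

variable {Z : Type*} [MeasurableSpace Z]

theorem measurable_det {X : Type*} [MeasurableSpace X] {n : ℕ}
    {M : X → Matrix (Fin n) (Fin n) ℂ} (hM : ∀ i j, Measurable fun x => M x i j) :
    Measurable fun x => (M x).det := by
  simp only [Matrix.det_apply]
  refine Finset.measurable_sum _ fun σ _ => Measurable.const_smul ?_ _
  exact Finset.measurable_prod _ fun i _ => hM _ _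

theorem measurable_det_kernelMatrix {κ : Z → Z → ℂ} (hκ : Measurable (Function.uncurry κ))
    {m : ℕ} : Measurable fun z : Fin m → Z => (kernelMatrix κ z).det :=
  measurable_det fun i j => by
    have := hκ.comp ((measurable_pi_apply (X := fun _ : Fin m => Z) i).prodMk
      (measurable_pi_apply j))
    exact this

theorem measurable_det_bordered {X : Type*} [MeasurableSpace X] {κ : X → Z → Z → ℂ} {γ : X → ℂ}
    {α β : X → Z → ℂ} (hκ : Measurable fun q : X × Z × Z => κ q.1 q.2.1 q.2.2) (hγ : Measurable γ)
    (hα : Measurable (Function.uncurry α)) (hβ : Measurable (Function.uncurry β)) {m : ℕ} :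
    Measurable fun q : X × (Fin m → Z) =>
      (bordered (κ q.1) (γ q.1) (α q.1) (β q.1) q.2).det := by
  refine measurable_det fun i j => ?_
  have hev : ∀ a : Fin m, Measurable fun q : X × (Fin m → Z) => q.2 a := fun a =>
    (measurable_pi_apply a).comp measurable_snd
  refine Fin.cases ?_ (fun i => ?_) i <;> refine Fin.cases ?_ (fun j => ?_) j
  · exact hγ.comp measurable_fst
  · exact hα.comp (measurable_fst.prodMk (hev j))
  · exact hβ.comp (measurable_fst.prodMk (hev i))
  · exact hκ.comp (measurable_fst.prodMk ((hev i).prodMk (hev j)))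

variable (ν : Measure Z) (h : Z → ℂ)

/-- The `m`-th term `(1/m!) ∫ G(z_1, …, z_m) ∏ h(z_a)` of a Fredholm series. -/
def seriesTerm {m : ℕ} (G : (Fin m → Z) → ℂ) : ℂ :=
  ((m.factorial : ℂ))⁻¹ * ∫ z : Fin m → Z, G z * ∏ a, h (z a) ∂(Measure.pi fun _ : Fin m => ν)

/-- The Fredholm determinant of the kernel `κ(s,t) h(t)`. -/
def fredholmDet (κ : Z → Z → ℂ) : ℂ := ∑' m : ℕ, seriesTerm ν h fun z : Fin m → Z =>
  (kernelMatrix κ z).det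

/-- The bordered Fredholm determinant. -/
def fredholmBordered (κ : Z → Z → ℂ) (γ : ℂ) (α β : Z → ℂ) : ℂ :=
  ∑' m : ℕ, seriesTerm ν h fun z : Fin m → Z => (bordered κ γ α β z).det

variable {ν h}

theorem aestronglyMeasurable_prod_apply [SigmaFinite ν] (hh : AEStronglyMeasurable h ν) (m : ℕ) :
    AEStronglyMeasurable (fun z : Fin m → Z => ∏ a, h (z a)) (Measure.pi fun _ => ν) := by
  have := Finset.aestronglyMeasurable_fun_prod (μ := Measure.pi fun _ : Fin m => ν)
    (f := fun a (z : Fin m → Z) => h (z a)) Finset.univ fun a _ =>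
      hh.comp_quasiMeasurePreserving (Measure.quasiMeasurePreserving_eval (fun _ => ν) a)
  exact this

theorem integrable_mul_prod [SigmaFinite ν] (hh : AEStronglyMeasurable h ν) {w : Z → ℝ}
    (hw : Integrable (fun t => w t * ‖h t‖) ν) {m : ℕ} {G : (Fin m → Z) → ℂ}
    (hG : AEStronglyMeasurable G (Measure.pi fun _ => ν)) {C : ℝ}
    (hb : ∀ z, ‖G z‖ ≤ C * ∏ a, w (z a)) :
    Integrable (fun z => G z * ∏ a, h (z a)) (Measure.pi fun _ => ν) := by
  refine Integrable.mono' ((Integrable.fintype_prod fun _ : Fin m => hw).const_mul C)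
    (hG.mul (aestronglyMeasurable_prod_apply hh m)) (Filter.Eventually.of_forall fun z => ?_)
  rw [norm_mul, norm_prod, Finset.prod_mul_distrib, ← mul_assoc]
  gcongr
  exact hb z

theorem norm_seriesTerm_le [SigmaFinite ν] {w : Z → ℝ}
    (hw : Integrable (fun t => w t * ‖h t‖) ν) {m : ℕ} {G : (Fin m → Z) → ℂ} {C : ℝ}
    (hb : ∀ z, ‖G z‖ ≤ C * ∏ a, w (z a)) :
    ‖seriesTerm ν h G‖ ≤ (m.factorial : ℝ)⁻¹ * (C * (∫ t, w t * ‖h t‖ ∂ν) ^ m) := by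
  rw [seriesTerm, norm_mul, norm_inv, Complex.norm_natCast]
  gcongr
  calc _ ≤ ∫ z : Fin m → Z, C * ∏ a, (w (z a) * ‖h (z a)‖) ∂(Measure.pi fun _ => ν) := by
        refine norm_integral_le_of_norm_le
          ((Integrable.fintype_prod fun _ : Fin m => hw).const_mul C)
          (Filter.Eventually.of_forall fun z => ?_)
        rw [norm_mul, norm_prod, Finset.prod_mul_distrib, ← mul_assoc]
        gcongr
        exact hb z
    _ = _ := by
        rw [integral_const_mul, integral_fintype_prod_eq_pow (fun t => w t * ‖h t‖)]
        simp

/-- Domination of the kernel `κ` by a product `g(s) g'(t)` which is integrable against `h` on the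
diagonal. -/
structure Dominated (ν : Measure Z) (h : Z → ℂ) (κ : Z → Z → ℂ) (g g' : Z → ℝ) : Prop where
  measurable_left : Measurable g
  measurable_right : Measurable g'
  left_pos : ∀ s, 0 < g s
  right_pos : ∀ t, 0 < g' t
  measurable_kernel : Measurable (Function.uncurry κ)
  norm_kernel_le : ∀ s t, ‖κ s t‖ ≤ g s * g' t
  aestronglyMeasurable : AEStronglyMeasurable h ν
  integrable : Integrable (fun t => (g t * g' t) * ‖h t‖) ν

namespace Dominated

variable [SigmaFinite ν] {κ : Z → Z → ℂ} {g g' : Z → ℝ} (H : Dominated ν h κ g g')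
include H

theorem summable_det : Summable fun m : ℕ => seriesTerm ν h fun z : Fin m → Z =>
    (kernelMatrix κ z).det :=
  Summable.of_norm_bounded (summable_hadamard _) fun _ => norm_seriesTerm_le H.integrable
    (norm_det_kernelMatrix_le H.left_pos H.right_pos H.norm_kernel_le)

variable {γ : ℂ} {α β : Z → ℂ} {A B : ℝ}

theorem norm_seriesTerm_bordered_le (hA : 0 < A) (hB : 0 < B)
    (hγ : ‖γ‖ ≤ A * B) (hα : ∀ t, ‖α t‖ ≤ A * g' t) (hβ : ∀ s, ‖β s‖ ≤ B * g s) (m : ℕ) :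
    ‖seriesTerm ν h fun z : Fin m → Z => (bordered κ γ α β z).det‖ ≤ A * B *
      ((m.factorial : ℝ)⁻¹ * (hadamard m * (∫ t, (g t * g' t) * ‖h t‖ ∂ν) ^ m)) := by
  refine (norm_seriesTerm_le H.integrable (norm_det_bordered_le H.left_pos H.right_pos
    H.norm_kernel_le hA hB hγ hα hβ)).trans (le_of_eq ?_)
  ring

theorem summable_bordered (hA : 0 < A) (hB : 0 < B)
    (hγ : ‖γ‖ ≤ A * B) (hα : ∀ t, ‖α t‖ ≤ A * g' t) (hβ : ∀ s, ‖β s‖ ≤ B * g s) :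
    Summable fun m : ℕ => seriesTerm ν h fun z : Fin m → Z => (bordered κ γ α β z).det :=
  Summable.of_norm_bounded ((summable_hadamard _).mul_left (A * B))
    (H.norm_seriesTerm_bordered_le hA hB hγ hα hβ)

theorem norm_fredholmBordered_le (hA : 0 < A) (hB : 0 < B)
    (hγ : ‖γ‖ ≤ A * B) (hα : ∀ t, ‖α t‖ ≤ A * g' t) (hβ : ∀ s, ‖β s‖ ≤ B * g s) :
    ‖fredholmBordered ν h κ γ α β‖ ≤ A * B * ∑' m : ℕ, ((m.factorial : ℝ)⁻¹ *
      (hadamard m * (∫ t, (g t * g' t) * ‖h t‖ ∂ν) ^ m)) := by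
  rw [← tsum_mul_left]
  exact tsum_of_norm_bounded ((summable_hadamard _).mul_left (A * B)).hasSum
    (H.norm_seriesTerm_bordered_le hA hB hγ hα hβ)

/-- The column `κ(·, t)` has size `g'(t)` and `β` has size `g(t)`, so the separated variable is
integrated against the same weight `g g'` as the rest. This licenses Fubini in the recursion below.
-/
theorem integrable_bordered_prod (hA : 0 < A) (hαm : Measurable α) (hα : ∀ t, ‖α t‖ ≤ A * g' t)
    (hβm : Measurable β) (hB : 0 < B) (hβ : ∀ s, ‖β s‖ ≤ B * g s) (m : ℕ) :
    Integrable (fun q : Z × (Fin m → Z) => (β q.1 * h q.1) *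
      ((bordered κ (α q.1) α (fun s => κ s q.1) q.2).det * ∏ a, h (q.2 a)))
      (ν.prod (Measure.pi fun _ => ν)) := by
  have hI := ((H.integrable.const_mul (B * A * hadamard m)).mul_prod
    (Integrable.fintype_prod fun _ : Fin m => H.integrable))
  refine Integrable.mono' hI ?_ (Filter.Eventually.of_forall fun q => ?_)
  · refine (hβm.aestronglyMeasurable.mul H.aestronglyMeasurable).comp_fst.mul
      (AEStronglyMeasurable.mul ?_
        (aestronglyMeasurable_prod_apply H.aestronglyMeasurable m).comp_snd)
    refine (measurable_det_bordered (κ := fun _ => κ) (γ := α) (α := fun _ => α)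
      (β := fun t s => κ s t) ?_ hαm ?_ ?_).aestronglyMeasurable
    · exact H.measurable_kernel.comp measurable_snd
    · exact hαm.comp measurable_snd
    · exact H.measurable_kernel.comp measurable_swap
  · have h1 := norm_det_bordered_le (γ := α q.1) (α := α) (β := fun s => κ s q.1) H.left_pos
      H.right_pos H.norm_kernel_le hA (H.right_pos q.1) (hα q.1) hα
      (fun s => by rw [mul_comm]; exact H.norm_kernel_le s q.1) q.2
    have hP : 0 ≤ ∏ a, ‖h (q.2 a)‖ := Finset.prod_nonneg fun a _ => norm_nonneg _
    have hP' : 0 ≤ ∏ a, (g (q.2 a) * g' (q.2 a)) :=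
      Finset.prod_nonneg fun a _ => (mul_pos (H.left_pos _) (H.right_pos _)).le
    simp only [norm_mul, norm_prod, Finset.prod_mul_distrib (g := fun a => ‖h (q.2 a)‖)]
    calc ‖β q.1‖ * ‖h q.1‖ * (‖(bordered κ (α q.1) α (fun s => κ s q.1) q.2).det‖ *
          ∏ a, ‖h (q.2 a)‖)
        ≤ B * g q.1 * ‖h q.1‖ * (A * g' q.1 * hadamard m * (∏ a, (g (q.2 a) * g' (q.2 a))) *
          ∏ a, ‖h (q.2 a)‖) := by
          have := hβ q.1
          have := H.left_pos q.1
          gcongr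
      _ = _ := by ring

/-- After the expansion along the first column, isolating `z_a` gives the same integral for every
`a`. The `m + 1` copies reduce `1/(m+1)!` to `1/m!`. -/
theorem seriesTerm_bordered_succ (hA : 0 < A) (hαm : Measurable α) (hα : ∀ t, ‖α t‖ ≤ A * g' t)
    (hβm : Measurable β) (hB : 0 < B) (hβ : ∀ s, ‖β s‖ ≤ B * g s) (m : ℕ) :
    (seriesTerm ν h fun z : Fin (m + 1) → Z => (bordered κ γ α β z).det) =
      γ * (seriesTerm ν h fun z : Fin (m + 1) → Z => (kernelMatrix κ z).det) -
      ∫ t, (β t * h t) * seriesTerm ν h fun z : Fin m → Z =>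
        (bordered κ (α t) α (fun s => κ s t) z).det ∂ν := by
  set Ψ : Z × (Fin m → Z) → ℂ := fun q => (β q.1 * h q.1) *
      ((bordered κ (α q.1) α (fun s => κ s q.1) q.2).det * ∏ a, h (q.2 a)) with hΨ
  have hΨi := H.integrable_bordered_prod hA hαm hα hβm hB hβ m
  have hmp : ∀ a : Fin (m + 1), MeasurePreserving
      (MeasurableEquiv.piFinSuccAbove (fun _ => Z) a) (Measure.pi fun _ : Fin (m + 1) => ν)
      (ν.prod (Measure.pi fun _ : Fin m => ν)) := fun a =>
    measurePreserving_piFinSuccAbove (fun _ => ν) a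
  have hterm : ∀ (a : Fin (m + 1)) (z : Fin (m + 1) → Z),
      β (z a) * (bordered κ (α (z a)) α (fun s => κ s (z a)) (a.removeNth z)).det *
        ∏ b, h (z b) = Ψ (MeasurableEquiv.piFinSuccAbove (fun _ => Z) a z) := fun a z => by
    rw [Fin.prod_univ_succAbove _ a]
    simp only [hΨ, MeasurableEquiv.piFinSuccAbove_apply, Fin.insertNthEquiv, Equiv.coe_fn_symm_mk,
      Fin.removeNth]
    ring
  have hdet : Integrable (fun z : Fin (m + 1) → Z => γ * ((kernelMatrix κ z).det *
      ∏ b, h (z b))) (Measure.pi fun _ => ν) :=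
    (integrable_mul_prod H.aestronglyMeasurable H.integrable
      (measurable_det_kernelMatrix H.measurable_kernel).aestronglyMeasurable
      (norm_det_kernelMatrix_le H.left_pos H.right_pos H.norm_kernel_le)).const_mul γ
  have hint : ∀ a : Fin (m + 1), Integrable (fun z : Fin (m + 1) → Z =>
      Ψ (MeasurableEquiv.piFinSuccAbove (fun _ => Z) a z)) (Measure.pi fun _ => ν) := fun a =>
    (hmp a).integrable_comp_of_integrable hΨi
  have hfact : (((m + 1).factorial : ℂ))⁻¹ * (m + 1) = ((m.factorial : ℂ))⁻¹ := by
    have : (m.factorial : ℂ) ≠ 0 := by exact_mod_cast m.factorial_ne_zero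
    have : (m + 1 : ℂ) ≠ 0 := by exact_mod_cast m.succ_ne_zero
    rw [Nat.factorial_succ]; push_cast; field_simp
  have hfub : ∫ q, Ψ q ∂(ν.prod (Measure.pi fun _ : Fin m => ν)) =
      ∫ t, (β t * h t) * ∫ z : Fin m → Z, (bordered κ (α t) α (fun s => κ s t) z).det *
        ∏ a, h (z a) ∂(Measure.pi fun _ => ν) ∂ν := by
    rw [integral_prod _ hΨi]
    simp only [integral_const_mul]
  have hrhs : ∫ t, (β t * h t) * (seriesTerm ν h fun z : Fin m → Z =>
      (bordered κ (α t) α (fun s => κ s t) z).det) ∂ν = ((m.factorial : ℂ))⁻¹ *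
        ∫ q, Ψ q ∂(ν.prod (Measure.pi fun _ : Fin m => ν)) := by
    rw [hfub, ← integral_const_mul]
    refine integral_congr_ae (Filter.Eventually.of_forall fun t => ?_)
    simp only [seriesTerm]; ring
  rw [hrhs]
  simp only [seriesTerm]
  have hsplit : ∀ z : Fin (m + 1) → Z, (bordered κ γ α β z).det * ∏ b, h (z b) =
      γ * ((kernelMatrix κ z).det * ∏ b, h (z b)) -
        ∑ a, Ψ (MeasurableEquiv.piFinSuccAbove (fun _ => Z) a z) := fun z => by
    rw [det_bordered, sub_mul, Finset.sum_mul]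
    simp only [hterm]; ring
  simp only [hsplit]
  rw [integral_sub hdet (integrable_finsetSum _ fun a _ => hint a),
    integral_finsetSum _ fun a _ => hint a, integral_const_mul]
  have : ∀ a : Fin (m + 1), ∫ z : Fin (m + 1) → Z,
      Ψ (MeasurableEquiv.piFinSuccAbove (fun _ => Z) a z) ∂(Measure.pi fun _ => ν) =
        ∫ q, Ψ q ∂(ν.prod (Measure.pi fun _ : Fin m => ν)) := fun a =>
    (hmp a).integral_comp' Ψ
  simp only [this, Finset.sum_const, Finset.card_univ, Fintype.card_fin, nsmul_eq_mul]
  rw [← hfact]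
  push_cast
  ring

end Dominated

end Fredholm

/-! ### The resolvent and Cramer's rule for Fredholm equations. -/

namespace Fredholm

variable {Z : Type*} [MeasurableSpace Z] {ν : Measure Z} {h : Z → ℂ}

namespace Dominated

variable [SigmaFinite ν] {κ : Z → Z → ℂ} {g g' : Z → ℝ} (H : Dominated ν h κ g g')
include H

variable {γ : ℂ} {α β : Z → ℂ} {A B : ℝ}

omit [SigmaFinite ν] in
theorem norm_kernel_le_swap (t : Z) : ∀ s, ‖κ s t‖ ≤ g' t * g s := fun s => by
  rw [mul_comm]; exact H.norm_kernel_le s t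

/-- The bordered Fredholm determinants with the column `κ(·, t)`. -/
theorem norm_resolvent_le (hA : 0 < A) (hα : ∀ t, ‖α t‖ ≤ A * g' t) (t : Z) :
    ‖fredholmBordered ν h κ (α t) α (fun s => κ s t)‖ ≤ A * g' t * ∑' m : ℕ,
      ((m.factorial : ℝ)⁻¹ * (hadamard m * (∫ t, (g t * g' t) * ‖h t‖ ∂ν) ^ m)) :=
  H.norm_fredholmBordered_le hA (H.right_pos t) (hα t) hα (H.norm_kernel_le_swap t)

theorem integrable_seriesTerm_resolvent (hA : 0 < A) (hαm : Measurable α)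
    (hα : ∀ t, ‖α t‖ ≤ A * g' t) (hβm : Measurable β) (hB : 0 < B) (hβ : ∀ s, ‖β s‖ ≤ B * g s)
    (m : ℕ) :
    Integrable (fun t => (β t * h t) * seriesTerm ν h fun z : Fin m → Z =>
      (bordered κ (α t) α (fun s => κ s t) z).det) ν := by
  have h1 := ((H.integrable_bordered_prod hA hαm hα hβm hB hβ m).integral_prod_left).const_mul
    ((m.factorial : ℂ))⁻¹
  refine h1.congr (Filter.Eventually.of_forall fun t => ?_)
  simp only [seriesTerm, integral_const_mul]
  ring

theorem hasSum_resolvent (hA : 0 < A) (hα : ∀ t, ‖α t‖ ≤ A * g' t) (t : Z) :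
    HasSum (fun m : ℕ => seriesTerm ν h fun z : Fin m → Z =>
      (bordered κ (α t) α (fun s => κ s t) z).det)
      (fredholmBordered ν h κ (α t) α (fun s => κ s t)) :=
  (H.summable_bordered hA (H.right_pos t) (hα t) hα (H.norm_kernel_le_swap t)).hasSum

theorem aestronglyMeasurable_resolvent (hA : 0 < A) (hαm : Measurable α)
    (hα : ∀ t, ‖α t‖ ≤ A * g' t) :
    AEStronglyMeasurable
      (fun t => h t * fredholmBordered ν h κ (α t) α (fun s => κ s t)) ν := by
  have hm : ∀ m : ℕ, AEStronglyMeasurable (fun t => h t * seriesTerm ν h fun z : Fin m → Z =>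
      (bordered κ (α t) α (fun s => κ s t) z).det) ν := fun m => by
    -- The weight `g` itself is an admissible column `β`; dividing by it afterwards leaves
    -- measurability of the term alone.
    have h1 := (H.integrable_seriesTerm_resolvent hA hαm hα (β := fun s => (g s : ℂ))
      (Complex.measurable_ofReal.comp H.measurable_left) one_pos (fun s => by
        rw [Complex.norm_real, Real.norm_eq_abs, abs_of_pos (H.left_pos s), one_mul])
        m).aestronglyMeasurable
    have h2 := ((Complex.measurable_ofReal.comp H.measurable_left).inv.aestronglyMeasurable
      (μ := ν)).mul h1
    refine h2.congr (Filter.Eventually.of_forall fun t => ?_)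
    have : (g t : ℂ) ≠ 0 := by exact_mod_cast (H.left_pos t).ne'
    simp only [Pi.mul_apply, Pi.inv_apply, Function.comp]
    field_simp
  refine aestronglyMeasurable_of_tendsto_ae (u := Filter.atTop)
    (f := fun n t => ∑ m ∈ Finset.range n, h t * seriesTerm ν h fun z : Fin m → Z =>
      (bordered κ (α t) α (fun s => κ s t) z).det)
    (fun n => Finset.aestronglyMeasurable_fun_sum _ fun m _ => hm m)
    (Filter.Eventually.of_forall fun t => ?_)
  exact ((H.hasSum_resolvent hA hα t).mul_left (h t)).tendsto_sum_nat

/-- The recursion between terms of degree `m + 1` and `m`, summed over `m`. The terms of degree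
zero, `γ` and `1`, complete the shifted series. -/
theorem fredholmBordered_eq (hA : 0 < A) (hαm : Measurable α) (hα : ∀ t, ‖α t‖ ≤ A * g' t)
    (hβm : Measurable β) (hB : 0 < B) (hβ : ∀ s, ‖β s‖ ≤ B * g s) :
    fredholmBordered ν h κ γ α β = γ * fredholmDet ν h κ -
      ∫ t, (β t * h t) * fredholmBordered ν h κ (α t) α (fun s => κ s t) ∂ν := by
  set C : ℕ → ℝ := fun m => (m.factorial : ℝ)⁻¹ *
    (hadamard m * (∫ t, (g t * g' t) * ‖h t‖ ∂ν) ^ m) with hC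
  have hCs : Summable C := summable_hadamard _
  have hint := H.integrable_seriesTerm_resolvent hA hαm hα hβm hB hβ
  have hsum := hasSum_integral_of_summable_integral_norm hint <| by
    refine Summable.of_nonneg_of_le (fun m => integral_nonneg fun t => norm_nonneg _)
      (fun m => ?_) (hCs.mul_left (A * B * ∫ t, (g t * g' t) * ‖h t‖ ∂ν))
    calc _ ≤ ∫ t, (A * B * C m) * ((g t * g' t) * ‖h t‖) ∂ν := by
          refine integral_mono (hint m).norm (H.integrable.const_mul _) fun t => ?_
          have h1 := H.norm_seriesTerm_bordered_le hA (H.right_pos t) (hα t) hα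
            (H.norm_kernel_le_swap t) m
          rw [norm_mul, norm_mul]
          have := hβ t
          have := H.left_pos t
          calc _ ≤ (B * g t * ‖h t‖) * (A * g' t * C m) := by gcongr
            _ = _ := by ring
      _ = _ := by rw [integral_const_mul]; ring
  have htsum : ∀ t, ∑' m : ℕ, (β t * h t) * (seriesTerm ν h fun z : Fin m → Z =>
      (bordered κ (α t) α (fun s => κ s t) z).det) =
        (β t * h t) * fredholmBordered ν h κ (α t) α (fun s => κ s t) := fun t =>
    tsum_mul_left
  simp only [htsum] at hsum
  have hdet := H.summable_det
  set a : ℕ → ℂ := fun m => seriesTerm ν h fun z : Fin m → Z => (bordered κ γ α β z).det with ha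
  set d : ℕ → ℂ := fun m => seriesTerm ν h fun z : Fin m → Z => (kernelMatrix κ z).det with hd
  set J : ℂ := ∫ t, (β t * h t) * fredholmBordered ν h κ (α t) α (fun s => κ s t) ∂ν with hJ
  have hsucc : ∀ m, a (m + 1) = γ * d (m + 1) - _ := fun m =>
    H.seriesTerm_bordered_succ (γ := γ) hA hαm hα hβm hB hβ m
  have hd1 : Summable fun m => d (m + 1) := (summable_nat_add_iff 1).2 hdet
  have hs1 : HasSum (fun m => a (m + 1)) (γ * ∑' m, d (m + 1) - J) := by
    simp only [hsucc]
    exact (hd1.hasSum.mul_left γ).sub hsum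
  have h0 : ∀ G : (Fin 0 → Z) → ℂ, seriesTerm ν h G = G Fin.elim0 := fun G => by
    have : ∀ z : Fin 0 → Z, z = Fin.elim0 := fun z => Subsingleton.elim _ _
    simp only [seriesTerm]
    rw [Measure.pi_of_empty (fun _ : Fin 0 => ν) Fin.elim0]
    simp
  have ha0 : a 0 = γ := by
    rw [ha]
    simp only [h0]
    rw [Matrix.det_fin_one]
    rfl
  have hd0 : d 0 = 1 := by
    rw [hd]
    simp only [h0]
    exact Matrix.det_fin_zero
  have e1 : fredholmBordered ν h κ γ α β = a 0 + ∑' m : ℕ, a (m + 1) :=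
    ((summable_nat_add_iff 1).1 hs1.summable).tsum_eq_zero_add
  have e2 : fredholmDet ν h κ = d 0 + ∑' m : ℕ, d (m + 1) := hdet.tsum_eq_zero_add
  rw [e1, e2, hs1.tsum_eq, ha0, hd0]
  ring

/-- Cramer's rule for Fredholm equations of the second kind. -/
theorem fredholmDet_mul_sub_integral (hA : 0 < A) (hαm : Measurable α)
    (hα : ∀ t, ‖α t‖ ≤ A * g' t) (hβm : Measurable β) (hB : 0 < B) (hβ : ∀ s, ‖β s‖ ≤ B * g s)
    {f : Z → ℂ} (hf : Integrable (fun t => (g' t : ℂ) * (h t * f t)) ν)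
    (heq : ∀ s, f s + ∫ t, κ s t * (h t * f t) ∂ν = β s) :
    fredholmDet ν h κ * (γ - ∫ t, α t * (h t * f t) ∂ν) = fredholmBordered ν h κ γ α β := by
  set Q : Z → ℂ := fun t => fredholmBordered ν h κ (α t) α (fun s => κ s t) with hQ
  set C : ℝ := ∑' m : ℕ, ((m.factorial : ℝ)⁻¹ *
    (hadamard m * (∫ t, (g t * g' t) * ‖h t‖ ∂ν) ^ m)) with hC
  have hQle : ∀ t, ‖Q t‖ ≤ A * g' t * C := H.norm_resolvent_le hA hα
  have hQm : AEStronglyMeasurable (fun t => h t * Q t) ν :=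
    H.aestronglyMeasurable_resolvent hA hαm hα
  have hC0 : 0 ≤ C := tsum_nonneg fun m => mul_nonneg (by positivity)
    (mul_nonneg (hadamard_nonneg m) (pow_nonneg (integral_nonneg fun t =>
      mul_nonneg (mul_pos (H.left_pos t) (H.right_pos t)).le (norm_nonneg _)) _))
  have hg'm : AEStronglyMeasurable (fun t => ((g' t : ℂ))⁻¹) ν :=
    (Complex.measurable_ofReal.comp H.measurable_right).inv.aestronglyMeasurable
  have hfm : AEStronglyMeasurable (fun t => h t * f t) ν := by
    refine (hg'm.mul hf.aestronglyMeasurable).congr (Filter.Eventually.of_forall fun t => ?_)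
    have : (g' t : ℂ) ≠ 0 := by exact_mod_cast (H.right_pos t).ne'
    simp only [Pi.mul_apply]
    field_simp
  have hfn : ∀ t, ‖(g' t : ℂ) * (h t * f t)‖ = g' t * ‖h t * f t‖ := fun t => by
    rw [norm_mul, Complex.norm_real, Real.norm_eq_abs, abs_of_pos (H.right_pos t)]
  have hαf : Integrable (fun t => α t * (h t * f t)) ν := by
    refine Integrable.mono' (hf.norm.const_mul A) (hαm.aestronglyMeasurable.mul hfm)
      (Filter.Eventually.of_forall fun t => ?_)
    rw [norm_mul, hfn, ← mul_assoc]
    gcongr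
    exact hα t
  have hQfm : AEStronglyMeasurable (fun t => f t * (h t * Q t)) ν := by
    have hQm' : AEStronglyMeasurable (fun t => (h t * f t) * (h t * Q t)) ν := hfm.mul hQm
    -- Measurability is known for `h f`, not for `f`, so the product is recovered as `h⁻¹ (h f)(h
    -- Q)`; where `h` vanishes both expressions are zero.
    have h3 := (H.aestronglyMeasurable.aemeasurable.inv.aestronglyMeasurable).mul hQm'
    refine h3.congr (Filter.Eventually.of_forall fun t => ?_)
    simp only [Pi.mul_apply, Pi.inv_apply]
    by_cases ht : h t = 0
    · simp [ht]
    · field_simp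
  have hQf : Integrable (fun t => f t * (h t * Q t)) ν := by
    refine Integrable.mono' (hf.norm.const_mul (A * C)) hQfm
      (Filter.Eventually.of_forall fun t => ?_)
    rw [hfn]
    calc ‖f t * (h t * Q t)‖ = ‖h t * f t‖ * ‖Q t‖ := by simp only [norm_mul]; ring
      _ ≤ ‖h t * f t‖ * (A * g' t * C) := by gcongr; exact hQle t
      _ = _ := by ring
  have hjoint : Integrable (fun q : Z × Z => (h q.1 * Q q.1) * (κ q.1 q.2 * (h q.2 * f q.2)))
      (ν.prod ν) := by
    refine Integrable.mono' ((H.integrable.const_mul (A * C)).mul_prod hf.norm)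
      (hQm.comp_fst.mul (H.measurable_kernel.aestronglyMeasurable.mul hfm.comp_snd))
      (Filter.Eventually.of_forall fun q => ?_)
    rw [hfn, norm_mul, norm_mul, norm_mul (κ q.1 q.2)]
    have := H.left_pos q.1
    have := H.right_pos q.2
    have := H.right_pos q.1
    calc ‖h q.1‖ * ‖Q q.1‖ * (‖κ q.1 q.2‖ * ‖h q.2 * f q.2‖)
        ≤ ‖h q.1‖ * (A * g' q.1 * C) * (g q.1 * g' q.2 * ‖h q.2 * f q.2‖) := by
          gcongr
          · exact hQle _
          · exact H.norm_kernel_le _ _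
      _ = _ := by ring
  -- Fredholm's resolvent identity: the recursion applied with the column `β = κ(·, r)`.
  have hres : ∀ r, ∫ t, h t * Q t * κ t r ∂ν = α r * fredholmDet ν h κ - Q r := fun r => by
    have := H.fredholmBordered_eq (γ := α r) hA hαm hα (β := fun s => κ s r)
      (H.measurable_kernel.comp (measurable_id.prodMk measurable_const)) (H.right_pos r)
      (H.norm_kernel_le_swap r)
    have h1 : ∫ t, h t * Q t * κ t r ∂ν = ∫ t, (κ t r * h t) * Q t ∂ν := by
      refine integral_congr_ae (Filter.Eventually.of_forall fun t => ?_)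
      simp only; ring
    rw [h1]
    linear_combination this
  have hswap : ∫ t, (h t * Q t) * ∫ r, κ t r * (h r * f r) ∂ν ∂ν =
      fredholmDet ν h κ * (∫ t, α t * (h t * f t) ∂ν) - ∫ t, f t * (h t * Q t) ∂ν := by
    have h1 : ∫ t, (h t * Q t) * ∫ r, κ t r * (h r * f r) ∂ν ∂ν =
        ∫ t, ∫ r, (h t * Q t) * (κ t r * (h r * f r)) ∂ν ∂ν := by
      simp only [integral_const_mul]
    rw [h1, integral_integral_swap hjoint, ← integral_const_mul, ← integral_sub
      (hαf.const_mul _) hQf]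
    refine integral_congr_ae (Filter.Eventually.of_forall fun r => ?_)
    simp only
    have h2 : ∀ t, (h t * Q t) * (κ t r * (h r * f r)) = (h r * f r) * (h t * Q t * κ t r) :=
      fun t => by ring
    simp only [h2, integral_const_mul, hres]
    ring
  -- The equation is inserted for `β`. After the swap of integrals, the resolvent identity cancels
  -- `∫ f h Q` and leaves the determinant times `∫ α h f`.
  have hsplit : ∫ t, (β t * h t) * Q t ∂ν = (∫ t, f t * (h t * Q t) ∂ν) +
      ∫ t, (h t * Q t) * ∫ r, κ t r * (h r * f r) ∂ν ∂ν := by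
    have h1 : Integrable (fun t => (h t * Q t) * ∫ r, κ t r * (h r * f r) ∂ν) ν := by
      refine hjoint.integral_prod_left.congr (Filter.Eventually.of_forall fun t => ?_)
      simp only [integral_const_mul]
    rw [← integral_add hQf h1]
    refine integral_congr_ae (Filter.Eventually.of_forall fun t => ?_)
    simp only [← heq t]
    ring
  rw [H.fredholmBordered_eq (γ := γ) hA hαm hα hβm hB hβ, hsplit, hswap]
  ring

end Dominated

end Fredholm

namespace Fredholm

variable {Z : Type*} [MeasurableSpace Z] {ν : Measure Z}

/-! ### Differentiation of Fredholm series -/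

/-- The modulus is monotone in `y`, so the two endpoints dominate the whole interval. Moments at `x
± δ` then provide a majorant that does not depend on `y`. -/
theorem norm_exp_mul_le {x y δ : ℝ} (hy : |y - x| ≤ δ) (s : ℂ) :
    ‖Complex.exp ((y - x : ℝ) * s)‖ ≤
      ‖Complex.exp (((x - δ) - x : ℝ) * s)‖ + ‖Complex.exp (((x + δ) - x : ℝ) * s)‖ := by
  simp only [Complex.norm_exp, Complex.re_ofReal_mul]
  have h1 := abs_le.1 hy
  rcases le_total 0 s.re with hs | hs
  · have : Real.exp ((y - x) * s.re) ≤ Real.exp ((x + δ - x) * s.re) :=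
      Real.exp_le_exp.2 (mul_le_mul_of_nonneg_right (by linarith) hs)
    have := Real.exp_pos ((x - δ - x) * s.re)
    linarith
  · have : Real.exp ((y - x) * s.re) ≤ Real.exp ((x - δ - x) * s.re) :=
      Real.exp_le_exp.2 (mul_le_mul_of_nonpos_right (by linarith) hs)
    have := Real.exp_pos ((x + δ - x) * s.re)
    linarith

/-- A majorant in product form keeps the `m`-fold integral a power of a single one, even after the
factor `∑ s(z_a)` has appeared. -/
theorem norm_sum_le_prod {m : ℕ} (f : Fin m → ℂ) : ‖∑ a, f a‖ ≤ ∏ a, (1 + ‖f a‖) := by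
  refine (norm_sum_le _ _).trans ?_
  suffices h : 1 + ∑ a, ‖f a‖ ≤ ∏ a, (1 + ‖f a‖) by linarith
  induction m with
  | zero => simp
  | succ m ih =>
    rw [Fin.sum_univ_succ, Fin.prod_univ_succ]
    have h1 := ih fun a => f a.succ
    have h2 := norm_nonneg (f 0)
    have h3 : 0 ≤ ∑ a : Fin m, ‖f a.succ‖ := Finset.sum_nonneg fun a _ => norm_nonneg _
    nlinarith

/-- Since `h` depends exponentially on `x` with rate `s`, the derivative of `∏ h(z_a)` is the
product times `∑ s(z_a)`. Domination near `x` permits differentiation under each integral, and the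
same majorant `v` for every degree permits differentiation of the series. -/
theorem hasDerivAt_tsum_seriesTerm [SigmaFinite ν] {h : ℝ → Z → ℂ} {s : Z → ℂ}
    (hs : Measurable s) {J : Set ℝ} (hJ : IsOpen J) {w : Z → ℝ}
    (hwm : Measurable w) (hw : ∀ t, 0 ≤ w t)
    (hh : ∀ x y t, h y t = h x t * Complex.exp ((y - x : ℝ) * s t))
    (hm : ∀ x ∈ J, AEStronglyMeasurable (h x) ν)
    (hi : ∀ x ∈ J, Integrable (fun t => w t * (1 + ‖s t‖) * ‖h x t‖) ν)
    {G : ∀ m, (Fin m → Z) → ℂ} (hG : ∀ m, Measurable (G m)) {c : ℕ → ℝ}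
    (hc : ∀ A : ℝ, Summable fun m : ℕ => (m.factorial : ℝ)⁻¹ * (c m * A ^ m))
    (hb : ∀ m z, ‖G m z‖ ≤ c m * ∏ a, w (z a)) {x : ℝ} (hx : x ∈ J) :
    HasDerivAt (fun y => ∑' m, seriesTerm ν (h y) (G m))
      (∑' m, seriesTerm ν (h x) fun z => (∑ a, s (z a)) * G m z) x := by
  obtain ⟨δ, hδ, hball⟩ := Metric.nhds_basis_closedBall.mem_iff.1 (hJ.mem_nhds hx)
  have hmem : ∀ y, |y - x| ≤ δ → y ∈ J := fun y hy => hball (by simpa [Real.dist_eq] using hy)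
  have hl : x - δ ∈ J := hmem _ (by simp [abs_of_pos hδ])
  have hr : x + δ ∈ J := hmem _ (by simp [abs_of_pos hδ])
  have hmax : ∀ y, |y - x| ≤ δ → ∀ t, ‖h y t‖ ≤ ‖h (x - δ) t‖ + ‖h (x + δ) t‖ := by
    intro y hy t
    rw [hh x y, hh x (x - δ), hh x (x + δ), norm_mul, norm_mul, norm_mul, ← mul_add]
    exact mul_le_mul_of_nonneg_left (norm_exp_mul_le hy _) (norm_nonneg _)
  set v : Z → ℝ := fun t => w t * (1 + ‖s t‖) * (‖h (x - δ) t‖ + ‖h (x + δ) t‖) with hv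
  have hvi : Integrable v ν := by
    refine ((hi _ hl).add (hi _ hr)).congr (Filter.Eventually.of_forall fun t => ?_)
    simp only [Pi.add_apply, hv]; ring
  have hcw : ∀ (m : ℕ) (z : Fin m → Z), 0 ≤ c m * ∏ a, w (z a) := fun m z =>
    (norm_nonneg _).trans (hb m z)
  have hb' : ∀ (m : ℕ) (z : Fin m → Z), ‖(∑ a, s (z a)) * G m z‖ ≤
      c m * ∏ a, (w (z a) * (1 + ‖s (z a)‖)) := fun m z => by
    rw [norm_mul, Finset.prod_mul_distrib, ← mul_assoc, mul_comm]
    exact mul_le_mul (hb m z) (norm_sum_le_prod _) (norm_nonneg _) (hcw m z)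
  have hb'' : ∀ (m : ℕ) (y : ℝ), |y - x| ≤ δ → ∀ z : Fin m → Z,
      ‖(∑ a, s (z a)) * G m z * ∏ a, h y (z a)‖ ≤ c m * ∏ a, v (z a) := fun m y hy z => by
    rw [norm_mul, norm_prod, hv, Finset.prod_mul_distrib, ← mul_assoc]
    exact mul_le_mul (hb' m z) (Finset.prod_le_prod (fun a _ => norm_nonneg _)
      fun a _ => hmax y hy _) (Finset.prod_nonneg fun a _ => norm_nonneg _)
      ((norm_nonneg _).trans (hb' m z))
  have hsum_meas : ∀ m : ℕ, Measurable fun z : Fin m → Z => ∑ a, s (z a) := fun m =>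
    Finset.measurable_fun_sum _ fun a _ => hs.comp (measurable_pi_apply a)
  have hwi : ∀ y ∈ J, Integrable (fun t => w t * ‖h y t‖) ν := fun y hy => by
    refine Integrable.mono' (hi y hy) (hwm.aestronglyMeasurable.mul (hm y hy).norm)
      (Filter.Eventually.of_forall fun t => ?_)
    rw [norm_mul, norm_norm, Real.norm_eq_abs, abs_of_nonneg (hw t)]
    have := hw t
    have : w t ≤ w t * (1 + ‖s t‖) := le_mul_of_one_le_right this (by simp)
    gcongr
  have hder : ∀ (m : ℕ), ∀ y ∈ Set.Ioo (x - δ) (x + δ),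
      HasDerivAt (fun y => seriesTerm ν (h y) (G m))
        (seriesTerm ν (h y) fun z => (∑ a, s (z a)) * G m z) y := by
    intro m y hy
    have hyJ : ∀ y ∈ Set.Ioo (x - δ) (x + δ), |y - x| ≤ δ := fun y hy => by
      rw [abs_le]; constructor <;> linarith [hy.1, hy.2]
    have hIoo := Ioo_mem_nhds hy.1 hy.2
    have key := hasDerivAt_integral_of_dominated_loc_of_deriv_le (μ := Measure.pi fun _ : Fin m => ν)
      (F := fun y z => G m z * ∏ a, h y (z a))
      (F' := fun y z => (∑ a, s (z a)) * G m z * ∏ a, h y (z a))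
      (bound := fun z => c m * ∏ a, v (z a)) (x₀ := y) hIoo ?_ ?_ ?_ ?_ ?_ ?_
    · exact key.2.const_mul _
    · filter_upwards [hIoo] with y' hy'
      exact (hG m).aestronglyMeasurable.mul (aestronglyMeasurable_prod_apply
        (hm y' (hmem _ (hyJ _ hy'))) m)
    · exact integrable_mul_prod (hm y (hmem _ (hyJ _ hy))) (hwi y (hmem _ (hyJ _ hy)))
        (hG m).aestronglyMeasurable (hb m)
    · exact ((hsum_meas m).mul (hG m)).aestronglyMeasurable.mul (aestronglyMeasurable_prod_apply
        (hm y (hmem _ (hyJ _ hy))) m)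
    · exact Filter.Eventually.of_forall fun z y' hy' => hb'' m y' (hyJ _ hy') z
    · exact (Integrable.fintype_prod fun _ : Fin m => hvi).const_mul _
    · refine Filter.Eventually.of_forall fun z y' _ => ?_
      have h1 : ∀ q : ℝ, ∏ a, h q (z a) =
          (∏ a, h y' (z a)) * Complex.exp ((q - y' : ℝ) * ∑ a, s (z a)) := fun q => by
        rw [Finset.mul_sum, Complex.exp_sum, ← Finset.prod_mul_distrib]
        exact Finset.prod_congr rfl fun a _ => hh _ _ _
      have h2 : HasDerivAt (fun q : ℝ => Complex.exp ((q - y' : ℝ) * ∑ a, s (z a)))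
          (∑ a, s (z a)) y' := by
        have h3 : HasDerivAt (fun q : ℝ => ((q - y' : ℝ) : ℂ)) 1 y' := by
          simpa using ((hasDerivAt_id y').sub_const y').ofReal_comp
        simpa using (h3.mul_const (∑ a, s (z a))).cexp
      have h4 := (h2.const_mul (∏ a, h y' (z a))).const_mul (G m z)
      refine (h4.congr_deriv (by ring)).congr_of_eventuallyEq
        (Filter.Eventually.of_forall fun q => ?_)
      simp only [h1 q]
  have hsum : Summable fun m => seriesTerm ν (h x) (G m) :=
    Summable.of_norm_bounded (hc _) fun m => norm_seriesTerm_le (hwi x hx) (hb m)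
  refine hasDerivAt_tsum_of_isPreconnected (u := fun m : ℕ => (m.factorial : ℝ)⁻¹ *
    (c m * (∫ t, v t ∂ν) ^ m)) (hc _) isOpen_Ioo isPreconnected_Ioo hder ?_
    (y₀ := x) (by simp [hδ]) hsum (by simp [hδ])
  intro m y hy
  rw [seriesTerm, norm_mul, norm_inv, Complex.norm_natCast]
  gcongr
  calc _ ≤ ∫ z : Fin m → Z, c m * ∏ a, v (z a) ∂(Measure.pi fun _ => ν) :=
        norm_integral_le_of_norm_le ((Integrable.fintype_prod fun _ : Fin m => hvi).const_mul _)
          (Filter.Eventually.of_forall fun z => hb'' m y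
            (by rw [abs_le]; constructor <;> linarith [hy.1, hy.2]) z)
    _ = _ := by
        rw [integral_const_mul, integral_fintype_prod_eq_pow v]
        simp

end Fredholm

namespace DirectLin

variable {S : Data}

/-! ### The plane wave factors -/

/-- The factor `(p₁ + k) / (p₁ - k)` of one step in `n₁`. -/
def ratio (S : Data) (k : ℂ) : ℂ := (S.p 0 + k) / (S.p 0 - k)

theorem NonSing.add_ne_zero {k : ℂ} (hk : NonSing S k) : S.p 0 + k ≠ 0 := fun h =>
  hk.2.1.2 (by linear_combination h)

theorem NonSing.sub_ne_zero {k : ℂ} (hk : NonSing S k) : S.p 0 - k ≠ 0 := fun h =>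
  hk.2.1.1 (by linear_combination -h)

theorem NonSing.ratio_ne_zero {k : ℂ} (hk : NonSing S k) : ratio S k ≠ 0 :=
  div_ne_zero hk.add_ne_zero hk.sub_ne_zero

theorem flow_add_one {k : ℂ} (hk : NonSing S k) (N : ℤ) (x : ℝ) :
    flow S (N + 1) x k = flow S N x k * ratio S k := by
  have := zpow_add_one₀ hk.ratio_ne_zero N
  rw [ratio] at this
  rw [flow, flow, this, ratio]
  ring

theorem flow_exp (N : ℤ) (x y : ℝ) (k : ℂ) :
    flow S N y k = flow S N x k * Complex.exp ((y - x : ℝ) * k) := by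
  rw [flow, flow, mul_right_comm, ← Complex.exp_add]
  congr 2
  push_cast
  ring

theorem rho_add_one {k : ℂ} (hk : NonSing S k) (N n : ℤ) (x : ℝ) :
    rho S N (n + 1) x k = rho S N n x k * k := by
  rw [rho, rho, zpow_add_one₀ hk.1]; ring

theorem rho_shift {k : ℂ} (hk : NonSing S k) (N n : ℤ) (x : ℝ) :
    rho S (N + 1) n x k = rho S N n x k * ratio S k := by
  rw [rho, rho, flow_add_one hk]; ring

theorem hasDerivAt_rho (N n : ℤ) (x : ℝ) (k : ℂ) :
    HasDerivAt (fun y => rho S N n y k) (k * rho S N n x k) x := by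
  have h3 : HasDerivAt (fun q : ℝ => ((q - x : ℝ) : ℂ)) 1 x := by
    simpa using ((hasDerivAt_id x).sub_const x).ofReal_comp
  have h2 : HasDerivAt (fun q : ℝ => Complex.exp ((q - x : ℝ) * k)) k x := by
    simpa using (h3.mul_const k).cexp
  refine ((h2.const_mul (flow S N x k)).mul_const (k ^ n)).congr_deriv
    (by rw [rho]; ring) |>.congr_of_eventuallyEq (Filter.Eventually.of_forall fun q => ?_)
  simp only [rho]
  rw [flow_exp N x q]

/-! ### The measure and the density on the domain -/

/-- The measure `μ` on the domain `D`. -/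
def dom (S : Data) : Measure S.D := S.μ.comap Subtype.val

/-- The density `w ρ_n(k) σ_n(k')` on the domain `D`. -/
def dens (S : Data) (N n : ℤ) (x : ℝ) (z : S.D) : ℂ :=
  S.w z * (rho S N n x z.1.1 * sigma S N n x z.1.2)

/-- The Cauchy kernel on the domain `D`. -/
def cauchy (S : Data) (s t : S.D) : ℂ := Om s.1.1 t.1.2

variable {K : Set ℂ} {J : Set ℝ}

theorem Admissible.sigmaFinite_dom (H : Admissible S K J) : SigmaFinite (dom S) := by
  have := H.sigmaFinite
  refine SigmaFinite.of_map (dom S) measurable_subtype_coe.aemeasurable ?_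
  rw [dom, map_comap_subtype_coe H.measurableSet]
  infer_instance

theorem Admissible.integrable_dom_iff (H : Admissible S K J) (f : ℂ × ℂ → ℂ) :
    IntegrableOn f S.D S.μ ↔ Integrable (fun z : S.D => f z) (dom S) :=
  integrableOn_iff_comap_subtypeVal H.measurableSet

theorem Admissible.integral_dom (H : Admissible S K J) (f : ℂ × ℂ → ℂ) :
    ∫ z in S.D, f z ∂S.μ = ∫ z, f z ∂(dom S) :=
  (integral_subtype_comap H.measurableSet f).symm

theorem Admissible.nonSing_fst (H : Admissible S K J) (z : S.D) : NonSing S z.1.1 :=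
  H.nonSing_left _ (H.fst_mem _ z.2)

theorem Admissible.nonSing_snd (H : Admissible S K J) (z : S.D) : NonSing S z.1.2 :=
  H.nonSing_right _ z.2

theorem Admissible.dens_add_one (H : Admissible S K J) (N n : ℤ) (x : ℝ) (z : S.D) :
    dens S N (n + 1) x z = -(z.1.1 / z.1.2) * dens S N n x z := by
  have h2 := (H.nonSing_snd z).1
  have h3 : (-z.1.2) ^ (-(n + 1)) = (-z.1.2) ^ (-n) * (-z.1.2)⁻¹ := by
    rw [neg_add, ← sub_eq_add_neg, zpow_sub_one₀ (neg_ne_zero.2 h2)]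
  rw [dens, dens, rho_add_one (H.nonSing_fst z), sigma, sigma, h3]
  field_simp

theorem Admissible.dens_shift (H : Admissible S K J) (N n : ℤ) (x : ℝ) (z : S.D) :
    dens S (N + 1) n x z = ratio S z.1.1 * ratio S z.1.2 * dens S N n x z := by
  rw [dens, dens, rho_shift (H.nonSing_fst z), sigma, sigma, flow_add_one (H.nonSing_snd z)]
  ring

theorem dens_exp (N n : ℤ) (x y : ℝ) (z : S.D) :
    dens S N n y z = dens S N n x z * Complex.exp ((y - x : ℝ) * (z.1.1 + z.1.2)) := by
  rw [dens, dens, rho, rho, sigma, sigma, flow_exp N x y, flow_exp N x y, mul_add,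
    Complex.exp_add]
  ring

theorem Admissible.integrable_dens_mul (H : Admissible S K J) (N n i j : ℤ) {x : ℝ}
    (hx : x ∈ J) : Integrable (fun z => dens S N n x z * (z.1.1 ^ i * z.1.2 ^ j)) (dom S) := by
  refine ((H.integrable_dom_iff _).1 (H.moments N n i j x hx)).congr
    (Filter.Eventually.of_forall fun z => ?_)
  simp only [dens]; ring

theorem Admissible.aestronglyMeasurable_dens (H : Admissible S K J) (N n : ℤ) {x : ℝ}
    (hx : x ∈ J) : AEStronglyMeasurable (dens S N n x) (dom S) := by
  simpa using (H.integrable_dens_mul N n 0 0 hx).aestronglyMeasurable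

theorem measurable_Om {X : Type*} [MeasurableSpace X] {a b : X → ℂ} (ha : Measurable a)
    (hb : Measurable b) : Measurable fun x => Om (a x) (b x) :=
  measurable_const.div (ha.add hb)

theorem measurable_cauchy : Measurable (Function.uncurry (cauchy S)) :=
  measurable_Om (measurable_fst.comp (measurable_subtype_coe.comp measurable_fst))
    (measurable_snd.comp (measurable_subtype_coe.comp measurable_snd))

theorem Admissible.tauTerm_eq (H : Admissible S K J) (N n : ℤ) {x : ℝ} (hx : x ∈ J) (m : ℕ) :
    tauTerm S N n x m = Fredholm.seriesTerm (dom S) (dens S N n x) fun z : Fin m → S.D =>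
      (Fredholm.kernelMatrix (cauchy S) z).det := by
  have := H.sigmaFinite_dom
  have := H.sigmaFinite
  have hmp : MeasurePreserving (fun (z : Fin m → S.D) a => (z a).1)
      (Measure.pi fun _ : Fin m => dom S) (Measure.pi fun _ : Fin m => S.μ.restrict S.D) :=
    measurePreserving_pi _ _ fun _ =>
      ⟨measurable_subtype_coe, map_comap_subtype_coe H.measurableSet _⟩
  have haesm : AEStronglyMeasurable (fun z => S.w z * (rho S N n x z.1 * sigma S N n x z.2))
      (S.μ.restrict S.D) := by
    simpa using (H.moments N n 0 0 x hx).aestronglyMeasurable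
  have hdet := Fredholm.measurable_det_kernelMatrix (κ := fun s t : ℂ × ℂ => Om s.1 t.2) (m := m)
    (measurable_Om (measurable_fst.comp measurable_fst) (measurable_snd.comp measurable_snd))
  have haux := hdet.aestronglyMeasurable.mul (Fredholm.aestronglyMeasurable_prod_apply haesm m)
  rw [← hmp.map_eq] at haux
  rw [tauTerm, Fredholm.seriesTerm]
  congr 1
  rw [← hmp.map_eq]
  exact integral_map hmp.measurable.aemeasurable haux

theorem Admissible.tau_eq (H : Admissible S K J) (N n : ℤ) {x : ℝ} (hx : x ∈ J) :
    tau S N n x = Fredholm.fredholmDet (dom S) (dens S N n x) (cauchy S) :=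
  tsum_congr fun m => H.tauTerm_eq N n hx m

/-! ### Integrability -/

/-- `|k| + 1/|k|`. -/
def size (k : ℂ) : ℝ := ‖k‖ + ‖k‖⁻¹

theorem measurable_size : Measurable size := measurable_norm.add measurable_norm.inv

theorem one_le_size {k : ℂ} (hk : k ≠ 0) : 1 ≤ size k := by
  have h0 : 0 < ‖k‖ := norm_pos_iff.2 hk
  rcases le_total 1 ‖k‖ with h | h
  · have := inv_pos.2 h0
    rw [size]; linarith
  · have := (one_le_inv₀ h0).2 h
    rw [size]; linarith

theorem norm_le_size (k : ℂ) : ‖k‖ ≤ size k := by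
  have := inv_nonneg.2 (norm_nonneg k)
  rw [size]; linarith

theorem inv_norm_le_size (k : ℂ) : ‖k‖⁻¹ ≤ size k := by
  have := norm_nonneg k
  rw [size]; linarith

/-- Each factor `|f| + 1/|f|` shifts the exponent by `±1`, so having all integer moments is enough.
-/
theorem integrable_size_mul {X : Type*} [MeasurableSpace X] {ν : Measure X} {f : X → ℂ}
    (hf : ∀ x, f x ≠ 0) {F : X → ℝ} (hF : ∀ i : ℤ, Integrable (fun x => F x * ‖f x‖ ^ i) ν)
    (a : ℕ) : ∀ i : ℤ, Integrable (fun x => F x * size (f x) ^ a * ‖f x‖ ^ i) ν := by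
  induction a with
  | zero => simpa using hF
  | succ a ih =>
    intro i
    refine ((ih (i + 1)).add (ih (i - 1))).congr (Filter.Eventually.of_forall fun x => ?_)
    have h0 : ‖f x‖ ≠ 0 := norm_ne_zero_iff.2 (hf x)
    simp only [Pi.add_apply]
    rw [zpow_add_one₀ h0, zpow_sub_one₀ h0, pow_succ]
    have : size (f x) = ‖f x‖ + ‖f x‖⁻¹ := rfl
    generalize size (f x) ^ a = q at *
    rw [this]
    ring

theorem Admissible.integrable_size (H : Admissible S K J) (N n : ℤ) {x : ℝ} (hx : x ∈ J)
    (a b : ℕ) :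
    Integrable (fun z => ‖dens S N n x z‖ * size z.1.1 ^ a * size z.1.2 ^ b) (dom S) := by
  have h1 : ∀ j i : ℤ, Integrable (fun z => (‖dens S N n x z‖ * ‖z.1.2‖ ^ j) * ‖z.1.1‖ ^ i)
      (dom S) := fun j i => by
    refine (H.integrable_dens_mul N n i j hx).norm.congr (Filter.Eventually.of_forall fun z => ?_)
    simp only [norm_mul, norm_zpow]; ring
  have h2 : ∀ j : ℤ, Integrable
      (fun z => (‖dens S N n x z‖ * size z.1.1 ^ a) * ‖z.1.2‖ ^ j) (dom S) := fun j => by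
    refine (integrable_size_mul (fun z => (H.nonSing_fst z).1) (h1 j) a 0).congr
      (Filter.Eventually.of_forall fun z => ?_)
    simp only [zpow_zero]; ring
  simpa using integrable_size_mul (fun z => (H.nonSing_snd z).1) h2 b 0

/-- Removing the pole of `1/(p₁ + k')`. -/
theorem Admissible.dens_add_one_mul_Om (H : Admissible S K J) (N n : ℤ) (x : ℝ) (z : S.D) :
    dens S (N + 1) n x z * Om (S.p 0) z.1.2 = Om z.1.1 z.1.2 * ((S.p 0 + z.1.1) / (2 * S.p 0)) *
      (dens S (N + 1) n x z - dens S N n x z) := by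
  obtain ⟨c, m, hker⟩ := H.kernel
  have h0 := (hker z.1.1 (H.fst_mem _ z.2) z.1 z.2).1
  have h1 := (H.nonSing_fst z).sub_ne_zero
  have h2 := (H.nonSing_snd z).add_ne_zero
  have h3 := (H.nonSing_snd z).sub_ne_zero
  have h4 := H.p_ne_zero
  rw [H.dens_shift, ratio, ratio, Om, Om]
  field_simp
  ring

/-- The point `p₁` is never in `K`, so the kernel bound says nothing about `Ω(p₁, k')`. The density
one step ahead in `n₁` contains the factor `p₁ + k'`; clearing the pole with it trades `Ω(p₁, k')`
for `Ω(k, k')` times a difference of densities at consecutive `n₁`, all of whose moments are finite.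
-/
theorem Admissible.integrable_Om_size (H : Admissible S K J) (N n : ℤ) {x : ℝ} (hx : x ∈ J)
    (a b : ℕ) :
    Integrable (fun z => ‖dens S N n x z‖ * ‖Om (S.p 0) z.1.2‖ * size z.1.1 ^ a *
      size z.1.2 ^ b) (dom S) := by
  obtain ⟨c, m, hker⟩ := H.kernel
  obtain ⟨M, rfl⟩ : ∃ M, N = M + 1 := ⟨N - 1, by ring⟩
  have h4 : 0 < ‖S.p 0‖ := norm_pos_iff.2 H.p_ne_zero
  have hI := ((H.integrable_size (M + 1) n hx (m + 1 + a) (m + b)).add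
    (H.integrable_size M n hx (m + 1 + a) (m + b))).const_mul
      (c * ((‖S.p 0‖ + 1) / (2 * ‖S.p 0‖)))
  refine Integrable.mono' hI ?_ (Filter.Eventually.of_forall fun z => ?_)
  · refine (((H.aestronglyMeasurable_dens _ _ hx).norm.mul ?_).mul ?_).mul ?_
    · exact (measurable_Om measurable_const
        (measurable_snd.comp measurable_subtype_coe)).norm.aestronglyMeasurable
    · exact ((measurable_size.comp
        (measurable_fst.comp measurable_subtype_coe)).pow_const a).aestronglyMeasurable
    · exact ((measurable_size.comp
        (measurable_snd.comp measurable_subtype_coe)).pow_const b).aestronglyMeasurable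
  · have s1 := one_le_size (H.nonSing_fst z).1
    have s2 := one_le_size (H.nonSing_snd z).1
    have hk := (hker z.1.1 (H.fst_mem _ z.2) z.1 z.2).2
    change _ ≤ c * size z.1.1 ^ m * size z.1.2 ^ m at hk
    have hp : ‖S.p 0 + z.1.1‖ ≤ (‖S.p 0‖ + 1) * size z.1.1 := by
      refine (norm_add_le _ _).trans ?_
      have := norm_le_size z.1.1
      nlinarith
    have hd := norm_sub_le (dens S (M + 1) n x z) (dens S M n x z)
    rw [Real.norm_of_nonneg (by positivity), ← norm_mul, H.dens_add_one_mul_Om, norm_mul, norm_mul,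
      norm_div, norm_mul 2 (S.p 0), Complex.norm_ofNat]
    simp only [Pi.add_apply]
    calc _ ≤ (c * size z.1.1 ^ m * size z.1.2 ^ m) *
          ((‖S.p 0‖ + 1) * size z.1.1 / (2 * ‖S.p 0‖)) *
          (‖dens S (M + 1) n x z‖ + ‖dens S M n x z‖) * size z.1.1 ^ a * size z.1.2 ^ b := by
          have := (norm_nonneg _).trans hk
          gcongr
      _ = _ := by rw [pow_add, pow_add, pow_add]; ring

end DirectLin

namespace DirectLin

variable {S : Data} {K : Set ℂ} {J : Set ℝ}

/-! ### The solution of the integral equation, without its plane wave factor -/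

/-- The solution `u` divided by its plane wave factor `ρ_n(k)`, continued to all `k` by means of
the integral equation. -/
def amplitude (S : Data) (N n : ℤ) (x : ℝ) (u : ℂ → ℤ → ℂ) (i : ℤ) (k : ℂ) : ℂ :=
  k ^ i - ∫ t, Om k t.1.2 * (S.w t * (sigma S N n x t.1.2 * u t.1.1 i)) ∂(dom S)

theorem IsSolution.eq_rho_mul {N n : ℤ} {x : ℝ} {u : ℂ → ℤ → ℂ} (hu : IsSolution S K N n x u)
    (H : Admissible S K J) (i : ℤ) {k : ℂ} (hk : k ∈ K) :
    u k i = rho S N n x k * amplitude S N n x u i k := by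
  have h1 := hu.eqn k hk i
  rw [H.integral_dom] at h1
  have h2 : ∫ t : S.D, S.w t * (rho S N n x k * Om k t.1.2 * sigma S N n x t.1.2 * u t.1.1 i)
      ∂(dom S) = rho S N n x k *
        ∫ t : S.D, Om k t.1.2 * (S.w t * (sigma S N n x t.1.2 * u t.1.1 i)) ∂(dom S) := by
    rw [← integral_const_mul]
    refine integral_congr_ae (Filter.Eventually.of_forall fun t => ?_)
    simp only; ring
  rw [h2] at h1
  rw [amplitude]
  linear_combination h1

theorem IsSolution.dens_mul_amplitude {N n : ℤ} {x : ℝ} {u : ℂ → ℤ → ℂ}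
    (hu : IsSolution S K N n x u) (H : Admissible S K J) (i : ℤ) (t : S.D) :
    dens S N n x t * amplitude S N n x u i t.1.1 =
      S.w t * (sigma S N n x t.1.2 * u t.1.1 i) := by
  rw [hu.eq_rho_mul H i (H.fst_mem _ t.2), dens]
  ring

theorem IsSolution.amplitude_add {N n : ℤ} {x : ℝ} {u : ℂ → ℤ → ℂ}
    (hu : IsSolution S K N n x u) (H : Admissible S K J) (i : ℤ) (k : ℂ) :
    amplitude S N n x u i k +
      ∫ t, Om k t.1.2 * (dens S N n x t * amplitude S N n x u i t.1.1) ∂(dom S) = k ^ i := by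
  simp only [hu.dens_mul_amplitude H]
  rw [amplitude]
  ring

/-- Weights which dominate the kernel at the spectral points `T ⊇ K`. -/
structure Weights (S : Data) (K : Set ℂ) (J : Set ℝ) (T : Set ℂ) (g g' : ℂ → ℝ) : Prop where
  admissible : Admissible S K J
  subset : K ⊆ T
  dominated : ∀ (N n : ℤ), ∀ x ∈ J, Fredholm.Dominated (dom S) (dens S N n x) (cauchy S)
    (fun s => g s.1.1) (fun t => g' t.1.2)
  measurable_right : Measurable g'
  integrable : ∀ (N n : ℤ), ∀ x ∈ J, Integrable (fun z : S.D =>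
    g z.1.1 * g' z.1.2 * (1 + ‖z.1.1 + z.1.2‖) * ‖dens S N n x z‖) (dom S)
  row : ∀ k ∈ T, ∃ A > 0, ∀ t : S.D, ‖Om k t.1.2‖ ≤ A * g' t.1.2
  add_ne_zero : ∀ k ∈ T, ∀ t : S.D, k + t.1.2 ≠ 0
  one_le_right : ∀ t : S.D, 1 ≤ g' t.1.2
  inv_le_right : ∀ t : S.D, ‖t.1.2⁻¹‖ ≤ g' t.1.2
  one_le_left : ∀ s : S.D, 1 ≤ g s.1.1
  norm_le_left : ∀ s : S.D, ‖s.1.1‖ ≤ g s.1.1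
  solution : ∀ (N n : ℤ), ∀ x ∈ J, ∀ u, IsSolution S K N n x u → ∀ i : ℤ,
    (∀ s : S.D, ‖s.1.1 ^ i‖ ≤ g s.1.1) → ∀ b : ℕ,
      Integrable (fun t : S.D => ((size t.1.2 ^ b * g' t.1.2 : ℝ) : ℂ) *
        (dens S N n x t * amplitude S N n x u i t.1.1)) (dom S)

/-- The function `r` makes room for one further row of the kernel: zero when `T = K`, and `|Ω(p₁,
·)|` when `p₁` is adjoined. The exponent is `m + 1` rather than `m` so that the weights also
dominate `|k|` and `1/|k'|`, even for `m = 0`. -/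
theorem Admissible.weights (H : Admissible S K J) {T : Set ℂ} (hKT : K ⊆ T)
    (hT : ∀ k ∈ T, ∀ t : S.D, k + t.1.2 ≠ 0) {C : ℝ} (hC1 : 1 ≤ C) {m : ℕ}
    (hcore : ∀ k ∈ K, ∀ t : S.D, ‖Om k t.1.2‖ ≤ C * size k ^ m * size t.1.2 ^ m)
    {r : ℂ → ℝ} (hr : ∀ k, 0 ≤ r k) (hrm : Measurable r)
    (hri : ∀ (N n : ℤ), ∀ x ∈ J, ∀ a b : ℕ, Integrable
      (fun z : S.D => ‖dens S N n x z‖ * r z.1.2 * size z.1.1 ^ a * size z.1.2 ^ b) (dom S))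
    (hrow : ∀ k ∈ T, k ∈ K ∨ ∀ t : S.D, ‖Om k t.1.2‖ ≤ r t.1.2) :
    Weights S K J T (fun k => C * size k ^ (m + 1)) (fun k => size k ^ (m + 1) + r k) := by
  have hC0 : 0 < C := by linarith
  have hfst : Measurable fun s : S.D => s.1.1 := measurable_fst.comp measurable_subtype_coe
  have hsnd : Measurable fun s : S.D => s.1.2 := measurable_snd.comp measurable_subtype_coe
  set g : ℂ → ℝ := fun k => C * size k ^ (m + 1) with hg
  set g' : ℂ → ℝ := fun k => size k ^ (m + 1) + r k with hg'
  have hgm : Measurable g := (measurable_size.pow_const _).const_mul C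
  have hg'm : Measurable g' :=
    (measurable_size.pow_const _).add hrm
  have size_fst : ∀ s : S.D, 1 ≤ size s.1.1 := fun s => one_le_size (H.nonSing_fst s).1
  have size_snd : ∀ s : S.D, 1 ≤ size s.1.2 := fun s => one_le_size (H.nonSing_snd s).1
  have hle_pow : ∀ k, 1 ≤ size k → size k ≤ size k ^ (m + 1) := fun k hk =>
    le_self_pow₀ hk (Nat.succ_ne_zero m)
  have hg_le : ∀ k, 1 ≤ size k → size k ≤ g k := fun k hk => by
    have h1 := hle_pow k hk
    have : size k ^ (m + 1) ≤ C * size k ^ (m + 1) :=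
      le_mul_of_one_le_left (by positivity) hC1
    exact h1.trans this
  have hg'_le : ∀ k, 1 ≤ size k → size k ≤ g' k := fun k hk => by
    have h1 := hle_pow k hk
    have := hr k
    simp only [hg']
    linarith
  have hpow : ∀ k, 1 ≤ size k → size k ^ m ≤ size k ^ (m + 1) := fun k hk =>
    pow_le_pow_right₀ hk (Nat.le_succ m)
  have hkernel : ∀ k ∈ K, ∀ t : S.D, ‖Om k t.1.2‖ ≤ g k * g' t.1.2 := fun k hk t => by
    have h1 := one_le_size (H.nonSing_left k hk).1
    have h2 := size_snd t
    refine (hcore k hk t).trans ?_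
    have h3 := hpow k h1
    have h4 : size t.1.2 ^ m ≤ g' t.1.2 := by
      have := hpow _ h2
      have := hr t.1.2
      simp only [hg']
      linarith
    simp only [hg]
    gcongr
  have hint : ∀ (N n : ℤ), ∀ x ∈ J, Integrable (fun z : S.D =>
      g z.1.1 * g' z.1.2 * (1 + ‖z.1.1 + z.1.2‖) * ‖dens S N n x z‖) (dom S) := by
    intro N n x hx
    have hI := ((H.integrable_size N n hx (m + 2) (m + 2)).add
      (hri N n x hx (m + 2) 1)).const_mul (3 * C)
    refine Integrable.mono' hI ?_ (Filter.Eventually.of_forall fun z => ?_)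
    · refine ((((hgm.comp hfst).mul (hg'm.comp hsnd)).mul ?_).aestronglyMeasurable).mul
        (H.aestronglyMeasurable_dens N n hx).norm
      exact measurable_const.add (hfst.add hsnd).norm
    · have s1 := size_fst z
      have s2 := size_snd z
      have h3 : 1 + ‖z.1.1 + z.1.2‖ ≤ 3 * (size z.1.1 * size z.1.2) := by
        have h4 := norm_add_le z.1.1 z.1.2
        have h5 := norm_le_size z.1.1
        have h6 := norm_le_size z.1.2
        nlinarith
      have hg0 : 0 ≤ g z.1.1 := by simp only [hg]; positivity
      have hg'0 : 0 ≤ g' z.1.2 := add_nonneg (by positivity) (hr _)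
      rw [Real.norm_of_nonneg (by positivity)]
      simp only [Pi.add_apply]
      calc g z.1.1 * g' z.1.2 * (1 + ‖z.1.1 + z.1.2‖) * ‖dens S N n x z‖
          ≤ g z.1.1 * g' z.1.2 * (3 * (size z.1.1 * size z.1.2)) * ‖dens S N n x z‖ := by
            gcongr
        _ = _ := by simp only [hg, hg']; ring
  have hpos : ∀ s : S.D, 0 < g s.1.1 := fun s => by
    have := size_fst s
    exact mul_pos hC0 (by positivity)
  have hpos' : ∀ t : S.D, 0 < g' t.1.2 := fun t => by
    have := hg'_le _ (size_snd t)
    linarith [size_snd t]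
  have hdominated : ∀ (N n : ℤ), ∀ x ∈ J, Fredholm.Dominated (dom S) (dens S N n x) (cauchy S)
      (fun s => g s.1.1) (fun t => g' t.1.2) := fun N n x hx =>
    { measurable_left := hgm.comp hfst
      measurable_right := hg'm.comp hsnd
      left_pos := hpos
      right_pos := hpos'
      measurable_kernel := measurable_cauchy
      norm_kernel_le := fun s t => hkernel _ (H.fst_mem _ s.2) t
      aestronglyMeasurable := H.aestronglyMeasurable_dens N n hx
      integrable := by
        refine Integrable.mono' (hint N n x hx)
          (((hgm.comp hfst).mul (hg'm.comp hsnd)).aestronglyMeasurable.mul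
            (H.aestronglyMeasurable_dens N n hx).norm) (Filter.Eventually.of_forall fun z => ?_)
        have h1 := hpos z
        have h2 := hpos' z
        rw [Real.norm_of_nonneg (by positivity)]
        exact mul_le_mul_of_nonneg_right (le_mul_of_one_le_right (by positivity)
          (le_add_of_nonneg_right (norm_nonneg _))) (norm_nonneg _) }
  refine ⟨H, hKT, hdominated, hg'm, hint, ?_, hT, ?_, ?_, ?_, ?_, ?_⟩
  · intro k hk
    rcases hrow k hk with hk | hk
    · have h1 := one_le_size (H.nonSing_left k hk).1
      exact ⟨g k, mul_pos hC0 (by positivity), hkernel k hk⟩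
    · refine ⟨1, one_pos, fun t => ?_⟩
      have := size_snd t
      have : 0 ≤ size t.1.2 ^ (m + 1) := by positivity
      have := hk t
      simp only [hg']
      linarith
  · exact fun t => (size_snd t).trans (hg'_le _ (size_snd t))
  · exact fun t => by
      rw [norm_inv]
      exact (inv_norm_le_size _).trans (hg'_le _ (size_snd t))
  · exact fun t => (size_fst t).trans (hg_le _ (size_fst t))
  · exact fun t => (norm_le_size _).trans (hg_le _ (size_fst t))
  · intro N n x hx u hu i hi b
    set F : S.D → ℂ := fun t => S.w t * (sigma S N n x t.1.2 * u t.1.1 i) with hF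
    have hFj : ∀ j : ℤ, Integrable (fun t => F t * t.1.2 ^ j) (dom S) := fun j => by
      refine ((H.integrable_dom_iff _).1 (hu.integrable i j)).congr
        (Filter.Eventually.of_forall fun z => ?_)
      simp only [hF]; ring
    have hFm : AEStronglyMeasurable F (dom S) := by
      simpa using (hFj 0).aestronglyMeasurable
    have hFs : Integrable (fun t => size t.1.2 ^ m * ‖F t‖) (dom S) := by
      refine (integrable_size_mul (F := fun t => ‖F t‖) (fun z => (H.nonSing_snd z).1)
        (fun j => ?_) m 0).congr (Filter.Eventually.of_forall fun z => ?_)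
      · refine (hFj j).norm.congr (Filter.Eventually.of_forall fun z => ?_)
        simp only [norm_mul, norm_zpow]
      · simp only [zpow_zero]; ring
    set I := ∫ t, size t.1.2 ^ m * ‖F t‖ ∂(dom S) with hI
    have hI0 : 0 ≤ I := integral_nonneg fun t => by
      have := size_snd t
      positivity
    -- The integral equation bounds its own solution: `w σ u` has all moments in `k'`, so the
    -- amplitude is of order `g`. Integrability against the larger weight, pole included, then
    -- reduces to moments of the density.
    have hamp : ∀ s : S.D, ‖amplitude S N n x u i s.1.1‖ ≤ (1 + I) * g s.1.1 := fun s => by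
      have h1 : ‖∫ t, Om s.1.1 t.1.2 * F t ∂(dom S)‖ ≤ (C * size s.1.1 ^ m) * I := by
        rw [hI, ← integral_const_mul]
        refine norm_integral_le_of_norm_le (hFs.const_mul _)
          (Filter.Eventually.of_forall fun t => ?_)
        rw [norm_mul, ← mul_assoc]
        gcongr
        exact hcore _ (H.fst_mem _ s.2) t
      have h2 : C * size s.1.1 ^ m ≤ g s.1.1 := by
        simp only [hg]
        gcongr 1
        exact hpow _ (size_fst s)
      calc _ ≤ ‖s.1.1 ^ i‖ + ‖∫ t, Om s.1.1 t.1.2 * F t ∂(dom S)‖ := norm_sub_le _ _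
        _ ≤ g s.1.1 + g s.1.1 * I := by
            refine add_le_add (hi s) (h1.trans ?_)
            gcongr
        _ = _ := by ring
    have hI2 := ((H.integrable_size N n hx (m + 1) (b + (m + 1))).add
      (hri N n x hx (m + 1) b)).const_mul ((1 + I) * C)
    refine Integrable.mono' hI2 ?_ (Filter.Eventually.of_forall fun t => ?_)
    · simp only [hu.dens_mul_amplitude H]
      exact (Complex.measurable_ofReal.comp (((measurable_size.comp hsnd).pow_const b).mul
        (hg'm.comp hsnd))).aestronglyMeasurable.mul hFm
    · have := hpos' t
      have := size_snd t
      rw [norm_mul, norm_mul, Complex.norm_real, Real.norm_of_nonneg (by positivity)]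
      simp only [Pi.add_apply]
      calc _ ≤ size t.1.2 ^ b * g' t.1.2 * (‖dens S N n x t‖ * ((1 + I) * g t.1.1)) := by
            gcongr
            exact hamp t
        _ = _ := by simp only [hg, hg']; ring

/-- Two systems with a common `g` are needed. Multiplication by `(p₁+k)/(p₁-k)` brings in `Ω(p₁,
k')`, which uses up the weight `g'`; the result is only controlled with `g₀`, a pure power of
`size`, and only on `K`. -/
theorem Admissible.exists_weights (H : Admissible S K J) : ∃ g g₀ g' : ℂ → ℝ,
    Weights S K J K g g₀ ∧ Weights S K J (insert (S.p 0) K) g g' ∧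
      ∃ b : ℕ, ∀ k, g₀ k = size k ^ b := by
  obtain ⟨c, m, hker⟩ := H.kernel
  have hcore : ∀ k ∈ K, ∀ t : S.D, ‖Om k t.1.2‖ ≤ max c 1 * size k ^ m * size t.1.2 ^ m :=
    fun k hk t => by
    have h1 := one_le_size (H.nonSing_left k hk).1
    have h2 := one_le_size (H.nonSing_snd t).1
    refine ((hker k hk t.1 t.2).2).trans ?_
    change c * size k ^ m * size t.1.2 ^ m ≤ _
    gcongr
    exact le_max_left _ _
  have hK : ∀ k ∈ K, ∀ t : S.D, k + t.1.2 ≠ 0 := fun k hk t => (hker k hk t.1 t.2).1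
  refine ⟨_, _, _, H.weights subset_rfl hK (le_max_right c 1) hcore (r := fun _ => 0)
    (fun _ => le_rfl) measurable_const (fun N n x hx a b => by simp) (fun k hk => Or.inl hk),
    H.weights (Set.subset_insert _ _) ?_ (le_max_right c 1) hcore
      (r := fun k => ‖Om (S.p 0) k‖) (fun _ => norm_nonneg _)
      (measurable_Om measurable_const measurable_id).norm
      (fun N n x hx a b => H.integrable_Om_size N n hx a b) ?_, m + 1, fun k => add_zero _⟩
  · rintro k (rfl | hk) t
    · exact (H.nonSing_snd t).add_ne_zero
    · exact hK k hk t
  · rintro k (rfl | hk)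
    · exact Or.inr fun t => le_rfl
    · exact Or.inl hk

end DirectLin

/-! ### Uniqueness for the integral equation and determinant formulas for its solution. -/

namespace DirectLin

open Fredholm

variable {S : Data} {K : Set ℂ} {J : Set ℝ} {T : Set ℂ} {g g' : ℂ → ℝ}

theorem measurable_fst_dom : Measurable fun s : S.D => s.1.1 :=
  measurable_fst.comp measurable_subtype_coe

theorem measurable_snd_dom : Measurable fun s : S.D => s.1.2 :=
  measurable_snd.comp measurable_subtype_coe

/-- `e` solves the integral equation with right-hand side `r` at the points of `T`, in the form
without plane wave factors. -/
structure Sol (S : Data) (g' : ℂ → ℝ) (T : Set ℂ) (N n : ℤ) (x : ℝ) (e r : ℂ → ℂ) : Prop where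
  integrable : ∀ b : ℕ, Integrable (fun t : S.D =>
    ((size t.1.2 ^ b * g' t.1.2 : ℝ) : ℂ) * (dens S N n x t * e t.1.1)) (dom S)
  eqn : ∀ k ∈ T, e k + ∫ t, Om k t.1.2 * (dens S N n x t * e t.1.1) ∂(dom S) = r k

theorem measurable_bordered {γ : ℂ} {α β : S.D → ℂ} (hα : Measurable α) (hβ : Measurable β)
    (m : ℕ) : Measurable fun z : Fin m → S.D => (bordered (cauchy S) γ α β z).det := by
  have h1 := measurable_det_bordered (X := Unit) (κ := fun _ => cauchy S) (γ := fun _ => γ)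
    (α := fun _ => α) (β := fun _ => β) (m := m) (measurable_cauchy.comp measurable_snd)
    measurable_const (hα.comp measurable_snd) (hβ.comp measurable_snd)
  exact h1.comp (measurable_const.prodMk measurable_id : Measurable fun z => ((), z))

theorem Sol.integrable_zero {N n : ℤ} {x : ℝ} {e r : ℂ → ℂ} (h : Sol S g' T N n x e r) :
    Integrable (fun t : S.D => (g' t.1.2 : ℂ) * (dens S N n x t * e t.1.1)) (dom S) := by
  simpa using h.integrable 0

namespace Weights

variable (W : Weights S K J T g g') {N n : ℤ} {x : ℝ}
include W

theorem integrable_row_mul {F : S.D → ℂ}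
    (hF : Integrable (fun t : S.D => (g' t.1.2 : ℂ) * F t) (dom S)) {α : S.D → ℂ}
    (hαm : Measurable α) {A : ℝ} (hα : ∀ t, ‖α t‖ ≤ A * g' t.1.2) :
    Integrable (fun t => α t * F t) (dom S) := by
  have hpos : ∀ t : S.D, 0 < g' t.1.2 := fun t => one_pos.trans_le (W.one_le_right t)
  have hgm : Measurable fun t : S.D => (g' t.1.2 : ℂ) :=
    Complex.measurable_ofReal.comp (W.measurable_right.comp measurable_snd_dom)
  refine Integrable.mono' (hF.norm.const_mul A) ?_ (Filter.Eventually.of_forall fun t => ?_)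
  · refine ((hαm.mul hgm.inv).aestronglyMeasurable.mul hF.aestronglyMeasurable).congr
      (Filter.Eventually.of_forall fun t => ?_)
    have : (g' t.1.2 : ℂ) ≠ 0 := by exact_mod_cast (hpos t).ne'
    simp only [Pi.mul_apply, Pi.inv_apply]
    field_simp
  · rw [norm_mul, norm_mul, Complex.norm_real, Real.norm_of_nonneg (hpos t).le, ← mul_assoc]
    gcongr
    exact hα t

theorem integrable_Om_mul {F : S.D → ℂ}
    (hF : Integrable (fun t : S.D => (g' t.1.2 : ℂ) * F t) (dom S)) {k : ℂ}
    (hk : k ∈ T) : Integrable (fun t => Om k t.1.2 * F t) (dom S) := by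
  obtain ⟨A, -, hA⟩ := W.row k hk
  exact W.integrable_row_mul hF (measurable_Om measurable_const measurable_snd_dom) hA

theorem integrable_of_weighted {F : S.D → ℂ}
    (hF : Integrable (fun t : S.D => (g' t.1.2 : ℂ) * F t) (dom S)) : Integrable F (dom S) := by
  simpa using W.integrable_row_mul hF (α := fun _ => 1) measurable_const (A := 1)
    fun t => by simpa using W.one_le_right t

theorem integrable_inv_mul {F : S.D → ℂ}
    (hF : Integrable (fun t : S.D => (g' t.1.2 : ℂ) * F t) (dom S)) :
    Integrable (fun t : S.D => t.1.2⁻¹ * F t) (dom S) :=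
  W.integrable_row_mul hF (A := 1) measurable_snd_dom.inv fun t => by
    simpa using W.inv_le_right t

theorem sol_lin {e₁ r₁ e₂ r₂ : ℂ → ℂ}
    (h₁ : Sol S g' T N n x e₁ r₁) (h₂ : Sol S g' T N n x e₂ r₂) (a b : ℂ) :
    Sol S g' T N n x (fun k => a * e₁ k + b * e₂ k) (fun k => a * r₁ k + b * r₂ k) where
  integrable := fun i => by
    refine (((h₁.integrable i).const_mul a).add ((h₂.integrable i).const_mul b)).congr
      (Filter.Eventually.of_forall fun t => ?_)
    simp only [Pi.add_apply]; ring
  eqn := fun k hk => by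
    rw [← h₁.eqn k hk, ← h₂.eqn k hk]
    have : ∫ t, Om k t.1.2 * (dens S N n x t * (a * e₁ t.1.1 + b * e₂ t.1.1)) ∂(dom S) =
        a * ∫ t, Om k t.1.2 * (dens S N n x t * e₁ t.1.1) ∂(dom S) +
        b * ∫ t, Om k t.1.2 * (dens S N n x t * e₂ t.1.1) ∂(dom S) := by
      rw [← integral_const_mul, ← integral_const_mul, ← integral_add
        ((W.integrable_Om_mul h₁.integrable_zero hk).const_mul a)
        ((W.integrable_Om_mul h₂.integrable_zero hk).const_mul b)]
      refine integral_congr_ae (Filter.Eventually.of_forall fun t => ?_)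
      simp only; ring
    rw [this]
    ring

/-- For the difference of two solutions the border column in Cramer's rule vanishes, hence so does
`τ` times the integral of the difference against `Ω(k, ·)`. The equation at `k` then gives the claim
on all of `T`, not just on the projection of `D`. -/
theorem sol_unique {e₁ e₂ r : ℂ → ℂ}
    (hreg : Regular S J N n x) (h₁ : Sol S g' T N n x e₁ r) (h₂ : Sol S g' T N n x e₂ r) :
    ∀ k ∈ T, e₁ k = e₂ k := by
  have := W.admissible.sigmaFinite_dom
  intro k hk
  have h := W.sol_lin h₁ h₂ 1 (-1)
  obtain ⟨A, hA0, hA⟩ := W.row k hk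
  have key := (W.dominated N n x hreg.1).fredholmDet_mul_sub_integral (γ := 0) (B := 1) hA0
    (measurable_Om measurable_const measurable_snd_dom) hA (β := fun _ => 0) measurable_const
    one_pos (fun s => by simpa using (zero_le_one.trans (W.one_le_left s))) h.integrable_zero
    (fun s => by
      have := h.eqn s.1.1 (W.subset (W.admissible.fst_mem _ s.2))
      refine this.trans ?_
      ring)
  have hz : fredholmBordered (dom S) (dens S N n x) (cauchy S) 0 (fun t => Om k t.1.2)
      (fun _ => 0) = 0 := by
    have h0 : ∀ (m : ℕ) (z : Fin m → S.D),
        (bordered (cauchy S) 0 (fun t => Om k t.1.2) (fun _ => 0) z).det = 0 := fun m z =>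
      Matrix.det_eq_zero_of_column_eq_zero 0 fun i => by
        refine Fin.cases ?_ (fun i => ?_) i <;> simp
    simp [fredholmBordered, seriesTerm, h0]
  rw [hz, ← W.admissible.tau_eq N n hreg.1] at key
  have h3 := (mul_eq_zero.1 key).resolve_left hreg.2
  have h4 := h.eqn k hk
  linear_combination h4 + h3

section solution

variable {u : ℂ → ℤ → ℂ}

theorem sol_amplitude (hx : x ∈ J) (hu : IsSolution S K N n x u) {i : ℤ}
    (hi : ∀ s : S.D, ‖s.1.1 ^ i‖ ≤ g s.1.1) :
    Sol S g' T N n x (amplitude S N n x u i) (fun k => k ^ i) :=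
  ⟨W.solution N n x hx u hu i hi, fun k _ => hu.amplitude_add W.admissible i k⟩

theorem tau_mul_sub_integral (hx : x ∈ J) (hu : IsSolution S K N n x u) {i : ℤ}
    (hi : ∀ s : S.D, ‖s.1.1 ^ i‖ ≤ g s.1.1) {α : S.D → ℂ} (hαm : Measurable α) {A : ℝ}
    (hA : 0 < A) (hα : ∀ t, ‖α t‖ ≤ A * g' t.1.2) (γ : ℂ) :
    tau S N n x * (γ - ∫ t, α t * (dens S N n x t * amplitude S N n x u i t.1.1) ∂(dom S)) =
      fredholmBordered (dom S) (dens S N n x) (cauchy S) γ α (fun s => s.1.1 ^ i) := by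
  have := W.admissible.sigmaFinite_dom
  rw [W.admissible.tau_eq N n hx]
  exact (W.dominated N n x hx).fredholmDet_mul_sub_integral (B := 1) hA hαm hα
    (measurable_fst_dom.pow_const i) one_pos (fun s => by simpa using hi s)
    (W.sol_amplitude hx hu hi).integrable_zero fun s => hu.amplitude_add W.admissible i s.1.1

theorem norm_zpow_zero_le (s : S.D) : ‖s.1.1 ^ (0 : ℤ)‖ ≤ g s.1.1 := by
  simpa using W.one_le_left s

theorem norm_zpow_one_le (s : S.D) : ‖s.1.1 ^ (1 : ℤ)‖ ≤ g s.1.1 := by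
  simpa using W.norm_le_left s

/-- Cramer's rule with the row `Ω(k, ·)` and the corner `k^i`: the equation at `k` says that the
functional obtained is the amplitude itself. -/
theorem tau_mul_amplitude (hx : x ∈ J) (hu : IsSolution S K N n x u) {i : ℤ}
    (hi : ∀ s : S.D, ‖s.1.1 ^ i‖ ≤ g s.1.1) {k : ℂ} (hk : k ∈ T) :
    tau S N n x * amplitude S N n x u i k =
      fredholmBordered (dom S) (dens S N n x) (cauchy S) (k ^ i) (fun t => Om k t.1.2)
        (fun s => s.1.1 ^ i) := by
  obtain ⟨A, hA0, hA⟩ := W.row k hk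
  rw [← W.tau_mul_sub_integral hx hu hi (measurable_Om measurable_const measurable_snd_dom) hA0 hA]
  have := hu.amplitude_add W.admissible i k
  rw [← this]
  ring

end solution

/-! ### Derivatives in `x₁` -/

theorem tau_hasDerivAt_tsum (hJ : IsOpen J) (hx : x ∈ J) {G : ∀ m, (Fin m → S.D) → ℂ}
    (hG : ∀ m, Measurable (G m)) {C : ℝ}
    (hb : ∀ m z, ‖G m z‖ ≤ (C * hadamard m) * ∏ a, (g (z a).1.1 * g' (z a).1.2)) :
    HasDerivAt (fun y => ∑' m, seriesTerm (dom S) (dens S N n y) (G m))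
      (∑' m, seriesTerm (dom S) (dens S N n x) fun z =>
        (∑ a, ((z a).1.1 + (z a).1.2)) * G m z) x := by
  have := W.admissible.sigmaFinite_dom
  have D := W.dominated N n x hx
  refine hasDerivAt_tsum_seriesTerm (s := fun t : S.D => t.1.1 + t.1.2)
    (measurable_fst_dom.add measurable_snd_dom) hJ (D.measurable_left.mul D.measurable_right)
    (fun t => (mul_pos (D.left_pos t) (D.right_pos t)).le) (fun x y t => dens_exp N n x y t)
    (fun x hx => W.admissible.aestronglyMeasurable_dens N n hx)
    (fun x hx => W.integrable N n x hx) hG (c := fun m => C * hadamard m) (fun A => ?_) hb hx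
  refine ((summable_hadamard A).mul_left C).congr fun m => ?_
  ring

theorem cauchy_identity (s t : S.D) : (s.1.1 + t.1.2) * cauchy S s t = 1 := by
  have := W.add_ne_zero s.1.1 (W.subset (W.admissible.fst_mem _ s.2)) t
  rw [cauchy, Om]
  field_simp

/-- The derivative of the tau function. -/
def _root_.DirectLin.tauDeriv (S : Data) (N n : ℤ) (x : ℝ) : ℂ :=
  ∑' m, seriesTerm (dom S) (dens S N n x) fun z : Fin m → S.D =>
    -(bordered (cauchy S) 0 (fun _ => 1) (fun _ => 1) z).det

theorem hasDerivAt_tau (hJ : IsOpen J) (hx : x ∈ J) :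
    HasDerivAt (tau S N n) (tauDeriv S N n x) x := by
  have D := W.dominated N n x hx
  have h1 := W.tau_hasDerivAt_tsum (N := N) (n := n) hJ hx
    (G := fun m z => (kernelMatrix (cauchy S) z).det) (C := 1)
    (fun m => measurable_det_kernelMatrix D.measurable_kernel) (fun m z => by
      rw [one_mul]
      exact norm_det_kernelMatrix_le D.left_pos D.right_pos D.norm_kernel_le z)
  have h2 : ∀ m, ∀ z : Fin m → S.D, (∑ a, ((z a).1.1 + (z a).1.2)) *
      (kernelMatrix (cauchy S) z).det =
        -(bordered (cauchy S) 0 (fun _ => 1) (fun _ => 1) z).det := fun m z =>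
    sum_add_mul_det_kernelMatrix (cauchy S) (fun s => s.1.1) (fun t => t.1.2)
      W.cauchy_identity z
  simp only [h2] at h1
  refine h1.congr_of_eventuallyEq ?_
  filter_upwards [hJ.mem_nhds hx] with y hy
  exact W.admissible.tau_eq N n hy

/-- A second termwise differentiation gives the continuity needed to integrate `τ'/τ` when a
logarithm is constructed. -/
theorem continuousAt_tauDeriv (hJ : IsOpen J) (hx : x ∈ J) :
    ContinuousAt (tauDeriv S N n) x := by
  have D := W.dominated N n x hx
  refine (W.tau_hasDerivAt_tsum hJ hx (G := fun m z =>
    -(bordered (cauchy S) 0 (fun _ => 1) (fun _ => 1) z).det) (C := 1 * 1)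
    (fun m => (measurable_bordered measurable_const measurable_const m).neg)
    fun m z => ?_).continuousAt
  rw [norm_neg]
  refine norm_det_bordered_le D.left_pos D.right_pos D.norm_kernel_le one_pos one_pos (by simp)
    (fun t => ?_) (fun s => ?_) z
  · simpa using W.one_le_right t
  · simpa using W.one_le_left s

/-- Cramer's rule with corner `0` and constant row `1`. This is why `ln τ` is an antiderivative of
the potential. -/
theorem tauDeriv_eq {u : ℤ → ℤ → ℝ → ℂ → ℤ → ℂ} (hx : x ∈ J)
    (hu : IsSolution S K N n x (u N n x)) :
    tauDeriv S N n x = tau S N n x * potential S u 0 0 N n x := by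
  have h1 := W.tau_mul_sub_integral hx hu W.norm_zpow_zero_le (α := fun _ => 1) measurable_const
    one_pos (fun t => by simpa using W.one_le_right t) 0
  have h2 : tauDeriv S N n x = -fredholmBordered (dom S) (dens S N n x) (cauchy S) 0
      (fun _ => 1) (fun s => s.1.1 ^ (0 : ℤ)) := by
    simp [tauDeriv, fredholmBordered, seriesTerm, integral_neg, tsum_neg]
  have h3 : potential S u 0 0 N n x =
      ∫ t, 1 * (dens S N n x t * amplitude S N n x (u N n x) 0 t.1.1) ∂(dom S) := by
    rw [potential, W.admissible.integral_dom]
    refine integral_congr_ae (Filter.Eventually.of_forall fun t => ?_)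
    simp only [hu.dens_mul_amplitude W.admissible, zpow_zero]
    ring
  rw [h2, h3, ← h1]
  ring

theorem eventually_regular (hJ : IsOpen J) (hreg : Regular S J N n x) :
    ∀ᶠ y in nhds x, Regular S J N n y :=
  (hJ.eventually_mem hreg.1).and
    ((W.hasDerivAt_tau hJ hreg.1).continuousAt.eventually_ne hreg.2)

/-- The amplitude is a bordered determinant over `τ`. By the Cauchy identity the derivative of the
numerator is the bordered determinant with column `k` minus `k` times the original one, that is, the
numerators of the amplitudes of index `1` and `0`; the potential enters through `τ'` in the quotient
rule. -/
theorem hasDerivAt_amplitude (hJ : IsOpen J) {u : ℤ → ℤ → ℝ → ℂ → ℤ → ℂ}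
    (hu : ∀ y, Regular S J N n y → IsSolution S K N n y (u N n y))
    (hreg : Regular S J N n x) {k : ℂ} (hk : k ∈ T) :
    HasDerivAt (fun y => amplitude S N n y (u N n y) 0 k)
      (amplitude S N n x (u N n x) 1 k -
        (k + potential S u 0 0 N n x) * amplitude S N n x (u N n x) 0 k) x := by
  have := W.admissible.sigmaFinite_dom
  obtain ⟨A, hA0, hA⟩ := W.row k hk
  have hx := hreg.1
  have D := W.dominated N n x hx
  have hαm : Measurable fun t : S.D => Om k t.1.2 :=
    measurable_Om measurable_const measurable_snd_dom
  set α : S.D → ℂ := fun t => Om k t.1.2 with hαdef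
  have hα : ∀ t, (k + t.1.2) * α t = 1 := fun t => by
    have := W.add_ne_zero k hk t
    simp only [hαdef, Om]
    field_simp
  -- One constant has to bound the row as well as both corners, `1` and `k`.
  set A' := max A (max 1 ‖k‖) with hA'
  have hA1 : ∀ t, ‖α t‖ ≤ A' * g' t.1.2 := fun t => by
    have := W.one_le_right t
    exact (hA t).trans (mul_le_mul_of_nonneg_right (le_max_left _ _) (by linarith))
  have hA'0 : 0 < A' := hA0.trans_le (le_max_left _ _)
  have h1A : (1 : ℝ) ≤ A' := (le_max_left _ _).trans (le_max_right _ _)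
  have hkA : ‖k‖ ≤ A' := (le_max_right _ _).trans (le_max_right _ _)
  have hb0 : ∀ (m : ℕ) (z : Fin m → S.D), ‖(bordered (cauchy S) 1 α (fun _ => 1) z).det‖ ≤
      (A' * 1 * hadamard m) * ∏ a, (g (z a).1.1 * g' (z a).1.2) := fun m z =>
    norm_det_bordered_le D.left_pos D.right_pos D.norm_kernel_le hA'0 one_pos (by simpa using h1A)
      hA1 (fun s => by simpa using W.one_le_left s) z
  have hb1 : ∀ (m : ℕ) (z : Fin m → S.D),
      ‖(bordered (cauchy S) k α (fun s => s.1.1) z).det‖ ≤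
      (A' * 1 * hadamard m) * ∏ a, (g (z a).1.1 * g' (z a).1.2) := fun m z =>
    norm_det_bordered_le D.left_pos D.right_pos D.norm_kernel_le hA'0 one_pos (by simpa using hkA)
      hA1 (fun s => by simpa using W.norm_le_left s) z
  have hder := W.tau_hasDerivAt_tsum (N := N) (n := n) hJ hx
    (G := fun m z => (bordered (cauchy S) 1 α (fun _ => 1) z).det) (C := A' * 1)
    (fun m => measurable_bordered hαm measurable_const m) hb0
  have hval : (∑' m, seriesTerm (dom S) (dens S N n x) fun z : Fin m → S.D =>
      (∑ a, ((z a).1.1 + (z a).1.2)) * (bordered (cauchy S) 1 α (fun _ => 1) z).det) =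
      fredholmBordered (dom S) (dens S N n x) (cauchy S) k α (fun s => s.1.1) -
        k * fredholmBordered (dom S) (dens S N n x) (cauchy S) 1 α (fun _ => 1) := by
    have hs0 := D.summable_bordered (γ := 1) (α := α) (β := fun _ => 1) hA'0 one_pos
      (by simpa using h1A) hA1 (fun s => by simpa using W.one_le_left s)
    have hs1 := D.summable_bordered (γ := k) (α := α) (β := fun s => s.1.1) hA'0 one_pos
      (by simpa using hkA) hA1 (fun s => by simpa using W.norm_le_left s)
    rw [fredholmBordered, fredholmBordered, ← tsum_mul_left, ← hs1.tsum_sub (hs0.mul_left k)]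
    refine tsum_congr fun m => ?_
    have hi0 := integrable_mul_prod D.aestronglyMeasurable D.integrable
      (measurable_bordered hαm measurable_const m).aestronglyMeasurable (hb0 m)
    have hi1 := integrable_mul_prod D.aestronglyMeasurable D.integrable
      (measurable_bordered hαm measurable_fst_dom m).aestronglyMeasurable (hb1 m)
    simp only [seriesTerm]
    rw [mul_left_comm, ← mul_sub, ← integral_const_mul k, ← integral_sub hi1 (hi0.const_mul k)]
    congr 1
    refine integral_congr_ae (Filter.Eventually.of_forall fun z => ?_)
    simp only
    rw [sum_add_mul_det_bordered (cauchy S) (fun s => s.1.1) (fun t => t.1.2) W.cauchy_identity k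
      α hα z]
    ring
  have hF : ∀ y, Regular S J N n y → tau S N n y * amplitude S N n y (u N n y) 0 k =
      fredholmBordered (dom S) (dens S N n y) (cauchy S) 1 α (fun _ => 1) := fun y hy => by
    simpa using W.tau_mul_amplitude hy.1 (hu y hy) W.norm_zpow_zero_le hk
  have hF1 : tau S N n x * amplitude S N n x (u N n x) 1 k =
      fredholmBordered (dom S) (dens S N n x) (cauchy S) k α (fun s => s.1.1) := by
    simpa using W.tau_mul_amplitude hx (hu x hreg) W.norm_zpow_one_le hk
  rw [hval, ← hF1, ← hF x hreg] at hder
  have hτ := W.hasDerivAt_tau (N := N) (n := n) hJ hx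
  rw [W.tauDeriv_eq hx (hu x hreg)] at hτ
  have hquot := hder.div hτ hreg.2
  have heq : (∑' m, seriesTerm (dom S) (dens S N n x) fun z : Fin m → S.D =>
      (bordered (cauchy S) 1 α (fun _ => 1) z).det) =
        tau S N n x * amplitude S N n x (u N n x) 0 k := (hF x hreg).symm
  rw [heq] at hquot
  refine (hquot.congr_deriv ?_).congr_of_eventuallyEq ?_
  · have := hreg.2
    field_simp
    ring
  · filter_upwards [W.eventually_regular hJ hreg] with y hy
    have := hy.2
    rw [Pi.div_apply, eq_div_iff hy.2, mul_comm, hF y hy]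
    rfl

/-! ### The step in `n` -/

/-- The new factors `-k/k'` of the density are absorbed into the determinant, where `-(k/k') Ω = Ω -
1/k'`. This rank-one change is a border with row `1/k'`, to which Cramer's rule applies. -/
theorem tau_add_one (hx : x ∈ J) {u : ℂ → ℤ → ℂ} (hu : IsSolution S K N n x u) :
    tau S N (n + 1) x = tau S N n x *
      (1 - ∫ t, t.1.2⁻¹ * (dens S N n x t * amplitude S N n x u 0 t.1.1) ∂(dom S)) := by
  rw [W.tau_mul_sub_integral hx hu W.norm_zpow_zero_le (α := fun t => t.1.2⁻¹)
    measurable_snd_dom.inv one_pos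
    (fun t => by simpa using W.inv_le_right t), W.admissible.tau_eq _ _ hx, fredholmDet,
    fredholmBordered]
  refine tsum_congr fun m => ?_
  rw [seriesTerm, seriesTerm]
  congr 1
  refine integral_congr_ae (Filter.Eventually.of_forall fun z => ?_)
  simp only [zpow_zero]
  rw [det_kernelMatrix_sub_one_mul]
  have h1 : kernelMatrix (fun s t : S.D => cauchy S s t - t.1.2⁻¹) z = Matrix.of fun a b =>
      (-(z a).1.1) * (Matrix.of fun a b => ((z b).1.2)⁻¹ * kernelMatrix (cauchy S) z a b) a b := by
    ext a b
    have h2 := (W.admissible.nonSing_snd (z b)).1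
    have h3 := W.cauchy_identity (z a) (z b)
    simp only [kernelMatrix, Matrix.of_apply]
    field_simp
    linear_combination h3
  rw [h1, Matrix.det_mul_column, Matrix.det_mul_row]
  simp only [W.admissible.dens_add_one, Finset.prod_mul_distrib, neg_div', Finset.prod_div_distrib,
    Finset.prod_inv_distrib]
  ring

end Weights

end DirectLin

namespace DirectLin

variable {S : Data} {K : Set ℂ} {J : Set ℝ} {T : Set ℂ} {g g₀ g' : ℂ → ℝ}

/-! ### Transformations of the integral equation -/

theorem integrable_bdd_mul {X : Type*} [MeasurableSpace X] {ν : Measure X} {F G a : X → ℂ}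
    (hF : Integrable F ν) (ha : Measurable a) {C : ℝ} (hC : ∀ t, ‖a t‖ ≤ C)
    (hG : ∀ t, G t = a t * F t) : Integrable G ν := by
  refine Integrable.mono' (hF.norm.const_mul C) ?_ (Filter.Eventually.of_forall fun t => ?_)
  · exact (ha.aestronglyMeasurable.mul hF.aestronglyMeasurable).congr
      (Filter.Eventually.of_forall fun t => (hG t).symm)
  · rw [hG, norm_mul]
    gcongr
    exact hC t

theorem Sol.congr_right {N n : ℤ} {x : ℝ} {e r r' : ℂ → ℂ} (h : Sol S g' T N n x e r)
    (hr : ∀ k ∈ T, r k = r' k) : Sol S g' T N n x e r' :=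
  ⟨h.integrable, fun k hk => (h.eqn k hk).trans (hr k hk)⟩

theorem dens_mul_fst {N n : ℤ} {x : ℝ} (H : Admissible S K J) (e : ℂ → ℂ) (t : S.D) :
    dens S N n x t * (t.1.1 * e t.1.1) = -t.1.2 * (dens S N (n + 1) x t * e t.1.1) := by
  have := (H.nonSing_snd t).1
  rw [H.dens_add_one]
  field_simp

theorem dens_mul_ratio {N n : ℤ} {x : ℝ} (H : Admissible S K J) (e : ℂ → ℂ) (t : S.D) :
    dens S N n x t * (ratio S t.1.1 * e t.1.1) =
      (S.p 0 - t.1.2) * Om (S.p 0) t.1.2 * (dens S (N + 1) n x t * e t.1.1) := by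
  have h1 := (H.nonSing_snd t).add_ne_zero
  have h2 := (H.nonSing_snd t).sub_ne_zero
  rw [H.dens_shift, Om]
  have : ratio S t.1.2 = (S.p 0 + t.1.2) / (S.p 0 - t.1.2) := rfl
  rw [this]
  field_simp

namespace Weights

variable {N n : ℤ} {x : ℝ}

/-- The step in `n` turns the integrated factor `l` into `-l'`, and `-l'/(k+l') = k/(k+l') - 1`. One
power of `size` is spent on it, which is why `Sol` asks for integrability with every power. -/
theorem sol_mul_self (W : Weights S K J T g g') {e r : ℂ → ℂ}
    (h : Sol S g' T N (n + 1) x e r) :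
    Sol S g' T N n x (fun k => k * e k)
      (fun k => k * r k - ∫ t, dens S N (n + 1) x t * e t.1.1 ∂(dom S)) where
  integrable := fun b => by
    have hs : ∀ t : S.D, (size t.1.2 : ℂ) ≠ 0 := fun t => by
      have := one_le_size (W.admissible.nonSing_snd t).1
      exact_mod_cast (by linarith : (0 : ℝ) < size t.1.2).ne'
    refine integrable_bdd_mul (h.integrable (b + 1)) (a := fun t => -t.1.2 / (size t.1.2 : ℂ))
      (measurable_snd_dom.neg.div (Complex.measurable_ofReal.comp
        (measurable_size.comp measurable_snd_dom))) (C := 1) (fun t => ?_) fun t => ?_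
    · have h1 := one_le_size (W.admissible.nonSing_snd t).1
      rw [norm_div, norm_neg, Complex.norm_real, Real.norm_of_nonneg (by linarith)]
      exact (div_le_one (by linarith)).2 (norm_le_size _)
    · rw [dens_mul_fst W.admissible]
      have := hs t
      push_cast
      field_simp
      ring
  eqn := fun k hk => by
    have h1 : ∫ t, Om k t.1.2 * (dens S N n x t * (t.1.1 * e t.1.1)) ∂(dom S) =
        k * ∫ t, Om k t.1.2 * (dens S N (n + 1) x t * e t.1.1) ∂(dom S) -
          ∫ t, dens S N (n + 1) x t * e t.1.1 ∂(dom S) := by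
      rw [← integral_const_mul, ← integral_sub
        ((W.integrable_Om_mul h.integrable_zero hk).const_mul k)
        (W.integrable_of_weighted h.integrable_zero)]
      refine integral_congr_ae (Filter.Eventually.of_forall fun t => ?_)
      have := W.add_ne_zero k hk t
      simp only
      rw [dens_mul_fst W.admissible, Om]
      field_simp
      ring
    rw [h1, ← h.eqn k hk]
    ring

/-- Partial fractions in `l'`: `(p₁-l')/((p₁+l')(k+l'))` equals `((p₁+k)/(p₁-k))/(k+l') -
(2p₁/(p₁-k))/(p₁+l')`. The integral with the last pole is `r(p₁) - e(p₁)`, by the equation at `k =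
p₁`. -/
theorem sol_ratio_mul (W : Weights S K J (insert (S.p 0) K) g g')
    (hb : ∃ b : ℕ, ∀ k, g₀ k = size k ^ b) {e r : ℂ → ℂ}
    (h : Sol S g' (insert (S.p 0) K) (N + 1) n x e r) :
    Sol S g₀ K N n x (fun k => ratio S k * e k)
      (fun k => ratio S k * r k - 2 * S.p 0 / (S.p 0 - k) * (r (S.p 0) - e (S.p 0))) where
  integrable := fun b => by
    obtain ⟨b₀, hb₀⟩ := hb
    obtain ⟨A, hA0, hA⟩ := W.row (S.p 0) (Set.mem_insert _ _)
    have hs : ∀ t : S.D, 1 ≤ size t.1.2 := fun t => one_le_size (W.admissible.nonSing_snd t).1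
    have hg : ∀ t : S.D, 1 ≤ g' t.1.2 := W.one_le_right
    refine integrable_bdd_mul (h.integrable (b + b₀ + 1))
      (a := fun t => (S.p 0 - t.1.2) * Om (S.p 0) t.1.2 / ((size t.1.2 * g' t.1.2 : ℝ) : ℂ))
      (((measurable_const.sub measurable_snd_dom).mul
        (measurable_Om measurable_const measurable_snd_dom)).div (Complex.measurable_ofReal.comp
        ((measurable_size.comp measurable_snd_dom).mul
          (W.measurable_right.comp measurable_snd_dom))))
      (C := (‖S.p 0‖ + 1) * A) (fun t => ?_) fun t => ?_
    · have h1 := hs t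
      have h2 := hg t
      rw [norm_div, norm_mul, Complex.norm_real, Real.norm_of_nonneg (by positivity),
        div_le_iff₀ (by positivity)]
      have h3 : ‖S.p 0 - t.1.2‖ ≤ (‖S.p 0‖ + 1) * size t.1.2 := by
        refine (norm_sub_le _ _).trans ?_
        have := norm_le_size t.1.2
        have := norm_nonneg (S.p 0)
        nlinarith
      calc _ ≤ ((‖S.p 0‖ + 1) * size t.1.2) * (A * g' t.1.2) := by
            gcongr
            exact hA t
        _ = _ := by ring
    · rw [dens_mul_ratio W.admissible, hb₀]
      have h1 : (size t.1.2 : ℂ) ≠ 0 := by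
        exact_mod_cast (by linarith [hs t] : (0 : ℝ) < size t.1.2).ne'
      have h2 : (g' t.1.2 : ℂ) ≠ 0 := by
        exact_mod_cast (by linarith [hg t] : (0 : ℝ) < g' t.1.2).ne'
      push_cast
      field_simp
      ring
  eqn := fun k hk => by
    have hkT := Set.mem_insert_of_mem (S.p 0) hk
    have hp := Set.mem_insert (S.p 0) K
    have hkn := (W.admissible.nonSing_left k hk).sub_ne_zero
    have h1 : ∫ t, Om k t.1.2 * (dens S N n x t * (ratio S t.1.1 * e t.1.1)) ∂(dom S) =
        ratio S k * ∫ t, Om k t.1.2 * (dens S (N + 1) n x t * e t.1.1) ∂(dom S) -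
        2 * S.p 0 / (S.p 0 - k) *
          ∫ t, Om (S.p 0) t.1.2 * (dens S (N + 1) n x t * e t.1.1) ∂(dom S) := by
      rw [← integral_const_mul, ← integral_const_mul, ← integral_sub
        ((W.integrable_Om_mul h.integrable_zero hkT).const_mul _)
        ((W.integrable_Om_mul h.integrable_zero hp).const_mul _)]
      refine integral_congr_ae (Filter.Eventually.of_forall fun t => ?_)
      have h2 := W.add_ne_zero k hkT t
      have h3 := W.add_ne_zero _ hp t
      simp only
      rw [dens_mul_ratio W.admissible, Om, Om, ratio]
      field_simp
      ring
    rw [h1, ← h.eqn k hkT, ← h.eqn _ hp]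
    ring

theorem integral_inv_mul_self (W : Weights S K J T g g') {e : ℂ → ℂ} :
    ∫ t, t.1.2⁻¹ * (dens S N n x t * (t.1.1 * e t.1.1)) ∂(dom S) =
      -∫ t, dens S N (n + 1) x t * e t.1.1 ∂(dom S) := by
  rw [← integral_neg]
  refine integral_congr_ae (Filter.Eventually.of_forall fun t => ?_)
  have := (W.admissible.nonSing_snd t).1
  simp only
  rw [dens_mul_fst W.admissible]
  field_simp

/-- Since `(p₁-k')/(p₁+k') = 2p₁/(p₁+k') - 1`, the equation at `k = p₁` evaluates the part with the
pole. -/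
theorem integral_ratio_mul (W : Weights S K J (insert (S.p 0) K) g g') {e r : ℂ → ℂ}
    (h : Sol S g' (insert (S.p 0) K) (N + 1) n x e r) :
    ∫ t, dens S N n x t * (ratio S t.1.1 * e t.1.1) ∂(dom S) =
      2 * S.p 0 * (r (S.p 0) - e (S.p 0)) -
        ∫ t, dens S (N + 1) n x t * e t.1.1 ∂(dom S) := by
  have hp := Set.mem_insert (S.p 0) K
  rw [← h.eqn _ hp, add_sub_cancel_left, ← integral_const_mul, ← integral_sub
    ((W.integrable_Om_mul h.integrable_zero hp).const_mul _)
    (W.integrable_of_weighted h.integrable_zero)]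
  refine integral_congr_ae (Filter.Eventually.of_forall fun t => ?_)
  have h3 := W.add_ne_zero _ hp t
  simp only
  rw [dens_mul_ratio W.admissible, Om]
  field_simp
  ring

theorem integral_inv_ratio_mul (W : Weights S K J (insert (S.p 0) K) g g') {e r : ℂ → ℂ}
    (h : Sol S g' (insert (S.p 0) K) (N + 1) n x e r) :
    ∫ t, t.1.2⁻¹ * (dens S N n x t * (ratio S t.1.1 * e t.1.1)) ∂(dom S) =
      (∫ t, t.1.2⁻¹ * (dens S (N + 1) n x t * e t.1.1) ∂(dom S)) -
        2 * (r (S.p 0) - e (S.p 0)) := by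
  have hp := Set.mem_insert (S.p 0) K
  rw [← h.eqn _ hp, add_sub_cancel_left, ← integral_const_mul, ← integral_sub
    (W.integrable_inv_mul h.integrable_zero)
    ((W.integrable_Om_mul h.integrable_zero hp).const_mul _)]
  refine integral_congr_ae (Filter.Eventually.of_forall fun t => ?_)
  have h3 := W.add_ne_zero _ hp t
  have h4 := (W.admissible.nonSing_snd t).1
  simp only
  rw [dens_mul_ratio W.admissible, Om]
  field_simp
  ring

end Weights

/-! ### The Lax pair -/

theorem potential_zero_eq (H : Admissible S K J) {u : ℤ → ℤ → ℝ → ℂ → ℤ → ℂ} {N n : ℤ} {x : ℝ}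
    (hu : IsSolution S K N n x (u N n x)) : potential S u 0 0 N n x =
      ∫ t, dens S N n x t * amplitude S N n x (u N n x) 0 t.1.1 ∂(dom S) := by
  rw [potential, H.integral_dom]
  refine integral_congr_ae (Filter.Eventually.of_forall fun t => ?_)
  simp only [hu.dens_mul_amplitude H, zpow_zero]
  ring

/-- The amplitude at the spectral point `p₁`, one step in `n₁` ahead. -/
def atLattice (S : Data) (u : ℤ → ℤ → ℝ → ℂ → ℤ → ℂ) (N n : ℤ) (x : ℝ) : ℂ :=
  amplitude S (N + 1) n x (u (N + 1) n x) 0 (S.p 0)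

section lax

variable {u : ℤ → ℤ → ℝ → ℂ → ℤ → ℂ} {N n : ℤ} {x : ℝ}

namespace Weights

theorem sol_amplitude_zero (W : Weights S K J T g g') (hx : x ∈ J)
    (hu : IsSolution S K N n x (u N n x)) :
    Sol S g' T N n x (amplitude S N n x (u N n x) 0) fun _ => 1 :=
  (W.sol_amplitude hx hu W.norm_zpow_zero_le).congr_right fun k _ => zpow_zero k

theorem sol_amplitude_one (W : Weights S K J T g g') (hx : x ∈ J)
    (hu : IsSolution S K N n x (u N n x)) :
    Sol S g' T N n x (amplitude S N n x (u N n x) 1) fun k => k :=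
  (W.sol_amplitude hx hu W.norm_zpow_one_le).congr_right fun k _ => zpow_one k

theorem sol_mul_amplitude (W : Weights S K J T g g') (hx : x ∈ J)
    (hu : IsSolution S K N (n + 1) x (u N (n + 1) x)) :
    Sol S g' T N n x (fun k => k * amplitude S N (n + 1) x (u N (n + 1) x) 0 k)
      fun k => k - potential S u 0 0 N (n + 1) x := by
  rw [potential_zero_eq W.admissible hu]
  simpa using W.sol_mul_self (W.sol_amplitude_zero hx hu)

theorem sol_ratio_mul_amplitude
    (W : Weights S K J (insert (S.p 0) K) g g') (hb : ∃ b : ℕ, ∀ k, g₀ k = size k ^ b)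
    (hx : x ∈ J) (hu : IsSolution S K (N + 1) n x (u (N + 1) n x)) :
    Sol S g₀ K N n x (fun k => ratio S k * amplitude S (N + 1) n x (u (N + 1) n x) 0 k)
      fun k => -1 + 2 * S.p 0 * atLattice S u N n x / (S.p 0 - k) := by
  refine (W.sol_ratio_mul hb (W.sol_amplitude_zero hx hu)).congr_right fun k hk => ?_
  have := (W.admissible.nonSing_left k hk).sub_ne_zero
  rw [ratio, atLattice]
  field_simp
  ring

theorem sol_mul_ratio_mul_amplitude (W₀ : Weights S K J K g g₀)
    (W : Weights S K J (insert (S.p 0) K) g g') (hb : ∃ b : ℕ, ∀ k, g₀ k = size k ^ b)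
    (hx : x ∈ J) (hu : IsSolution S K (N + 1) (n + 1) x (u (N + 1) (n + 1) x)) :
    Sol S g₀ K N n x
      (fun k => k * (ratio S k * amplitude S (N + 1) (n + 1) x (u (N + 1) (n + 1) x) 0 k))
      fun k => k * (-1 + 2 * S.p 0 * atLattice S u N (n + 1) x / (S.p 0 - k)) -
        (2 * S.p 0 * (1 - atLattice S u N (n + 1) x) -
          potential S u 0 0 (N + 1) (n + 1) x) := by
  rw [potential_zero_eq W.admissible hu, atLattice,
    ← W.integral_ratio_mul (W.sol_amplitude_zero hx hu)]
  exact W₀.sol_mul_self (W.sol_ratio_mul_amplitude hb hx hu)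

/-- The relation between the amplitudes at consecutive `n`. -/
theorem mul_amplitude (W : Weights S K J T g g') (hreg : Regular S J N n x)
    (hu : IsSolution S K N n x (u N n x))
    (hu' : IsSolution S K N (n + 1) x (u N (n + 1) x)) {k : ℂ} (hk : k ∈ T) :
    k * amplitude S N (n + 1) x (u N (n + 1) x) 0 k = amplitude S N n x (u N n x) 1 k -
      potential S u 0 0 N (n + 1) x * amplitude S N n x (u N n x) 0 k := by
  have h := W.sol_unique hreg (W.sol_mul_amplitude hreg.1 hu')
    ((W.sol_lin (W.sol_amplitude_one hreg.1 hu) (W.sol_amplitude_zero hreg.1 hu) 1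
      (-potential S u 0 0 N (n + 1) x)).congr_right fun k _ => by ring) k hk
  rw [h]
  ring

variable (W₀ : Weights S K J K g g₀) (W : Weights S K J (insert (S.p 0) K) g g')
  (hb : ∃ b : ℕ, ∀ k, g₀ k = size k ^ b)
  (hu : ∀ N n x, Regular S J N n x → IsSolution S K N n x (u N n x))
include W₀ W hb hu

/-- The linear relation behind the discrete Lax equation. -/
theorem four_term (h00 : Regular S J N n x) (h01 : Regular S J N (n + 1) x)
    (h10 : Regular S J (N + 1) n x) (h11 : Regular S J (N + 1) (n + 1) x) {A c : ℂ}
    (hA : A * atLattice S u N n x = c * (S.p 0 * atLattice S u N (n + 1) x)) {k : ℂ}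
    (hk : k ∈ K) :
    c * (k * (ratio S k * amplitude S (N + 1) (n + 1) x (u (N + 1) (n + 1) x) 0 k)) +
        c * (k * amplitude S N (n + 1) x (u N (n + 1) x) 0 k) =
      A * (ratio S k * amplitude S (N + 1) n x (u (N + 1) n x) 0 k) +
        (A - c * SemiDiscreteKP.amp (S.p 0) (potential S u 0 0) N (n + 1) x) *
          amplitude S N n x (u N n x) 0 k := by
  have hx := h00.1
  -- Equal coefficients `c` cancel the term linear in `k`, the hypothesis `hA` matches the poles at
  -- `k = p₁`, and the coefficient of the amplitude at `(N, n)` adjusts the constants.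
  refine W₀.sol_unique h00 (W₀.sol_lin
    (W₀.sol_mul_ratio_mul_amplitude W hb hx (hu _ _ _ h11))
    (W₀.sol_mul_amplitude hx (hu _ _ _ h01)) c c) ((W₀.sol_lin
    (W.sol_ratio_mul_amplitude hb hx (hu _ _ _ h10))
    (W₀.sol_amplitude_zero hx (hu _ _ _ h00)) A _).congr_right fun k hk => ?_) k hk
  have := (W.admissible.nonSing_left k hk).sub_ne_zero
  rw [SemiDiscreteKP.amp]
  field_simp
  linear_combination (2 * S.p 0) * hA

/-- The four-term relation, integrated against `1/k'` with coefficients chosen so that nothing is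
divided. The integrals that are not potentials are quotients `τ_{n+1}/τ_n` at `N` and `N + 1`, by
`tau_add_one`. -/
theorem atLattice_mul_amp (h00 : Regular S J N n x) (h01 : Regular S J N (n + 1) x)
    (h10 : Regular S J (N + 1) n x) (h11 : Regular S J (N + 1) (n + 1) x) :
    atLattice S u N n x * SemiDiscreteKP.amp (S.p 0) (potential S u 0 0) N (n + 1) x *
        (tau S (N + 1) n x * tau S N (n + 1) x) =
      S.p 0 * atLattice S u N (n + 1) x *
        (tau S N (n + 1) x * tau S (N + 1) n x + tau S (N + 1) (n + 1) x * tau S N n x) := by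
  have hx := h00.1
  set B := atLattice S u N n x with hB
  set B' := atLattice S u N (n + 1) x with hB'
  set V := SemiDiscreteKP.amp (S.p 0) (potential S u 0 0) N (n + 1) x with hV
  have s00 := W₀.sol_amplitude_zero hx (hu _ _ _ h00)
  have s01 := W₀.sol_mul_amplitude hx (hu _ _ _ h01)
  have s10 := W.sol_ratio_mul_amplitude hb hx (hu _ _ _ h10)
  have s11 := W₀.sol_mul_ratio_mul_amplitude W hb hx (hu _ _ _ h11)
  have i00 := W₀.integrable_inv_mul s00.integrable_zero
  have i01 := W₀.integrable_inv_mul s01.integrable_zero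
  have i10 := W₀.integrable_inv_mul s10.integrable_zero
  have i11 := W₀.integrable_inv_mul s11.integrable_zero
  have v00 := W.tau_add_one hx (hu _ _ _ h00)
  have v01 := W.integral_inv_mul_self (N := N) (n := n) (x := x)
    (e := amplitude S N (n + 1) x (u N (n + 1) x) 0)
  rw [← potential_zero_eq W.admissible (hu _ _ _ h01)] at v01
  have v10 := W.integral_inv_ratio_mul (W.sol_amplitude_zero hx (hu _ _ _ h10))
  have w10 := W.tau_add_one hx (hu _ _ _ h10)
  have v11 := W.integral_inv_mul_self (N := N) (n := n) (x := x)
    (e := fun k => ratio S k * amplitude S (N + 1) (n + 1) x (u (N + 1) (n + 1) x) 0 k)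
  rw [W.integral_ratio_mul (W.sol_amplitude_zero hx (hu _ _ _ h11)),
    ← potential_zero_eq W.admissible (hu _ _ _ h11)] at v11
  have key : B * (∫ t, t.1.2⁻¹ * (dens S N n x t * (t.1.1 * (ratio S t.1.1 *
        amplitude S (N + 1) (n + 1) x (u (N + 1) (n + 1) x) 0 t.1.1))) ∂(dom S)) +
      B * (∫ t, t.1.2⁻¹ * (dens S N n x t * (t.1.1 *
        amplitude S N (n + 1) x (u N (n + 1) x) 0 t.1.1)) ∂(dom S)) =
      (S.p 0 * B') * (∫ t, t.1.2⁻¹ * (dens S N n x t * (ratio S t.1.1 *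
        amplitude S (N + 1) n x (u (N + 1) n x) 0 t.1.1)) ∂(dom S)) +
      (S.p 0 * B' - B * V) * (∫ t, t.1.2⁻¹ * (dens S N n x t *
        amplitude S N n x (u N n x) 0 t.1.1) ∂(dom S)) := by
    rw [← integral_const_mul, ← integral_const_mul, ← integral_const_mul, ← integral_const_mul,
      ← integral_add (i11.const_mul _) (i01.const_mul _),
      ← integral_add (i10.const_mul _) (i00.const_mul _)]
    refine integral_congr_ae (Filter.Eventually.of_forall fun t => ?_)
    have h4 := W₀.four_term W hb hu h00 h01 h10 h11 (A := S.p 0 * B') (c := B) (mul_comm _ _)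
      (W.admissible.fst_mem _ t.2)
    simp only
    linear_combination (t.1.2⁻¹ * dens S N n x t) * h4
  rw [v11, v01, v10] at key
  have hB1 : amplitude S (N + 1) n x (u (N + 1) n x) 0 (S.p 0) = B := rfl
  have hB2 : amplitude S (N + 1) (n + 1) x (u (N + 1) (n + 1) x) 0 (S.p 0) = B' := rfl
  rw [hB1, hB2] at key
  have hV' : V = 2 * S.p 0 + potential S u 0 0 N (n + 1) x -
    potential S u 0 0 (N + 1) (n + 1) x := rfl
  rw [v00, w10]
  generalize (∫ t, t.1.2⁻¹ * (dens S N n x t * amplitude S N n x (u N n x) 0 t.1.1) ∂(dom S)) = q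
    at *
  generalize (∫ t, t.1.2⁻¹ * (dens S (N + 1) n x t *
    amplitude S (N + 1) n x (u (N + 1) n x) 0 t.1.1) ∂(dom S)) = q' at *
  linear_combination (-(tau S (N + 1) n x * tau S N n x)) * key +
    (tau S (N + 1) n x * tau S N n x) * B * hV'

/-- If the amplitude at `p₁` vanishes, the solution carried over from `N + 1` has right-hand side
`-1`, so it is minus the solution at `N`; comparing integrals gives `2p₁ + u - ũ = 0`. Division by
the amplitude is therefore safe where the equation is claimed. -/
theorem amp_eq_zero_of_atLattice (h00 : Regular S J N n x) (h10 : Regular S J (N + 1) n x)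
    (h0 : atLattice S u N n x = 0) :
    SemiDiscreteKP.amp (S.p 0) (potential S u 0 0) N n x = 0 := by
  have hx := h00.1
  have s00 := W₀.sol_amplitude_zero hx (hu _ _ _ h00)
  have s10 := W.sol_ratio_mul_amplitude hb hx (hu _ _ _ h10)
  have heq := W₀.sol_unique h00 s10 ((W₀.sol_lin s00 s00 (-1) 0).congr_right fun k _ => by
    rw [h0]; ring)
  have v10 := W.integral_ratio_mul (W.sol_amplitude_zero hx (hu _ _ _ h10))
  have hB1 : amplitude S (N + 1) n x (u (N + 1) n x) 0 (S.p 0) = 0 := h0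
  rw [hB1, ← potential_zero_eq W.admissible (hu _ _ _ h10)] at v10
  have hI : ∫ t, dens S N n x t * (ratio S t.1.1 *
      amplitude S (N + 1) n x (u (N + 1) n x) 0 t.1.1) ∂(dom S) =
        -potential S u 0 0 N n x := by
    rw [potential_zero_eq W.admissible (hu _ _ _ h00), ← integral_neg]
    refine integral_congr_ae (Filter.Eventually.of_forall fun t => ?_)
    simp only
    rw [heq _ (W.admissible.fst_mem _ t.2)]
    ring
  rw [hI] at v10
  rw [SemiDiscreteKP.amp]
  linear_combination -v10

end Weights

end lax

end DirectLin

namespace SemiDiscreteKP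

/-! ### Compatibility of the Lax pair -/

variable {p : ℂ} {v θ φ : ℤ → ℤ → ℝ → ℂ} {N n : ℤ} {x : ℝ}

theorem den_eq_one_add_inv (θ : ℤ → ℤ → ℝ → ℂ) (N m n : ℤ) (x : ℝ) : den θ N m n x = 1 +
    (Complex.exp ((θ (N + 1) m x - θ N m x) - (θ (N + 1) n x - θ N n x)))⁻¹ := by
  rw [den, ← Complex.exp_neg]
  congr 2
  ring

theorem one_add_exp_ne_zero {N m n : ℤ} {x : ℝ} (h : den θ N m n x ≠ 0) :
    1 + Complex.exp ((θ (N + 1) m x - θ N m x) - (θ (N + 1) n x - θ N n x)) ≠ 0 := fun h0 => h <| by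
  have := Complex.exp_ne_zero ((θ (N + 1) m x - θ N m x) - (θ (N + 1) n x - θ N n x))
  rw [den_eq_one_add_inv]
  field_simp
  linear_combination h0

theorem den_swap (θ : ℤ → ℤ → ℝ → ℂ) (N m n : ℤ) (x : ℝ) : den θ N n m x = 1 +
    Complex.exp ((θ (N + 1) m x - θ N m x) - (θ (N + 1) n x - θ N n x)) := by
  rw [den]
  congr 2
  ring

theorem laxB_eq (p : ℂ) (v θ φ : ℤ → ℤ → ℝ → ℂ) (N n : ℤ) (x : ℝ) : laxB p v θ φ N n x =
    amp p v N (n + 1) x / den θ N n (n + 1) x * φ (N + 1) n x - φ N (n + 1) x -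
      amp p v N (n + 1) x / den θ N (n + 1) n x * φ N n x := by
  rw [laxB, den_swap θ N (n + 1) n, den, amp]

theorem hasDerivAt_den (hθ : ∀ M m, HasDerivAt (θ M m) (v M m x) x) (N m n : ℤ) :
    HasDerivAt (den θ N m n) ((den θ N m n x - 1) *
      ((v N m x - v (N + 1) m x) - (v N n x - v (N + 1) n x))) x := by
  have h := ((((hθ N m).sub (hθ (N + 1) m)).sub ((hθ N n).sub (hθ (N + 1) n))).cexp).const_add 1
  refine h.congr_deriv ?_
  simp [den]

/-- The difference of the two sides of the semi-discrete equation at `(N, n + 1, x)`, times the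
amplitude. -/
def defect (p : ℂ) (v θ : ℤ → ℤ → ℝ → ℂ) (N n : ℤ) (x : ℝ) : ℂ :=
  deriv (amp p v N (n + 1)) x - amp p v N (n + 1) x *
    (v N (n + 2) x - 2 * v N (n + 1) x + v N n x + amp p v N (n + 1) x
      - amp p v N (n + 2) x / den θ N (n + 2) (n + 1) x
      - amp p v N n x / den θ N n (n + 1) x)

theorem holds_iff_defect (hd : DifferentiableAt ℝ (amp p v N (n + 1)) x)
    (h0 : amp p v N (n + 1) x ≠ 0) : Holds p v θ N (n + 1) x ↔ defect p v θ N n x = 0 := by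
  have e1 : n + 1 + 1 = n + 2 := by ring
  have e2 : n + 1 - 1 = n := by ring
  rw [Holds, e1, e2, defect, sub_eq_zero, logDeriv_apply, div_eq_iff h0, mul_comm (amp p v N _ x)]
  exact and_iff_right hd

/-- Once the Lax equations have been used for every derivative and for `φ̃_{n+1}`, `φ̃_{n+2}`, only
an identity of rational functions in two exponentials is left. The remainder isolates how
compatibility fails off the equation. -/
theorem hasDerivAt_laxB (hθ : ∀ M m, HasDerivAt (θ M m) (v M m x) x)
    (hd : DifferentiableAt ℝ (amp p v N (n + 1)) x) (hn : den θ N (n + 1) n x ≠ 0)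
    (hn' : den θ N (n + 2) (n + 1) x ≠ 0)
    (h0 : HasDerivAt (φ N n) (laxA v φ N n x) x)
    (h1 : HasDerivAt (φ N (n + 1)) (laxA v φ N (n + 1) x) x)
    (h2 : HasDerivAt (φ (N + 1) n) (laxA v φ (N + 1) n x) x)
    (e1 : φ (N + 1) (n + 1) x = laxB p v θ φ N n x)
    (e2 : φ (N + 1) (n + 2) x = laxB p v θ φ N (n + 1) x) :
    HasDerivAt (laxB p v θ φ N n) (laxA v φ (N + 1) (n + 1) x +
      defect p v θ N n x / den θ N n (n + 1) x * (φ (N + 1) n x -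
        (den θ N n (n + 1) x - 1) * φ N n x)) x := by
  have d1 := hasDerivAt_den hθ N (n + 1) n
  have d2 := hasDerivAt_den hθ N n (n + 1)
  have hE : den θ N n (n + 1) x ≠ 0 := by
    rw [den_swap θ N (n + 1) n]
    exact one_add_exp_ne_zero hn
  have hG : den θ N (n + 1) (n + 2) x ≠ 0 := by
    rw [den_swap θ N (n + 2) (n + 1)]
    exact one_add_exp_ne_zero hn'
  have key := (((hd.hasDerivAt.div d2 hE).mul h2).sub h1).sub ((hd.hasDerivAt.div d1 hn).mul h0)
  have hfun : laxB p v θ φ N n = _ := funext fun y => laxB_eq p v θ φ N n y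
  rw [hfun]
  refine key.congr_deriv ?_
  have n11 : n + 1 + 1 = n + 2 := by ring
  rw [laxB_eq] at e1 e2
  rw [n11] at e2
  have x1 := den_eq_one_add_inv θ N (n + 1) n x
  have y1 := den_swap θ N (n + 1) n x
  have x2 := den_eq_one_add_inv θ N (n + 2) (n + 1) x
  have y2 := den_swap θ N (n + 2) (n + 1) x
  have hE0 := Complex.exp_ne_zero
    ((θ (N + 1) (n + 1) x - θ N (n + 1) x) - (θ (N + 1) n x - θ N n x))
  have hG0 := Complex.exp_ne_zero
    ((θ (N + 1) (n + 2) x - θ N (n + 2) x) - (θ (N + 1) (n + 1) x - θ N (n + 1) x))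
  generalize Complex.exp
    ((θ (N + 1) (n + 1) x - θ N (n + 1) x) - (θ (N + 1) n x - θ N n x)) = E at *
  generalize Complex.exp
    ((θ (N + 1) (n + 2) x - θ N (n + 2) x) - (θ (N + 1) (n + 1) x - θ N (n + 1) x)) = G at *
  have x1' : den θ N (n + 1) n x = (1 + E) / E := by rw [x1]; field_simp; ring
  have x2' : den θ N (n + 2) (n + 1) x = (1 + G) / G := by rw [x2]; field_simp; ring
  rw [y1] at hE
  rw [y2] at hG
  simp only [laxA, n11, Pi.div_apply]
  rw [e2, e1]
  simp only [defect, y1, y2, x1', x2']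
  generalize deriv (amp p v N (n + 1)) x = w
  simp only [amp]
  field_simp
  ring

theorem compatible_iff_holds (hθ : ∀ M m, HasDerivAt (θ M m) (v M m x) x)
    (hv : ∀ M m, DifferentiableAt ℝ (v M m) x) (h0 : amp p v N (n + 1) x ≠ 0)
    (hn : den θ N (n + 1) n x ≠ 0) (hn' : den θ N (n + 2) (n + 1) x ≠ 0) :
    Compatible p v θ N n x ↔ Holds p v θ N (n + 1) x := by
  have hd : DifferentiableAt ℝ (amp p v N (n + 1)) x :=
    ((differentiableAt_const _).add (hv _ _)).sub (hv _ _)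
  rw [holds_iff_defect hd h0]
  constructor
  · intro hc
    have hE : den θ N n (n + 1) x ≠ 0 := by
      rw [den_swap θ N (n + 1) n]
      exact one_add_exp_ne_zero hn
    -- A test wave function: zero at `N`, with `φ̃_n = 1` at `x`. The discrete equation forces the
    -- values `A` and `A' A` of its shifts, and the continuous one forces the slope `c`. The
    -- remainder is then the defect over a nonzero denominator.
    set A : ℂ := amp p v N (n + 1) x / den θ N n (n + 1) x with hA
    set A' : ℂ := amp p v N (n + 2) x / den θ N (n + 1) (n + 2) x with hA'
    set c : ℂ := A + (v (N + 1) (n + 1) x - v (N + 1) n x) with hcdef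
    set φ : ℤ → ℤ → ℝ → ℂ := fun M m y =>
      if M = N then 0 else if m = n then 1 + c * (y - x) else
        if m = n + 1 then A else if m = n + 2 then A' * A else 0 with hφ
    have hN : N + 1 ≠ N := by omega
    have φ0 : ∀ m, φ N m = fun _ => 0 := fun m => by funext y; simp [hφ]
    have φ10 : φ (N + 1) n = fun y : ℝ => 1 + c * ((y : ℂ) - x) := by funext y; simp [hφ]
    have φ11 : φ (N + 1) (n + 1) = fun _ => A := by funext y; simp [hφ]
    have φ12 : φ (N + 1) (n + 2) = fun _ => A' * A := by funext y; simp [hφ]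
    have n11 : n + 1 + 1 = n + 2 := by ring
    have h0 : HasDerivAt (φ N n) (laxA v φ N n x) x := by
      simpa [laxA, φ0] using hasDerivAt_const x (0 : ℂ)
    have h1 : HasDerivAt (φ N (n + 1)) (laxA v φ N (n + 1) x) x := by
      simpa [laxA, φ0] using hasDerivAt_const x (0 : ℂ)
    have h2 : HasDerivAt (φ (N + 1) n) (laxA v φ (N + 1) n x) x := by
      have h3 : HasDerivAt (fun y : ℝ => (y : ℂ) - x) 1 x := by
        simpa using (hasDerivAt_id x).ofReal_comp.sub_const (x : ℂ)
      rw [φ10, laxA, φ11, φ10]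
      refine ((h3.const_mul c).const_add 1).congr_deriv ?_
      simp [hcdef]
    have e1 : φ (N + 1) (n + 1) x = laxB p v θ φ N n x := by
      rw [laxB_eq, φ11, φ10, φ0, φ0]
      simp [hA]
    have e2 : φ (N + 1) (n + 2) x = laxB p v θ φ N (n + 1) x := by
      rw [laxB_eq, n11, φ12, φ11, φ0, φ0]
      simp [hA']
    have huniq := (hasDerivAt_laxB hθ hd hn hn' h0 h1 h2 e1 e2).unique (hc φ h0 h1 h2 e1 e2)
    rw [add_eq_left, φ10, φ0] at huniq
    simpa [hE] using huniq
  · intro hdef φ h0 h1 h2 e1 e2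
    have := hasDerivAt_laxB hθ hd hn hn' h0 h1 h2 e1 e2
    rwa [hdef, zero_div, zero_mul, add_zero] at this

end SemiDiscreteKP

/-! ### Logarithms -/

/-- A continuously differentiable function without zeros on an open subset of the real line has a
differentiable logarithm there. -/
theorem exists_hasDerivAt_log {τ τ' : ℝ → ℂ} {R : Set ℝ} (hR : IsOpen R)
    (hd : ∀ x ∈ R, HasDerivAt τ (τ' x) x) (hc : ∀ x ∈ R, ContinuousAt τ' x)
    (h0 : ∀ x ∈ R, τ x ≠ 0) :
    ∃ θ : ℝ → ℂ, ∀ x ∈ R, HasDerivAt θ (τ' x / τ x) x ∧ Complex.exp (θ x) = τ x := by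
  classical
  -- The base point is a function of the component as a set, so a single primitive is used
  -- throughout each component.
  set pick : Set ℝ → ℝ := fun s => if h : s.Nonempty then h.some else 0 with hpick
  have hpick_mem : ∀ s : Set ℝ, s.Nonempty → pick s ∈ s := fun s hs => by
    simp only [hpick, dif_pos hs]
    exact hs.some_mem
  set θ : ℝ → ℂ := fun x => Complex.log (τ (pick (connectedComponentIn R x))) +
    ∫ y in (pick (connectedComponentIn R x))..x, τ' y / τ y with hθ
  have hder : ∀ x ∈ R, HasDerivAt θ (τ' x / τ x) x := by
    intro x hx
    set C := connectedComponentIn R x with hC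
    have hxC : x ∈ C := mem_connectedComponentIn hx
    have hCR : C ⊆ R := connectedComponentIn_subset R x
    have hCo : IsOpen C := hR.connectedComponentIn
    have hb : pick C ∈ C := hpick_mem C ⟨x, hxC⟩
    have hcont : ∀ y ∈ R, ContinuousAt (fun y => τ' y / τ y) y := fun y hy =>
      (hc y hy).div (hd y hy).continuousAt (h0 y hy)
    have hsub : Set.uIcc (pick C) x ⊆ C :=
      isPreconnected_connectedComponentIn.ordConnected.uIcc_subset hb hxC
    have hint : IntervalIntegrable (fun y => τ' y / τ y) volume (pick C) x :=
      ContinuousOn.intervalIntegrable fun y hy => (hcont y (hCR (hsub hy))).continuousWithinAt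
    have hmeas : StronglyMeasurableAtFilter (fun y => τ' y / τ y) (nhds x) volume :=
      ContinuousAt.stronglyMeasurableAtFilter hR hcont x hx
    have h1 := (intervalIntegral.integral_hasDerivAt_right hint hmeas (hcont x hx)).const_add
      (Complex.log (τ (pick C)))
    refine h1.congr_of_eventuallyEq ?_
    filter_upwards [hCo.mem_nhds hxC] with y hy
    simp only [hθ]
    rw [← connectedComponentIn_eq hy]
  refine ⟨θ, fun x hx => ⟨hder x hx, ?_⟩⟩
  set C := connectedComponentIn R x with hC
  have hxC : x ∈ C := mem_connectedComponentIn hx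
  have hCR : C ⊆ R := connectedComponentIn_subset R x
  have hCo : IsOpen C := hR.connectedComponentIn
  have hb : pick C ∈ C := hpick_mem C ⟨x, hxC⟩
  -- On the component `exp(-θ) τ` is constant, and the logarithm at the base point makes the
  -- constant `1`.
  have hder0 : ∀ y ∈ C, HasDerivAt (fun y => Complex.exp (-θ y) * τ y) 0 y := fun y hy => by
    refine (((hder y (hCR hy)).neg.cexp).mul (hd y (hCR hy))).congr_deriv ?_
    have := h0 y (hCR hy)
    field_simp
    ring
  have hconst := hCo.is_const_of_deriv_eq_zero isPreconnected_connectedComponentIn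
    (fun y hy => (hder0 y hy).differentiableAt.differentiableWithinAt)
    (fun y hy => (hder0 y hy).deriv) hb hxC
  have hθb : θ (pick C) = Complex.log (τ (pick C)) := by
    simp only [hθ]
    rw [← connectedComponentIn_eq hb, intervalIntegral.integral_same, add_zero]
  rw [hθb, Complex.exp_neg, Complex.exp_log (h0 _ (hCR hb)), inv_mul_cancel₀ (h0 _ (hCR hb)),
    Complex.exp_neg] at hconst
  have := Complex.exp_ne_zero (θ x)
  field_simp at hconst
  exact hconst

/-! ### The Lax pair and the semi-discrete equation for the potential. -/

namespace DirectLin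

/-- Subscripts `1` and `0` stand for `n + 1` and `n - 1`. By `h₀`, `V = p B d / B₀`; the left-hand
side is its derivative by the quotient rule, with the evolution of `B`, `B₀` and `d` inserted, and
`h₁` eliminates `B₁`. -/
theorem logDeriv_amp_algebra {p B B₁ B₀ V V₁ V₀ d d₁ v v₁ v₀ w w₁ w₀ : ℂ}
    (hB₀ : B₀ ≠ 0) (hd : d ≠ 0) (hV : V = 2 * p + v - w) (hV₁ : V₁ = 2 * p + v₁ - w₁)
    (hV₀ : V₀ = 2 * p + v₀ - w₀) (h₁ : p * B₁ = B * (V₁ - V₁ / d₁)) (h₀ : B₀ * V = p * B * d) :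
    ((p * (p * B₁ + (w₁ - w - p) * B) * d + p * B * ((d - 1) * ((v₀ - w₀) - (v - w)))) * B₀ -
        p * B * d * (p * B + (w - w₀ - p) * B₀)) / B₀ ^ 2 =
      (v₁ - 2 * v + v₀ + V - V₁ / d₁ - V₀ / d) * V := by
  have hw : w = 2 * p + v - V := by rw [hV]; ring
  have hw₁ : w₁ = 2 * p + v₁ - V₁ := by rw [hV₁]; ring
  have hw₀ : w₀ = 2 * p + v₀ - V₀ := by rw [hV₀]; ring
  have hp : p * B = B₀ * V / d := by rw [eq_div_iff hd, h₀]
  rw [h₁]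
  generalize V₁ / d₁ = r
  have : (p * (B * (V₁ - r) + (w₁ - w - p) * B) * d +
      p * B * ((d - 1) * ((v₀ - w₀) - (v - w)))) * B₀ -
        p * B * d * (p * B + (w - w₀ - p) * B₀) =
      ((p * B) * (V₁ - r + w₁ - w - p) * d +
      p * B * ((d - 1) * ((v₀ - w₀) - (v - w)))) * B₀ -
        p * B * d * (p * B + (w - w₀ - p) * B₀) := by ring
  rw [this, hp, hw, hw₁, hw₀]
  field_simp
  ring

variable {S : Data} {K : Set ℂ} {J : Set ℝ} {g g₀ g' : ℂ → ℝ}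
  {u : ℤ → ℤ → ℝ → ℂ → ℤ → ℂ} {θ : ℤ → ℤ → ℝ → ℂ} {N n : ℤ} {x : ℝ}

theorem exp_sub_sub_sub (hθ : IsInvDeriv S J (potential S u 0 0) θ) {M₁ m₁ M₂ m₂ M₃ m₃ M₄ m₄ : ℤ}
    (h₁ : Regular S J M₁ m₁ x) (h₂ : Regular S J M₂ m₂ x) (h₃ : Regular S J M₃ m₃ x)
    (h₄ : Regular S J M₄ m₄ x) :
    Complex.exp ((θ M₁ m₁ x - θ M₂ m₂ x) - (θ M₃ m₃ x - θ M₄ m₄ x)) =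
      tau S M₁ m₁ x / tau S M₂ m₂ x / (tau S M₃ m₃ x / tau S M₄ m₄ x) := by
  rw [Complex.exp_sub, Complex.exp_sub, Complex.exp_sub, (hθ _ _ _ h₁).2, (hθ _ _ _ h₂).2,
    (hθ _ _ _ h₃).2, (hθ _ _ _ h₄).2]

theorem Weights.exists_isInvDeriv (W : Weights S K J (insert (S.p 0) K) g g') (hJ : IsOpen J)
    (hu : ∀ N n x, Regular S J N n x → IsSolution S K N n x (u N n x)) :
    ∃ θ, IsInvDeriv S J (potential S u 0 0) θ := by
  have key : ∀ N n, ∃ θ : ℝ → ℂ, ∀ x ∈ {x | Regular S J N n x},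
      HasDerivAt θ (tauDeriv S N n x / tau S N n x) x ∧ Complex.exp (θ x) = tau S N n x :=
    fun N n => exists_hasDerivAt_log
      (isOpen_iff_mem_nhds.2 fun x hx => W.eventually_regular hJ hx)
      (fun x hx => W.hasDerivAt_tau hJ hx.1) (fun x hx => W.continuousAt_tauDeriv hJ hx.1)
      fun x hx => hx.2
  choose θ hθ using key
  refine ⟨θ, fun N n x hx => ⟨?_, (hθ N n x hx).2⟩⟩
  have h := (hθ N n x hx).1
  rwa [W.tauDeriv_eq hx.1 (hu N n x hx), mul_div_cancel_left₀ _ hx.2] at h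

theorem Weights.hasDerivAt_solution (W : Weights S K J (insert (S.p 0) K) g g') (hJ : IsOpen J)
    (hu : ∀ N n x, Regular S J N n x → IsSolution S K N n x (u N n x))
    (h0 : Regular S J N n x) (h1 : Regular S J N (n + 1) x) {k : ℂ} (hk : k ∈ K) :
    HasDerivAt (fun y => u N n y k 0)
      (SemiDiscreteKP.laxA (potential S u 0 0) (fun N n x => u N n x k 0) N n x) x := by
  have hkT := Set.mem_insert_of_mem (S.p 0) hk
  have ha := W.hasDerivAt_amplitude hJ (fun y hy => hu N n y hy) h0 hkT
  refine (((hasDerivAt_rho (S := S) N n x k).mul ha).congr_deriv ?_).congr_of_eventuallyEq ?_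
  · have h := W.mul_amplitude h0 (hu _ _ _ h0) (hu _ _ _ h1) hkT
    simp only [SemiDiscreteKP.laxA]
    rw [(hu _ _ _ h0).eq_rho_mul W.admissible 0 hk, (hu _ _ _ h1).eq_rho_mul W.admissible 0 hk,
      rho_add_one (W.admissible.nonSing_left k hk)]
    linear_combination (-rho S N n x k) * h
  · filter_upwards [W.eventually_regular hJ h0] with y hy
    exact (hu _ _ _ hy).eq_rho_mul W.admissible 0 hk

section discrete

variable (W₀ : Weights S K J K g g₀) (W : Weights S K J (insert (S.p 0) K) g g')
  (hb : ∃ b : ℕ, ∀ k, g₀ k = size k ^ b)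
  (hu : ∀ N n x, Regular S J N n x → IsSolution S K N n x (u N n x))
  (hθ : IsInvDeriv S J (potential S u 0 0) θ)
include W₀ W hb hu hθ

/-- The relation between the amplitude of the semi-discrete equation and `atLattice`. -/
theorem atLattice_mul_amp_eq (h00 : Regular S J N n x) (h01 : Regular S J N (n + 1) x)
    (h10 : Regular S J (N + 1) n x) (h11 : Regular S J (N + 1) (n + 1) x) :
    atLattice S u N n x * SemiDiscreteKP.amp (S.p 0) (potential S u 0 0) N (n + 1) x =
      S.p 0 * atLattice S u N (n + 1) x * SemiDiscreteKP.den θ N n (n + 1) x := by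
  have h := W₀.atLattice_mul_amp W hb hu h00 h01 h10 h11
  rw [SemiDiscreteKP.den, exp_sub_sub_sub hθ h00 h10 h01 h11]
  have := h00.2
  have := h01.2
  have := h10.2
  have := h11.2
  field_simp
  linear_combination h

theorem solution_eq_laxB (h00 : Regular S J N n x) (h01 : Regular S J N (n + 1) x)
    (h10 : Regular S J (N + 1) n x) (h11 : Regular S J (N + 1) (n + 1) x)
    (hden : SemiDiscreteKP.den θ N (n + 1) n x ≠ 0) {k : ℂ} (hk : k ∈ K) :
    u (N + 1) (n + 1) x k 0 = SemiDiscreteKP.laxB (S.p 0) (potential S u 0 0) θ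
      (fun N n x => u N n x k 0) N n x := by
  have hrel := atLattice_mul_amp_eq W₀ W hb hu hθ h00 h01 h10 h11
  have hE : SemiDiscreteKP.den θ N n (n + 1) x ≠ 0 := by
    rw [SemiDiscreteKP.den_swap θ N (n + 1) n]
    exact SemiDiscreteKP.one_add_exp_ne_zero hden
  have h4 := W₀.four_term W hb hu h00 h01 h10 h11 (c := 1)
    (A := SemiDiscreteKP.amp (S.p 0) (potential S u 0 0) N (n + 1) x /
      SemiDiscreteKP.den θ N n (n + 1) x) (by field_simp; linear_combination hrel) hk
  -- The two denominators are `1 + E` and `1 + 1/E`, whose reciprocals add up to one. This turns the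
  -- last coefficient of the four-term relation into that of the Lax equation.
  have hx1 : 1 / SemiDiscreteKP.den θ N (n + 1) n x =
      1 - 1 / SemiDiscreteKP.den θ N n (n + 1) x := by
    have h1 := SemiDiscreteKP.den_eq_one_add_inv θ N (n + 1) n x
    have h2 := SemiDiscreteKP.den_swap θ N (n + 1) n x
    have h3 := Complex.exp_ne_zero
      ((θ (N + 1) (n + 1) x - θ N (n + 1) x) - (θ (N + 1) n x - θ N n x))
    generalize Complex.exp
      ((θ (N + 1) (n + 1) x - θ N (n + 1) x) - (θ (N + 1) n x - θ N n x)) = E at *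
    rw [h1] at hden
    have h5 : 1 + E⁻¹ = (1 + E) / E := by field_simp; ring
    rw [h2] at hE
    rw [h1, h2, h5]
    field_simp
    ring
  have hns := W.admissible.nonSing_left k hk
  rw [SemiDiscreteKP.laxB_eq]
  rw [(hu _ _ _ h00).eq_rho_mul W.admissible 0 hk, (hu _ _ _ h01).eq_rho_mul W.admissible 0 hk,
    (hu _ _ _ h10).eq_rho_mul W.admissible 0 hk, (hu _ _ _ h11).eq_rho_mul W.admissible 0 hk,
    rho_shift hns, rho_shift hns, rho_add_one hns, div_eq_mul_one_div _
      (SemiDiscreteKP.den θ N (n + 1) n x), hx1]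
  linear_combination (rho S N n x k) * h4

omit W₀ hb hθ in
-- The amplitude evolves by the same law at `k = p₁` as on `K`; the enlarged weights were introduced
-- so that this point is allowed.
theorem hasDerivAt_atLattice (hJ : IsOpen J) (h10 : Regular S J (N + 1) n x)
    (h11 : Regular S J (N + 1) (n + 1) x) :
    HasDerivAt (atLattice S u N n) (S.p 0 * atLattice S u N (n + 1) x +
      (potential S u 0 0 (N + 1) (n + 1) x - potential S u 0 0 (N + 1) n x - S.p 0) *
        atLattice S u N n x) x := by
  have hp := Set.mem_insert (S.p 0) K
  refine (W.hasDerivAt_amplitude hJ (fun y hy => hu _ _ y hy) h10 hp).congr_deriv ?_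
  have h := W.mul_amplitude h10 (hu _ _ _ h10) (hu _ _ _ h11) hp
  rw [atLattice, atLattice, h]
  ring

theorem holds_of_regular (hJ : IsOpen J)
    (hreg : ∀ M ∈ ({N, N + 1} : Set ℤ), ∀ m ∈ ({n - 1, n, n + 1} : Set ℤ), Regular S J M m x)
    (hamp : SemiDiscreteKP.amp (S.p 0) (potential S u 0 0) N n x ≠ 0)
    (hden : SemiDiscreteKP.den θ N (n + 1) n x ≠ 0)
    (hden' : SemiDiscreteKP.den θ N (n - 1) n x ≠ 0) :
    SemiDiscreteKP.Holds (S.p 0) (potential S u 0 0) θ N n x := by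
  have r0m : Regular S J N (n - 1) x := hreg _ (by simp) _ (by simp)
  have r00 : Regular S J N n x := hreg _ (by simp) _ (by simp)
  have r01 : Regular S J N (n + 1) x := hreg _ (by simp) _ (by simp)
  have r1m : Regular S J (N + 1) (n - 1) x := hreg _ (by simp) _ (by simp)
  have r10 : Regular S J (N + 1) n x := hreg _ (by simp) _ (by simp)
  have r11 : Regular S J (N + 1) (n + 1) x := hreg _ (by simp) _ (by simp)
  have hp := W.admissible.p_ne_zero
  have hrel : ∀ y, Regular S J N (n - 1) y → Regular S J N n y → Regular S J (N + 1) (n - 1) y →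
      Regular S J (N + 1) n y →
      atLattice S u N (n - 1) y * SemiDiscreteKP.amp (S.p 0) (potential S u 0 0) N n y =
        S.p 0 * atLattice S u N n y * SemiDiscreteKP.den θ N (n - 1) n y := by
    intro y a b c d
    have := atLattice_mul_amp_eq (n := n - 1) W₀ W hb hu hθ a (by simpa using b) c (by simpa using d)
    simpa using this
  have hrel' := atLattice_mul_amp_eq W₀ W hb hu hθ r00 r01 r10 r11
  have hB : atLattice S u N n x ≠ 0 := fun h0 =>
    hamp (W₀.amp_eq_zero_of_atLattice W hb hu r00 r10 h0)
  -- Otherwise the relation at `n - 1` would make a product of nonzero factors vanish.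
  have hB' : atLattice S u N (n - 1) x ≠ 0 := fun h0 => by
    have := hrel x r0m r00 r1m r10
    rw [h0, zero_mul] at this
    exact mul_ne_zero (mul_ne_zero hp hB) hden' this.symm
  have dB := hasDerivAt_atLattice W hu hJ r10 r11
  have dB' : HasDerivAt (atLattice S u N (n - 1)) (S.p 0 * atLattice S u N n x +
      (potential S u 0 0 (N + 1) n x - potential S u 0 0 (N + 1) (n - 1) x - S.p 0) *
        atLattice S u N (n - 1) x) x := by
    have := hasDerivAt_atLattice W hu hJ r1m (by simpa using r10)
    simpa using this
  have dd : HasDerivAt (SemiDiscreteKP.den θ N (n - 1) n)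
      ((SemiDiscreteKP.den θ N (n - 1) n x - 1) *
        ((potential S u 0 0 N (n - 1) x - potential S u 0 0 (N + 1) (n - 1) x) -
          (potential S u 0 0 N n x - potential S u 0 0 (N + 1) n x))) x := by
    have h := (((((hθ _ _ _ r0m).1).sub (hθ _ _ _ r1m).1).sub
      (((hθ _ _ _ r00).1).sub (hθ _ _ _ r10).1)).cexp).const_add 1
    refine h.congr_deriv ?_
    simp [SemiDiscreteKP.den]
  have hder := (((dB.const_mul (S.p 0)).mul dd).div dB' hB')
  -- Differentiation needs the quotient formula near `x` and not only at `x`; regularity and the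
  -- nonvanishing of the denominator are open conditions.
  have heq : SemiDiscreteKP.amp (S.p 0) (potential S u 0 0) N n =ᶠ[nhds x]
      ((fun y => S.p 0 * atLattice S u N n y) * SemiDiscreteKP.den θ N (n - 1) n) /
        atLattice S u N (n - 1) := by
    filter_upwards [W.eventually_regular hJ r0m, W.eventually_regular hJ r00,
      W.eventually_regular hJ r1m, W.eventually_regular hJ r10,
      dB'.continuousAt.eventually_ne hB'] with y a b c d e
    rw [Pi.div_apply, eq_div_iff e, mul_comm, hrel y a b c d]
    rfl
  have hder2 := hder.congr_of_eventuallyEq heq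
  refine ⟨hder2.differentiableAt, ?_⟩
  have hval := hrel x r0m r00 r1m r10
  have hE : SemiDiscreteKP.den θ N n (n + 1) x ≠ 0 := by
    rw [SemiDiscreteKP.den_swap θ N (n + 1) n]
    exact SemiDiscreteKP.one_add_exp_ne_zero hden
  have hx1 : SemiDiscreteKP.den θ N (n + 1) n x * (SemiDiscreteKP.den θ N n (n + 1) x - 1) =
      SemiDiscreteKP.den θ N n (n + 1) x := by
    have h1 := SemiDiscreteKP.den_eq_one_add_inv θ N (n + 1) n x
    have h2 := SemiDiscreteKP.den_swap θ N (n + 1) n x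
    have h3 := Complex.exp_ne_zero
      ((θ (N + 1) (n + 1) x - θ N (n + 1) x) - (θ (N + 1) n x - θ N n x))
    rw [h1, h2]
    field_simp
    ring
  rw [logDeriv_apply, hder2.deriv, div_eq_iff hamp]
  simp only [Pi.mul_apply]
  have hV : SemiDiscreteKP.amp (S.p 0) (potential S u 0 0) N n x = 2 * S.p 0 +
    potential S u 0 0 N n x - potential S u 0 0 (N + 1) n x := rfl
  have hV1 : SemiDiscreteKP.amp (S.p 0) (potential S u 0 0) N (n + 1) x = 2 * S.p 0 +
    potential S u 0 0 N (n + 1) x - potential S u 0 0 (N + 1) (n + 1) x := rfl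
  have hVm : SemiDiscreteKP.amp (S.p 0) (potential S u 0 0) N (n - 1) x = 2 * S.p 0 +
    potential S u 0 0 N (n - 1) x - potential S u 0 0 (N + 1) (n - 1) x := rfl
  have q1 : S.p 0 * atLattice S u N (n + 1) x = atLattice S u N n x *
      (SemiDiscreteKP.amp (S.p 0) (potential S u 0 0) N (n + 1) x -
        SemiDiscreteKP.amp (S.p 0) (potential S u 0 0) N (n + 1) x /
          SemiDiscreteKP.den θ N (n + 1) n x) := by
    have h1 : SemiDiscreteKP.den θ N (n + 1) n x =
        SemiDiscreteKP.den θ N n (n + 1) x / (SemiDiscreteKP.den θ N n (n + 1) x - 1) := by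
      rw [eq_div_iff fun h0 => hE (by rw [← hx1, h0, mul_zero]), hx1]
    refine mul_right_cancel₀ hE (hrel'.symm.trans ?_)
    have h2 := hx1
    generalize SemiDiscreteKP.den θ N (n + 1) n x = d₂ at *
    generalize SemiDiscreteKP.den θ N n (n + 1) x = e at *
    field_simp
    linear_combination SemiDiscreteKP.amp (S.p 0) (potential S u 0 0) N (n + 1) x * (-h2)
  exact logDeriv_amp_algebra hB' hden' hV hV1 hVm q1 hval

end discrete

end DirectLin

end

theorem mainTheorem3 :
    -- the Lax pair of the wave function and the potential of the direct linearisation scheme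
    (∀ (S : DirectLin.Data) (K : Set ℂ) (J : Set ℝ), IsOpen J → DirectLin.Admissible S K J →
      ∀ u : ℤ → ℤ → ℝ → ℂ → ℤ → ℂ,
        (∀ N n x, DirectLin.Regular S J N n x → DirectLin.IsSolution S K N n x (u N n x)) →
      (∀ N n : ℤ, ∀ x ∈ J, Summable (DirectLin.tauTerm S N n x)) ∧
      (∃ θ : ℤ → ℤ → ℝ → ℂ, DirectLin.IsInvDeriv S J (DirectLin.potential S u 0 0) θ) ∧
      (∀ (N n : ℤ) (x : ℝ), DirectLin.Regular S J N n x → DirectLin.Regular S J N (n + 1) x →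
        ∀ k ∈ K, HasDerivAt (fun y => u N n y k 0)
          (SemiDiscreteKP.laxA (DirectLin.potential S u 0 0) (fun N n x => u N n x k 0) N n x)
          x) ∧
      (∀ θ : ℤ → ℤ → ℝ → ℂ, DirectLin.IsInvDeriv S J (DirectLin.potential S u 0 0) θ →
        (∀ (N n : ℤ) (x : ℝ),
          DirectLin.Regular S J N n x → DirectLin.Regular S J N (n + 1) x →
          DirectLin.Regular S J (N + 1) n x → DirectLin.Regular S J (N + 1) (n + 1) x →
          SemiDiscreteKP.den θ N (n + 1) n x ≠ 0 →
          ∀ k ∈ K, u (N + 1) (n + 1) x k 0 =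
            SemiDiscreteKP.laxB (S.p 0) (DirectLin.potential S u 0 0) θ
              (fun N n x => u N n x k 0) N n x) ∧
        (∀ (N n : ℤ) (x : ℝ),
          (∀ M ∈ ({N, N + 1} : Set ℤ), ∀ m ∈ ({n - 1, n, n + 1} : Set ℤ),
            DirectLin.Regular S J M m x) →
          SemiDiscreteKP.amp (S.p 0) (DirectLin.potential S u 0 0) N n x ≠ 0 →
          SemiDiscreteKP.den θ N (n + 1) n x ≠ 0 → SemiDiscreteKP.den θ N (n - 1) n x ≠ 0 →
          SemiDiscreteKP.Holds (S.p 0) (DirectLin.potential S u 0 0) θ N n x))) ∧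
    -- the compatibility condition of the Lax pair is the semi-discrete equation
    (∀ (p : ℂ) (v θ : ℤ → ℤ → ℝ → ℂ) (N n : ℤ) (x : ℝ),
      (∀ M m, HasDerivAt (θ M m) (v M m x) x) → (∀ M m, DifferentiableAt ℝ (v M m) x) →
      SemiDiscreteKP.amp p v N (n + 1) x ≠ 0 →
      SemiDiscreteKP.den θ N (n + 1) n x ≠ 0 →
      SemiDiscreteKP.den θ N (n + 2) (n + 1) x ≠ 0 →
      (SemiDiscreteKP.Compatible p v θ N n x ↔ SemiDiscreteKP.Holds p v θ N (n + 1) x)) := by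
  refine ⟨fun S K J hJ H u hu => ?_, fun p v θ N n x hθ hv h0 hn hn' =>
    SemiDiscreteKP.compatible_iff_holds hθ hv h0 hn hn'⟩
  obtain ⟨g, g₀, g', W₀, W, hb⟩ := H.exists_weights
  have := H.sigmaFinite_dom
  refine ⟨fun N n x hx => ?_, W.exists_isInvDeriv hJ hu,
    fun N n x h0 h1 k hk => W.hasDerivAt_solution hJ hu h0 h1 hk,
    fun θ hθ => ⟨fun N n x h00 h01 h10 h11 hden k hk =>
      DirectLin.solution_eq_laxB W₀ W hb hu hθ h00 h01 h10 h11 hden hk,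
      fun N n x hreg hamp hden hden' =>
        DirectLin.holds_of_regular W₀ W hb hu hθ hJ hreg hamp hden hden'⟩⟩
  exact (W.dominated N n x hx).summable_det.congr fun m => (H.tauTerm_eq N n hx m).symm
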